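/- Let $d\ge 3$ and let $\mathcal H$ be a homogeneous foliation of degree $d$ on $\mathbb P^2_{\mathbb C}$, defined in affine coordinates $(x,y)$ by $$\omega=A(x,y)\,\mathrm dx+B(x,y)\,\mathrm dy,\qquad A,B\in\mathbb C[x,y]_d,\quad \gcd(A,B)=1 .$$ Let $\mathrm{Leg}\,\mathcal H$ be its dual web, i.e. the $d$-web on the dual plane $\check{\mathbb P}^2_{\mathbb C}$ whose leaves are the tangent lines to the leaves of $\mathcal H$; in the affine chart $(p,q)$ of $\check{\mathbb P}^2_{\mathbb C}$ corresponding to the lines $\{y=px-q\}$ it is given by $A(x,px-q)+p\,B(x,px-q)=0$ with $x=\frac{\mathrm dq}{\mathrm dp}$. Its curvature is the meromorphic $2$-form given, near each point off the discriminant, where the web is the superposition of $d$ pairwise transverse foliations $\omega_i=0$, by $\mathrm d\sum_{r<s<t}\eta_{rst}$; here $\eta_{rst}$ is the unique $1$-form with $\mathrm d(\delta_{st}\omega_r)=\eta_{rst}\wedge\delta_{st}\omega_r$, $\mathrm d(\delta_{tr}\omega_s)=\eta_{rst}\wedge\delta_{tr}\omega_s$ and $\mathrm d(\delta_{rs}\omega_t)=\eta_{rst}\wedge\delta_{rs}\omega_t$,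 where $\omega_i\wedge\omega_j=\delta_{ij}\,\mathrm du\wedge\mathrm dv$ in local coordinates $(u,v)$. Let $\mathcal G_{\mathcal H}$ be the Gauss map, sending a regular point $m$ of $\mathcal H$ to the line tangent at $m$ to the leaf through $m$, and let $\widehat G_{\mathcal H}:\mathbb P^1_{\mathbb C}\to\mathbb P^1_{\mathbb C}$ be the rational map $[y:x]\mapsto[-A(x,y):B(x,y)]$. Assume that the line $T=(ax+by=0)$ is a transverse inflection line of $\mathcal H$ of order $\nu-1\ge 1$ (that is, $T$ is not invariant by $\mathcal H$ and has multiplicity exactly $\nu-1$ in the inflection divisor of $\mathcal H$). Suppose moreover that $[-a:b]$ is the only non-fixed critical point of $\widehat G_{\mathcal H}$ in its fiber $\widehat G_{\mathcal H}^{-1}(\widehat G_{\mathcal H}([-a:b]))$. Then $$P(x,y;a,b):=\frac{\begin{vmatrix}A(x,y)&A(b,-a)\\ B(x,y)&B(b,-a)\end{vmatrix}}{(ax+by)^{\nu}}$$ is a polynomial in $x,y$ and, setting $$Q(x,y;a,b):=(\nu-2)\left(\frac{\partial B}{\partial x}-\frac{\partial A}{\partial y}\right)P(x,y;a,b)+2(\nu+1)\begin{vmatrix}\dfrac{\partial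 P}{\partial x}&A(x,y)\\[2mm] \dfrac{\partial P}{\partial y}&B(x,y)\end{vmatrix},$$ the curvature of $\mathrm{Leg}\,\mathcal H$ is holomorphic on $T'=\mathcal G_{\mathcal H}(T)$ (i.e. it extends holomorphically at all but finitely many points of $T'$) if and only if $Q(b,-a;a,b)=0$. -/

import Mathlib

open MvPolynomial
open scoped LinearAlgebra.Projectivization

/-- The complex projective line, with homogeneous coordinates `[z 0 : z 1]`. -/
abbrev ProjLine : Type := ℙ ℂ (Fin 2 → ℂ)

/-- The dual projective plane: `[u : v : w]` is the line `u x + v y + w = 0` of the projective plane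
(in the affine chart `(x, y)`; the line at infinity is `[0 : 0 : 1]`). -/
abbrev DualPlane : Type := ℙ ℂ (Fin 3 → ℂ)

/-! ### Webs on open subsets of `ℂ²`, their fundamental form and curvature

A `1`-form `α du + β dv` on (an open subset of) `ℂ²` with coordinates `(u, v)` is the function
`m ↦ (α m, β m)`. -/

namespace PlanarWeb

/-- Coefficient of `du ∧ dv` in `(θ.1 du + θ.2 dv) ∧ (τ.1 du + τ.2 dv)`. -/
def wedge (θ τ : ℂ × ℂ) : ℂ := θ.1 * τ.2 - θ.2 * τ.1

/-- Coefficient of `du ∧ dv` in the exterior derivative of a `1`-form, at the point `m`. -/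
noncomputable def extD (θ : ℂ × ℂ → ℂ × ℂ) (m : ℂ × ℂ) : ℂ :=
  fderiv ℂ (fun z => (θ z).2) m (1, 0) - fderiv ℂ (fun z => (θ z).1) m (0, 1)

/-- On `V`, the `1`-form `η` is the fundamental form of the `3`-web defined by `ω₁, ω₂, ω₃`:
`d (δ₂₃ ω₁) = η ∧ δ₂₃ ω₁`, `d (δ₃₁ ω₂) = η ∧ δ₃₁ ω₂`, `d (δ₁₂ ω₃) = η ∧ δ₁₂ ω₃`,
where `ωᵢ ∧ ωⱼ = δᵢⱼ du ∧ dv`. -/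
def IsFundamentalForm3 (V : Set (ℂ × ℂ)) (ω₁ ω₂ ω₃ η : ℂ × ℂ → ℂ × ℂ) : Prop :=
  ∀ m ∈ V,
    extD (fun z => wedge (ω₂ z) (ω₃ z) • ω₁ z) m
      = wedge (η m) (wedge (ω₂ m) (ω₃ m) • ω₁ m) ∧
    extD (fun z => wedge (ω₃ z) (ω₁ z) • ω₂ z) m
      = wedge (η m) (wedge (ω₃ m) (ω₁ m) • ω₂ m) ∧
    extD (fun z => wedge (ω₁ z) (ω₂ z) • ω₃ z) m
      = wedge (η m) (wedge (ω₁ m) (ω₂ m) • ω₃ m)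

/-- The linear forms `θ i` are pairwise linearly independent with product the binary form `f`
of degree `d` (a function of the tangent vector). -/
def Factors {d : ℕ} (f : ℂ × ℂ → ℂ) (θ : Fin d → ℂ × ℂ) : Prop :=
  (∀ i j, i ≠ j → wedge (θ i) (θ j) ≠ 0) ∧
    ∀ ξ : ℂ × ℂ, f ξ = ∏ i, ((θ i).1 * ξ.1 + (θ i).2 * ξ.2)

/-- (The support of) the discriminant of the `d`-web given by the `d`-symmetric `1`-form `W`
(`W m ξ` is its value at the point `m` on the tangent vector `ξ`): the points `m` where `W m` is not
a product of `d` pairwise linearly independent `1`-forms. -/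
def discriminant (d : ℕ) (W : ℂ × ℂ → ℂ × ℂ → ℂ) : Set (ℂ × ℂ) :=
  {m | ¬ ∃ θ : Fin d → ℂ × ℂ, Factors (W m) θ}

/-- Near the point `m` the `d`-web `W` is regular and its curvature is `g du ∧ dv`: on a
neighbourhood `V` of `m`, `W` is the superposition of `d` pairwise transverse holomorphic foliations
`ω i = 0`, and `g du ∧ dv = dη` where `η = ∑_{r<s<t} η_{rst}` and `η_{rst}` is the fundamental form
of the `3`-subweb defined by `ω r, ω s, ω t`. -/
def HasCurvatureNear (d : ℕ) (W : ℂ × ℂ → ℂ × ℂ → ℂ) (g : ℂ × ℂ → ℂ) (m : ℂ × ℂ) : Prop :=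
  ∃ (V : Set (ℂ × ℂ)) (ω : Fin d → ℂ × ℂ → ℂ × ℂ)
    (η : Fin d → Fin d → Fin d → ℂ × ℂ → ℂ × ℂ),
    IsOpen V ∧ m ∈ V ∧
    (∀ i, AnalyticOnNhd ℂ (ω i) V) ∧
    (∀ z ∈ V, Factors (W z) (fun i => ω i z)) ∧
    (∀ r s t, r < s → s < t →
      AnalyticOnNhd ℂ (η r s t) V ∧ IsFundamentalForm3 V (ω r) (ω s) (ω t) (η r s t)) ∧
    ∀ z ∈ V,
      g z = extD (fun z' => ∑ r, ∑ s, ∑ t, if r < s ∧ s < t then η r s t z' else 0) z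

/-- The curvature of the `d`-web `W`, a holomorphic `2`-form off the discriminant, extends
holomorphically to a neighbourhood of `m`. -/
def CurvatureHolomorphicAt (d : ℕ) (W : ℂ × ℂ → ℂ × ℂ → ℂ) (m : ℂ × ℂ) : Prop :=
  ∃ (N : Set (ℂ × ℂ)) (g : ℂ × ℂ → ℂ), IsOpen N ∧ m ∈ N ∧ AnalyticOnNhd ℂ g N ∧
    ∀ z ∈ N, z ∉ discriminant d W → HasCurvatureNear d W g z

end PlanarWeb

/-- The line `{y = p x - q}`, where `m = (p, q)`, as a point of the dual plane. -/
noncomputable def dualChart₁ (m : ℂ × ℂ) : DualPlane :=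
  Projectivization.mk ℂ ![m.1, -1, -m.2] (fun h => by simpa using congrFun h 1)

/-- The line `{x = p y - q}`, where `m = (p, q)`, as a point of the dual plane. -/
noncomputable def dualChart₂ (m : ℂ × ℂ) : DualPlane :=
  Projectivization.mk ℂ ![-1, m.1, -m.2] (fun h => by simpa using congrFun h 0)

/-- A homogeneous foliation of degree `d` on the projective plane, defined in the affine chart
`(x, y)` by the `1`-form `A dx + B dy`, with `A`, `B` homogeneous of degree `d`, `gcd (A, B) = 1`.
The variables `x`, `y` are `X 0`, `X 1`. -/
structure HomogeneousFoliation (d : ℕ) where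
  A : MvPolynomial (Fin 2) ℂ
  B : MvPolynomial (Fin 2) ℂ
  homogeneous_A : A.IsHomogeneous d
  homogeneous_B : B.IsHomogeneous d
  gcd_eq_one : IsRelPrime A B

/-- The linear form `a x + b y`. -/
noncomputable def linForm (a b : ℂ) : MvPolynomial (Fin 2) ℂ := C a * X 0 + C b * X 1

namespace HomogeneousFoliation

variable {d : ℕ} (H : HomogeneousFoliation d)

/-! #### The inflection divisor -/

/-- The derivation `Z = B ∂/∂x - A ∂/∂y`: the vector field tangent to the foliation. -/
noncomputable def tangentField (f : MvPolynomial (Fin 2) ℂ) : MvPolynomial (Fin 2) ℂ :=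
  H.B * pderiv 0 f - H.A * pderiv 1 f

/-- Equation in the affine chart `(x, y)` of the inflection divisor of the foliation:
`Z(x) Z(Z(y)) - Z(y) Z(Z(x))`. -/
noncomputable def inflectionPoly : MvPolynomial (Fin 2) ℂ :=
  H.tangentField (X 0) * H.tangentField (H.tangentField (X 1))
    - H.tangentField (X 1) * H.tangentField (H.tangentField (X 0))

/-- The line `a x + b y = 0` is invariant by the foliation: `a x + b y` divides
`(a dx + b dy) ∧ (A dx + B dy)`. -/
def IsInvariantLine (a b : ℂ) : Prop := linForm a b ∣ C a * H.B - C b * H.A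

/-- The line `a x + b y = 0` is a transverse inflection line of order `n ≥ 1`: it is not invariant,
and it is a component of multiplicity `n` of the inflection divisor. -/
def IsTransverseInflectionLine (a b : ℂ) (n : ℕ) : Prop :=
  ¬ H.IsInvariantLine a b ∧ 1 ≤ n ∧ emultiplicity (linForm a b) H.inflectionPoly = n

/-! #### The rational map of the projective line -/

/-- The homogeneous lift `(y, x) ↦ (-A(x, y), B(x, y))`. -/
noncomputable def gaussLift (z : Fin 2 → ℂ) : Fin 2 → ℂ :=
  ![-(eval ![z 1, z 0] H.A), eval ![z 1, z 0] H.B]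

theorem linForm_dvd {f : MvPolynomial (Fin 2) ℂ} (hf : f.IsHomogeneous d) {x y : ℂ}
    (hv : ![x, y] ≠ 0) (h0 : eval ![x, y] f = 0) : linForm y (-x) ∣ f := by
  obtain ⟨i, hi⟩ : ∃ i, ![x, y] i ≠ 0 := by
    by_contra! hcon
    exact hv (funext hcon)
  set c : ℂ := ![x, y] i with hc
  let I : Ideal (MvPolynomial (Fin 2) ℂ) := Ideal.span {linForm y (-x)}
  have key : ∀ j, Ideal.Quotient.mk I (C c * X j) =
      Ideal.Quotient.mk I (C (![x, y] j) * X i) := by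
    intro j
    rw [Ideal.Quotient.eq, Ideal.mem_span_singleton]
    fin_cases i <;> fin_cases j
    · simp [hc]
    · refine ⟨-1, ?_⟩
      simp [linForm, hc]
      ring
    · refine ⟨1, ?_⟩
      simp [linForm, hc]
      ring
    · simp [hc]
  have e1 : ∀ (k : Fin 2 → MvPolynomial (Fin 2) ℂ) (s : MvPolynomial (Fin 2) ℂ),
      ∑ m ∈ f.support, C (f.coeff m) * ∏ j, (s * k j) ^ m j =
        s ^ d * ∑ m ∈ f.support, C (f.coeff m) * ∏ j, k j ^ m j := by
    intro k s
    rw [Finset.mul_sum]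
    refine Finset.sum_congr rfl fun m hm => ?_
    have hd : ∑ j, m j = d := by
      have := hf (MvPolynomial.mem_support_iff.mp hm)
      rw [← this, Finsupp.weight_apply, Finsupp.sum_fintype _ _ (by simp)]
      simp
    simp_rw [mul_pow]
    rw [Finset.prod_mul_distrib, Finset.prod_pow_eq_pow_sum, hd]
    ring
  have e2 : ∑ m ∈ f.support, C (f.coeff m) * ∏ j, (X j : MvPolynomial (Fin 2) ℂ) ^ m j = f := by
    conv_rhs => rw [← MvPolynomial.support_sum_monomial_coeff f]
    refine Finset.sum_congr rfl fun m _ => ?_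
    rw [MvPolynomial.monomial_eq, Finsupp.prod_fintype _ _ (by simp)]
  have e3 : ∑ m ∈ f.support, C (f.coeff m) *
      ∏ j, (C (![x, y] j) : MvPolynomial (Fin 2) ℂ) ^ m j = 0 := by
    rw [← map_zero C, ← h0, MvPolynomial.eval_eq', map_sum]
    refine Finset.sum_congr rfl fun m _ => ?_
    simp only [map_mul, map_prod, map_pow]
  have h1 := e1 X (C c)
  have h2 := e1 (fun j => C (![x, y] j)) (X i)
  rw [e2] at h1
  rw [e3, mul_zero] at h2
  have h3 : Ideal.Quotient.mk I (C c ^ d * f) = 0 := by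
    rw [← h1, ← map_zero (Ideal.Quotient.mk I), ← h2, map_sum, map_sum]
    refine Finset.sum_congr rfl fun m _ => ?_
    rw [map_mul, map_mul, map_prod, map_prod]
    congr 1
    refine Finset.prod_congr rfl fun j _ => ?_
    rw [map_pow, map_pow, key j, mul_comm (X i)]
  rw [Ideal.Quotient.eq_zero_iff_mem, Ideal.mem_span_singleton] at h3
  have hu : IsUnit (C c ^ d : MvPolynomial (Fin 2) ℂ) :=
    ((isUnit_iff_ne_zero.mpr hi).map (C : ℂ →+* MvPolynomial (Fin 2) ℂ)).pow d
  exact (hu.dvd_mul_left).mp h3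

theorem not_isUnit_linForm (a b : ℂ) : ¬ IsUnit (linForm a b) := by
  intro h
  have := h.map (eval (0 : Fin 2 → ℂ))
  simp [linForm] at this

theorem gaussLift_ne_zero {z : Fin 2 → ℂ} (hz : z ≠ 0) : H.gaussLift z ≠ 0 := by
  intro h
  have hA : eval ![z 1, z 0] H.A = 0 := by simpa [gaussLift] using congrFun h 0
  have hB : eval ![z 1, z 0] H.B = 0 := by simpa [gaussLift] using congrFun h 1
  have hv : ![z 1, z 0] ≠ 0 := by
    intro h'
    apply hz
    funext i
    fin_cases i
    · simpa using congrFun h' 1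
    · simpa using congrFun h' 0
  exact not_isUnit_linForm _ _
    (H.gcd_eq_one (linForm_dvd H.homogeneous_A hv hA) (linForm_dvd H.homogeneous_B hv hB))

/-- The rational map `[y : x] ↦ [-A(x, y) : B(x, y)]` of the projective line to itself. -/
noncomputable def gaussMap (z : ProjLine) : ProjLine :=
  Projectivization.mk ℂ (H.gaussLift z.rep) (H.gaussLift_ne_zero z.rep_nonzero)

/-- `z = [y : x]` is a critical point of `gaussMap`: the differential of the map vanishes at `z`,
that is, the differential of the lift `(y, x) ↦ (-A(x, y), B(x, y))` sends every vector `(t, s)`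
to a multiple of `(-A(x, y), B(x, y))` (the tangent space of the projective line at `[u]` being
`ℂ² / ℂ u`). -/
def IsCriticalPoint (z : ProjLine) : Prop :=
  ∀ s t : ℂ,
    ![-(s * eval ![z.rep 1, z.rep 0] (pderiv 0 H.A) + t * eval ![z.rep 1, z.rep 0] (pderiv 1 H.A)),
      s * eval ![z.rep 1, z.rep 0] (pderiv 0 H.B) + t * eval ![z.rep 1, z.rep 0] (pderiv 1 H.B)]
      ∈ Submodule.span ℂ {H.gaussLift z.rep}

/-- The non-fixed critical points of `gaussMap` in the fibre of `gaussMap` through `z₀`. -/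
def nonFixedCriticalPointsInFiber (z₀ : ProjLine) : Set ProjLine :=
  {z | H.gaussMap z = H.gaussMap z₀ ∧ H.IsCriticalPoint z ∧ H.gaussMap z ≠ z}

/-! #### The Gauss map and the dual web -/

/-- The image under the Gauss map `m ↦ T_m` of the line `a x + b y = 0`: the set of tangent lines
`A(m) (X - x) + B(m) (Y - y) = 0` at the regular points `m = (x, y)` of that line. -/
def gaussImageOfLine (a b : ℂ) : Set DualPlane :=
  {ℓ | ∃ (x y : ℂ)
      (h : ![eval ![x, y] H.A, eval ![x, y] H.B,
        -(x * eval ![x, y] H.A + y * eval ![x, y] H.B)] ≠ 0),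
      a * x + b * y = 0 ∧ ℓ = Projectivization.mk ℂ _ h}

/-- The dual web in the chart of the lines `y = p x - q`: the `d`-symmetric `1`-form obtained by
multiplying `A(x, p x - q) + p B(x, p x - q)`, `x = dq/dp`, by `(dp)^d`. Here `m = (p, q)` and
`ξ = (dp, dq)`. -/
noncomputable def leg₁ (m ξ : ℂ × ℂ) : ℂ :=
  eval ![ξ.2, m.1 * ξ.2 - m.2 * ξ.1] H.A + m.1 * eval ![ξ.2, m.1 * ξ.2 - m.2 * ξ.1] H.B

/-- The dual web in the chart of the lines `x = p y - q`: likewise with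
`p A(p y - q, y) + B(p y - q, y)`, `y = dq/dp`. -/
noncomputable def leg₂ (m ξ : ℂ × ℂ) : ℂ :=
  m.1 * eval ![m.1 * ξ.2 - m.2 * ξ.1, ξ.2] H.A + eval ![m.1 * ξ.2 - m.2 * ξ.1, ξ.2] H.B

/-- The equation of the dual web in the first chart. -/
theorem leg₁_eq (p q x : ℂ) :
    H.leg₁ (p, q) (1, x) = eval ![x, p * x - q] H.A + p * eval ![x, p * x - q] H.B := by
  simp [leg₁]

/-- The curvature of the dual web is holomorphic at the point `ℓ` of the dual plane. The two charts
cover the dual plane except the point `[0 : 0 : 1]`. -/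
def LegCurvatureHolomorphicAt (ℓ : DualPlane) : Prop :=
  (∀ m, dualChart₁ m = ℓ → PlanarWeb.CurvatureHolomorphicAt d H.leg₁ m) ∧
    (∀ m, dualChart₂ m = ℓ → PlanarWeb.CurvatureHolomorphicAt d H.leg₂ m)

/-- The curvature of the dual web is holomorphic on the irreducible curve with generic part `D`:
it is holomorphic at all but finitely many points of `D`. -/
def LegCurvatureHolomorphicOn (D : Set DualPlane) : Prop :=
  {ℓ ∈ D | ¬ H.LegCurvatureHolomorphicAt ℓ}.Finite

/-! #### The polynomial of the criterion -/

/-- The determinant with rows `A(x, y), A(b, -a)` and `B(x, y), B(b, -a)`. -/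
noncomputable def fiberPoly (a b : ℂ) : MvPolynomial (Fin 2) ℂ :=
  H.A * C (eval ![b, -a] H.B) - C (eval ![b, -a] H.A) * H.B

/-- `(ν - 2) (∂B/∂x - ∂A/∂y) P + 2 (ν + 1) (∂P/∂x B - A ∂P/∂y)`. -/
noncomputable def criterionPoly (ν : ℕ) (P : MvPolynomial (Fin 2) ℂ) : MvPolynomial (Fin 2) ℂ :=
  C ((ν : ℂ) - 2) * (pderiv 0 H.B - pderiv 1 H.A) * P
    + C (2 * ((ν : ℂ) + 1)) * (pderiv 0 P * H.B - H.A * pderiv 1 P)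

end HomogeneousFoliation

/-! Let `A₀, B₀` be the values of `A, B` at `(b, -a)`. By homogeneity the tangents along `T` are
parallel. If `B₀ ≠ 0`, the curve `T'` is `p = p₀`, `q ≠ 0`, with `p₀ = -A₀ / B₀`. Put `π = p - p₀`,
`F(μ) = (A + p₀ B)(μ, p₀ μ - 1)` and `b(μ) = B(μ, p₀ μ - 1)` (this `b` is a polynomial, not the
coefficient of `T`). The dual web is then given by the forms `q μᵢ dp - (1 + π μᵢ) dq`, where the
`μᵢ(p)` are the roots of `F + π b`.

The fundamental form of three such foliations is, up to a closed form coming from rescaling, `α(p)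
dp + β(p) dq / q`. The curvature of the whole web is therefore `S'(π) / q dp ∧ dq`, where `S`
(`pencilSum`) is a symmetric function of the roots (`HasCurvatureNear.eq_deriv_pencilSum`). By
symmetry `S` is single-valued, and it is analytic for small `π ≠ 0`. Since `π S` has a limit `c₁` at
`0` (`tendsto_mul_pencilSum`), `S` has at most a simple pole, and `S'` extends exactly when `c₁ = 0`
(`IsPencilWeb.curvatureHolomorphicAt_iff`).

To find `c₁`, note that `π = -F(μ) / b(μ)` at a root `μ`, so `π` times each summand is a rational
function of that root. As `π → 0` the roots tend to zeros of `F` or to infinity. Simple zeros and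
infinity contribute nothing. At the multiple zero `μ₀` the function behaves like the weight `F b /
(F' b - F b')` times `c₂ / (μ - μ₀)² + c₁ / (μ - μ₀)`. The weighted sums of these principal parts
over the roots come from the partial fractions of `b / (F + π b)` and its derivative at `μ₀`: the
double pole contributes `0` and the simple one `c₁`. With `F = (X - μ₀)^ν G`, `c₁` is a nonzero
multiple of `2 (ν + 1) G'/G + (ν - 2) b'/b` at `μ₀`, which is `Q(b, -a)` up to a nonzero factor
(`curvatureHolomorphicAt_iff_of_forms`).

The geometric hypotheses supply this picture. The inflection divisor is the product of `x A + y B`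
and the Jacobian of `(A, B)`, up to a constant, so inflection order `ν - 1` means that `ax + by` has
multiplicity `ν` in the fibre polynomial (`exists_fiberPoly_eq`). A fixed point of the Gauss map in
the fibre is the root `μ = ∞`, so having no other non-fixed critical point means that all finite
zeros of `F` except `μ₀` are simple. The case `B₀ = 0` is handled in the other chart by exchanging
`x` and `y`. -/

namespace PlanarWeb

open Filter Topology

/-! ### Exterior derivatives and wedge products of planar forms. -/

theorem fderiv_apply_fst {f : ℂ × ℂ → ℂ} {m : ℂ × ℂ} (hf : DifferentiableAt ℂ f m) :
    fderiv ℂ f m (1, 0) = deriv (fun t => f (t, m.2)) m.1 := by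
  have h : HasDerivAt (fun t : ℂ => (t, m.2)) (1, 0) m.1 :=
    (hasDerivAt_id m.1).prodMk (hasDerivAt_const _ _)
  exact (HasFDerivAt.comp_hasDerivAt (f := fun t : ℂ => (t, m.2)) m.1 (by simpa using hf.hasFDerivAt)
    h).deriv.symm

theorem fderiv_apply_snd {f : ℂ × ℂ → ℂ} {m : ℂ × ℂ} (hf : DifferentiableAt ℂ f m) :
    fderiv ℂ f m (0, 1) = deriv (fun t => f (m.1, t)) m.2 := by
  have h : HasDerivAt (fun t : ℂ => (m.1, t)) (0, 1) m.2 :=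
    (hasDerivAt_const _ _).prodMk (hasDerivAt_id m.2)
  exact (HasFDerivAt.comp_hasDerivAt (f := fun t : ℂ => (m.1, t)) m.2 (by simpa using hf.hasFDerivAt)
    h).deriv.symm

theorem extD_congr {θ τ : ℂ × ℂ → ℂ × ℂ} {m : ℂ × ℂ} (h : θ =ᶠ[𝓝 m] τ) :
    extD θ m = extD τ m := by
  unfold extD
  have h2 : (fun z => (θ z).2) =ᶠ[𝓝 m] fun z => (τ z).2 := h.mono fun z hz => by simp [hz]
  have h1 : (fun z => (θ z).1) =ᶠ[𝓝 m] fun z => (τ z).1 := h.mono fun z hz => by simp [hz]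
  rw [h2.fderiv_eq, h1.fderiv_eq]

theorem extD_add {θ τ : ℂ × ℂ → ℂ × ℂ} {m : ℂ × ℂ} (hθ : DifferentiableAt ℂ θ m)
    (hτ : DifferentiableAt ℂ τ m) : extD (fun z => θ z + τ z) m = extD θ m + extD τ m := by
  unfold extD
  simp only [Prod.snd_add, Prod.fst_add]
  rw [fderiv_fun_add hθ.snd hτ.snd, fderiv_fun_add hθ.fst hτ.fst]
  simp only [add_apply]
  ring

theorem extD_sum {ι : Type*} (s : Finset ι) {θ : ι → ℂ × ℂ → ℂ × ℂ} {m : ℂ × ℂ}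
    (h : ∀ i ∈ s, DifferentiableAt ℂ (θ i) m) :
    extD (fun z => ∑ i ∈ s, θ i z) m = ∑ i ∈ s, extD (θ i) m := by
  unfold extD
  simp only [Prod.snd_sum, Prod.fst_sum]
  rw [fderiv_fun_sum fun i hi => (h i hi).snd, fderiv_fun_sum fun i hi => (h i hi).fst]
  simp [Finset.sum_sub_distrib]

theorem extD_smul {f : ℂ × ℂ → ℂ} {θ : ℂ × ℂ → ℂ × ℂ} {m : ℂ × ℂ} (hf : DifferentiableAt ℂ f m)
    (hθ : DifferentiableAt ℂ θ m) :
    extD (fun z => f z • θ z) m =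
      f m * extD θ m + wedge (fderiv ℂ f m (1, 0), fderiv ℂ f m (0, 1)) (θ m) := by
  unfold extD wedge
  simp only [Prod.smul_snd, Prod.smul_fst, smul_eq_mul]
  rw [fderiv_fun_mul hf hθ.snd, fderiv_fun_mul hf hθ.fst]
  simp
  ring

/-- The logarithmic differential of `f`. -/
noncomputable def dlog (f : ℂ × ℂ → ℂ) (z : ℂ × ℂ) : ℂ × ℂ :=
  (fderiv ℂ f z (1, 0) / f z, fderiv ℂ f z (0, 1) / f z)

theorem analyticAt_fderiv_div {f : ℂ × ℂ → ℂ} {m : ℂ × ℂ} (hf : AnalyticAt ℂ f m) (h0 : f m ≠ 0)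
    (u : ℂ × ℂ) : AnalyticAt ℂ (fun z => fderiv ℂ f z u / f z) m :=
  (((ContinuousLinearMap.apply ℂ ℂ u).analyticAt _).comp hf.fderiv).div hf h0

theorem analyticAt_dlog {f : ℂ × ℂ → ℂ} {m : ℂ × ℂ} (hf : AnalyticAt ℂ f m) (h0 : f m ≠ 0) :
    AnalyticAt ℂ (dlog f) m :=
  (analyticAt_fderiv_div hf h0 _).prod (analyticAt_fderiv_div hf h0 _)

/-- Second derivatives commute. This closedness makes the curvature independent of the choice of the
defining forms. -/
theorem extD_dlog {f : ℂ × ℂ → ℂ} {m : ℂ × ℂ} (hf : AnalyticAt ℂ f m) (h0 : f m ≠ 0) :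
    extD (dlog f) m = 0 := by
  have hs : IsSymmSndFDerivAt ℂ f m :=
    ContDiffAt.isSymmSndFDerivAt_of_omega hf.contDiffAt
  have hd := hf.fderiv.differentiableAt
  have key : ∀ u v : ℂ × ℂ, fderiv ℂ (fun z => fderiv ℂ f z u / f z) m v
      = (fderiv ℂ (fderiv ℂ f) m v u * f m - fderiv ℂ f m u * fderiv ℂ f m v) / f m ^ 2 := by
    intro u v
    have h1 : HasFDerivAt (fun z => fderiv ℂ f z u) ((fderiv ℂ (fderiv ℂ f) m).flip u) m := by
      simpa using hd.hasFDerivAt.clm_apply (hasFDerivAt_const u m)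
    have hg : DifferentiableAt ℂ (fun z => fderiv ℂ f z u / f z) m :=
      (analyticAt_fderiv_div hf h0 u).differentiableAt
    -- The derivative of the quotient is obtained by differentiating quotient times `f`, with the
    -- product rule.
    have h2 : (fun z => fderiv ℂ f z u / f z * f z) =ᶠ[𝓝 m] fun z => fderiv ℂ f z u :=
      (hf.continuousAt.eventually_ne h0).mono fun z hz => div_mul_cancel₀ _ hz
    have h3 := DFunLike.congr_fun (h2.fderiv_eq (𝕜 := ℂ)) v
    rw [h1.fderiv, fderiv_fun_mul hg hf.differentiableAt] at h3
    simp only [add_apply, smul_apply, smul_eq_mul, ContinuousLinearMap.flip_apply] at h3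
    rw [← h3]
    field_simp
    ring
  unfold extD dlog
  simp only
  rw [key, key, hs.eq (1, 0) (0, 1)]
  ring

theorem wedge_smul_left (c : ℂ) (θ τ : ℂ × ℂ) : wedge (c • θ) τ = c * wedge θ τ := by
  simp [wedge]; ring

theorem wedge_smul_right (c : ℂ) (θ τ : ℂ × ℂ) : wedge θ (c • τ) = c * wedge θ τ := by
  simp [wedge]; ring

theorem wedge_add_left (θ θ' τ : ℂ × ℂ) : wedge (θ + θ') τ = wedge θ τ + wedge θ' τ := by
  simp [wedge]; ring

theorem wedge_dlog_smul {f : ℂ × ℂ → ℂ} {z : ℂ × ℂ} (h : f z ≠ 0) (τ : ℂ × ℂ) :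
    wedge (dlog f z) (f z • τ) = wedge (fderiv ℂ f z (1, 0), fderiv ℂ f z (0, 1)) τ := by
  simp only [wedge, dlog, Prod.smul_fst, Prod.smul_snd, smul_eq_mul]
  field_simp

/-- A `1`-form at a point is determined by its wedge products with two independent forms. -/
theorem eq_of_wedge_eq {η η' θ τ : ℂ × ℂ} (h : wedge θ τ ≠ 0) (h1 : wedge η θ = wedge η' θ)
    (h2 : wedge η τ = wedge η' τ) : η = η' := by
  simp only [wedge] at *
  ext
  · apply mul_right_cancel₀ h
    linear_combination θ.1 * h2 - τ.1 * h1
  · apply mul_right_cancel₀ h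
    linear_combination θ.2 * h2 - τ.2 * h1

/-- The fundamental form of a `3`-web is unique where the web is regular. -/
theorem IsFundamentalForm3.unique {V : Set (ℂ × ℂ)} {ω₁ ω₂ ω₃ η η' : ℂ × ℂ → ℂ × ℂ}
    (h : IsFundamentalForm3 V ω₁ ω₂ ω₃ η) (h' : IsFundamentalForm3 V ω₁ ω₂ ω₃ η') {m : ℂ × ℂ}
    (hm : m ∈ V) (h12 : wedge (ω₁ m) (ω₂ m) ≠ 0) (h23 : wedge (ω₂ m) (ω₃ m) ≠ 0)
    (h31 : wedge (ω₃ m) (ω₁ m) ≠ 0) : η m = η' m := by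
  obtain ⟨a1, a2, -⟩ := h m hm
  obtain ⟨b1, b2, -⟩ := h' m hm
  refine eq_of_wedge_eq (θ := wedge (ω₂ m) (ω₃ m) • ω₁ m) (τ := wedge (ω₃ m) (ω₁ m) • ω₂ m) ?_
    (a1.symm.trans b1) (a2.symm.trans b2)
  rw [wedge_smul_left, wedge_smul_right]
  exact mul_ne_zero h23 (mul_ne_zero h31 h12)

/-! ### Three-webs of branches `q m dp - (1 + (p - p₀) m) dq`. -/

/-- The `1`-form `q m(p) dp - (1 + (p - p₀) m(p)) dq`. -/
def branchForm (p₀ : ℂ) (m : ℂ → ℂ) (z : ℂ × ℂ) : ℂ × ℂ :=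
  (z.2 * m z.1, -(1 + (z.1 - p₀) * m z.1))

theorem wedge_branchForm (p₀ : ℂ) (m n : ℂ → ℂ) (z : ℂ × ℂ) :
    wedge (branchForm p₀ m z) (branchForm p₀ n z) = z.2 * (n z.1 - m z.1) := by
  simp [wedge, branchForm]; ring

/-- The contribution of the branch `f` to the `dq / q`-coefficient of the fundamental form of the
`3`-web of the branches `f, g, h`. -/
noncomputable def branchTerm (p₀ : ℂ) (f g h : ℂ → ℂ) (p : ℂ) : ℂ :=
  deriv f p * ((1 + (p - p₀) * g p) / (f p - g p)) * ((1 + (p - p₀) * h p) / (f p - h p))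

/-- The contribution of `f` to the `dp`-coefficient. It depends on `p` alone, hence is invisible to
the curvature. -/
noncomputable def branchTermFst (p₀ : ℂ) (f g h : ℂ → ℂ) (p : ℂ) : ℂ :=
  deriv f p * (f p + (p - p₀) * g p * h p) / ((f p - g p) * (f p - h p))

noncomputable def cycBranchTerm (p₀ : ℂ) (f g h : ℂ → ℂ) (p : ℂ) : ℂ :=
  branchTerm p₀ f g h p + branchTerm p₀ g h f p + branchTerm p₀ h f g p

/-- The shape `α(p) dp + β(p) dq / q` reflects the invariance of the foliations under scaling of
`q`. The constant `3` is irrelevant to the curvature because `dq / q` is closed. -/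
noncomputable def branchFundamentalForm (p₀ : ℂ) (f g h : ℂ → ℂ) (z : ℂ × ℂ) : ℂ × ℂ :=
  (branchTermFst p₀ f g h z.1 + branchTermFst p₀ g h f z.1 + branchTermFst p₀ h f g z.1,
    (3 - cycBranchTerm p₀ f g h z.1) / z.2)

/-- Thanks to this symmetry, one of the three defining equations yields the other two. -/
theorem branchFundamentalForm_cyc (p₀ : ℂ) (f g h : ℂ → ℂ) :
    branchFundamentalForm p₀ g h f = branchFundamentalForm p₀ f g h := by
  funext z
  simp only [branchFundamentalForm, cycBranchTerm]
  ext <;> simp only <;> ring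

theorem differentiableAt_branchForm {p₀ : ℂ} {m : ℂ → ℂ} {z : ℂ × ℂ}
    (hm : DifferentiableAt ℂ m z.1) : DifferentiableAt ℂ (branchForm p₀ m) z := by
  have : DifferentiableAt ℂ (fun z : ℂ × ℂ => m z.1) z := hm.comp z differentiableAt_fst
  unfold branchForm
  fun_prop

/-- A direct computation: after both sides are differentiated, it is a rational identity in `q`, `p
- p₀`, the three branches and their derivatives. -/
theorem extD_branch {p₀ : ℂ} {f g h : ℂ → ℂ} {z : ℂ × ℂ} (hf : DifferentiableAt ℂ f z.1)
    (hg : DifferentiableAt ℂ g z.1) (hh : DifferentiableAt ℂ h z.1) (hz : z.2 ≠ 0)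
    (hfg : f z.1 ≠ g z.1) (hgh : g z.1 ≠ h z.1) (hhf : h z.1 ≠ f z.1) :
    extD (fun w => wedge (branchForm p₀ g w) (branchForm p₀ h w) • branchForm p₀ f w) z =
      wedge (branchFundamentalForm p₀ f g h z)
        (wedge (branchForm p₀ g z) (branchForm p₀ h z) • branchForm p₀ f z) := by
  have hf' : DifferentiableAt ℂ (fun z : ℂ × ℂ => f z.1) z := hf.comp z differentiableAt_fst
  have hg' : DifferentiableAt ℂ (fun z : ℂ × ℂ => g z.1) z := hg.comp z differentiableAt_fst
  have hh' : DifferentiableAt ℂ (fun z : ℂ × ℂ => h z.1) z := hh.comp z differentiableAt_fst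
  unfold extD
  simp only [wedge_branchForm]
  simp only [branchForm, Prod.smul_mk, smul_eq_mul]
  rw [fderiv_apply_fst (by fun_prop), fderiv_apply_snd (by fun_prop)]
  simp only
  have e1 : deriv (fun t => z.2 * (h t - g t) * -(1 + (t - p₀) * f t)) z.1 =
      z.2 * ((deriv h z.1 - deriv g z.1) * -(1 + (z.1 - p₀) * f z.1) +
        (h z.1 - g z.1) * -(f z.1 + (z.1 - p₀) * deriv f z.1)) := by
    have := ((hh.hasDerivAt.sub hg.hasDerivAt).const_mul z.2).mul
      ((((hasDerivAt_id z.1).sub_const p₀).mul hf.hasDerivAt).const_add 1).neg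
    refine (HasDerivAt.deriv (this.congr_deriv ?_))
    simp
    ring
  have e2 : deriv (fun t => t * (h z.1 - g z.1) * (t * f z.1)) z.2 =
      2 * z.2 * (h z.1 - g z.1) * f z.1 := by
    have := (((hasDerivAt_id z.2).mul_const (h z.1 - g z.1))).mul
      ((hasDerivAt_id z.2).mul_const (f z.1))
    refine (HasDerivAt.deriv (this.congr_deriv ?_))
    simp
    ring
  rw [e1, e2]
  have h1 := sub_ne_zero.2 hfg
  have h2 := sub_ne_zero.2 hgh
  have h3 := sub_ne_zero.2 hhf
  simp only [branchFundamentalForm, cycBranchTerm, branchTerm, branchTermFst, wedge]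
  rw [← neg_sub (h z.1) (f z.1), ← neg_sub (f z.1) (g z.1), ← neg_sub (g z.1) (h z.1)]
  generalize deriv f z.1 = f'
  generalize deriv g z.1 = g'
  generalize deriv h z.1 = h'
  generalize z.1 - p₀ = π
  generalize f z.1 = F at *
  generalize g z.1 = G at *
  generalize h z.1 = K at *
  generalize z.2 = q at *
  field_simp
  ring

/-- Rescaling the forms of a `3`-web adds a logarithmic differential to the fundamental form. -/
theorem isFundamentalForm3_smul {p₀ : ℂ} {V : Set (ℂ × ℂ)} {f g h : ℂ → ℂ} {ρ₁ ρ₂ ρ₃ : ℂ × ℂ → ℂ}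
    {ω₁ ω₂ ω₃ : ℂ × ℂ → ℂ × ℂ} (hV : IsOpen V)
    (hf : ∀ z ∈ V, DifferentiableAt ℂ f z.1) (hg : ∀ z ∈ V, DifferentiableAt ℂ g z.1)
    (hh : ∀ z ∈ V, DifferentiableAt ℂ h z.1) (hz : ∀ z ∈ V, z.2 ≠ 0)
    (hfg : ∀ z ∈ V, f z.1 ≠ g z.1) (hgh : ∀ z ∈ V, g z.1 ≠ h z.1) (hhf : ∀ z ∈ V, h z.1 ≠ f z.1)
    (h1 : ∀ z ∈ V, DifferentiableAt ℂ ρ₁ z) (h2 : ∀ z ∈ V, DifferentiableAt ℂ ρ₂ z)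
    (h3 : ∀ z ∈ V, DifferentiableAt ℂ ρ₃ z)
    (h0 : ∀ z ∈ V, ρ₁ z * ρ₂ z * ρ₃ z ≠ 0)
    (e1 : ∀ z ∈ V, ω₁ z = ρ₁ z • branchForm p₀ f z) (e2 : ∀ z ∈ V, ω₂ z = ρ₂ z • branchForm p₀ g z)
    (e3 : ∀ z ∈ V, ω₃ z = ρ₃ z • branchForm p₀ h z) :
    IsFundamentalForm3 V ω₁ ω₂ ω₃
      (fun z => branchFundamentalForm p₀ f g h z + dlog (fun z => ρ₁ z * ρ₂ z * ρ₃ z) z) := by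
  have key : ∀ (θ₁ θ₂ θ₃ : ℂ × ℂ → ℂ × ℂ) (a b c : ℂ × ℂ → ℂ) (u v w : ℂ → ℂ), ∀ z ∈ V,
      (∀ z ∈ V, θ₁ z = a z • branchForm p₀ u z) → (∀ z ∈ V, θ₂ z = b z • branchForm p₀ v z) →
      (∀ z ∈ V, θ₃ z = c z • branchForm p₀ w z) →
      DifferentiableAt ℂ u z.1 → DifferentiableAt ℂ v z.1 → DifferentiableAt ℂ w z.1 →
      u z.1 ≠ v z.1 → v z.1 ≠ w z.1 → w z.1 ≠ u z.1 →
      (∀ z, a z * b z * c z = ρ₁ z * ρ₂ z * ρ₃ z) →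
      extD (fun z => wedge (θ₂ z) (θ₃ z) • θ₁ z) z =
        wedge (branchFundamentalForm p₀ u v w z + dlog (fun z => ρ₁ z * ρ₂ z * ρ₃ z) z)
          (wedge (θ₂ z) (θ₃ z) • θ₁ z) := by
    intro θ₁ θ₂ θ₃ a b c u v w z hzV i1 i2 i3 du dv dw huv hvw hwu habc
    have hR : DifferentiableAt ℂ (fun z => ρ₁ z * ρ₂ z * ρ₃ z) z :=
      ((h1 z hzV).mul (h2 z hzV)).mul (h3 z hzV)
    -- Each of the three forms `δ₂₃ ω₁`, `δ₃₁ ω₂`, `δ₁₂ ω₃` is scaled by the same factor `ρ₁ ρ₂ ρ₃`,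
    -- so a single logarithmic differential corrects all three equations.
    have ev : ∀ z ∈ V, wedge (θ₂ z) (θ₃ z) • θ₁ z = (ρ₁ z * ρ₂ z * ρ₃ z) •
        (wedge (branchForm p₀ v z) (branchForm p₀ w z) • branchForm p₀ u z) := by
      intro y hy
      rw [i1 y hy, i2 y hy, i3 y hy, wedge_smul_left, wedge_smul_right, ← habc, smul_smul, smul_smul]
      ring_nf
    have hτ : DifferentiableAt ℂ
        (fun z => wedge (branchForm p₀ v z) (branchForm p₀ w z) • branchForm p₀ u z) z := by
      simp only [wedge_branchForm]
      have hv' : DifferentiableAt ℂ (fun z : ℂ × ℂ => v z.1) z := dv.comp z differentiableAt_fst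
      have hw' : DifferentiableAt ℂ (fun z : ℂ × ℂ => w z.1) z := dw.comp z differentiableAt_fst
      have := differentiableAt_branchForm (p₀ := p₀) du
      fun_prop
    rw [extD_congr (Filter.eventuallyEq_of_mem (hV.mem_nhds hzV) ev), extD_smul hR hτ,
      extD_branch du dv dw (hz z hzV) huv hvw hwu, ev z hzV, wedge_add_left,
      wedge_dlog_smul (f := fun z => ρ₁ z * ρ₂ z * ρ₃ z) (h0 z hzV),
      wedge_smul_right (ρ₁ z * ρ₂ z * ρ₃ z)]
  intro z hzV
  refine ⟨key _ _ _ _ _ _ _ _ _ z hzV e1 e2 e3 (hf z hzV) (hg z hzV) (hh z hzV) (hfg z hzV)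
    (hgh z hzV) (hhf z hzV) fun _ => rfl, ?_, ?_⟩
  · rw [← branchFundamentalForm_cyc]
    exact key _ _ _ _ _ _ _ _ _ z hzV e2 e3 e1 (hg z hzV) (hh z hzV) (hf z hzV) (hgh z hzV)
      (hhf z hzV) (hfg z hzV) fun _ => by ring
  · rw [← branchFundamentalForm_cyc, ← branchFundamentalForm_cyc]
    exact key _ _ _ _ _ _ _ _ _ z hzV e3 e1 e2 (hh z hzV) (hf z hzV) (hg z hzV) (hhf z hzV)
      (hfg z hzV) (hgh z hzV) fun _ => by ring

theorem analyticAt_branchTerm {p₀ p : ℂ} {f g h : ℂ → ℂ} (hf : AnalyticAt ℂ f p)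
    (hg : AnalyticAt ℂ g p) (hh : AnalyticAt ℂ h p) (hfg : f p ≠ g p) (hfh : f p ≠ h p) :
    AnalyticAt ℂ (branchTerm p₀ f g h) p := by
  have hπ : AnalyticAt ℂ (fun p => p - p₀) p := analyticAt_id.sub analyticAt_const
  exact (hf.deriv.mul ((analyticAt_const.add (hπ.mul hg)).div (hf.sub hg) (sub_ne_zero.2 hfg))).mul
    ((analyticAt_const.add (hπ.mul hh)).div (hf.sub hh) (sub_ne_zero.2 hfh))

theorem analyticAt_branchTermFst {p₀ p : ℂ} {f g h : ℂ → ℂ} (hf : AnalyticAt ℂ f p)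
    (hg : AnalyticAt ℂ g p) (hh : AnalyticAt ℂ h p) (hfg : f p ≠ g p) (hfh : f p ≠ h p) :
    AnalyticAt ℂ (branchTermFst p₀ f g h) p := by
  have hπ : AnalyticAt ℂ (fun p => p - p₀) p := analyticAt_id.sub analyticAt_const
  exact (hf.deriv.mul (hf.add ((hπ.mul hg).mul hh))).div ((hf.sub hg).mul (hf.sub hh))
    (mul_ne_zero (sub_ne_zero.2 hfg) (sub_ne_zero.2 hfh))

theorem analyticAt_cycBranchTerm {p₀ p : ℂ} {f g h : ℂ → ℂ} (hf : AnalyticAt ℂ f p)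
    (hg : AnalyticAt ℂ g p) (hh : AnalyticAt ℂ h p) (hfg : f p ≠ g p) (hgh : g p ≠ h p)
    (hhf : h p ≠ f p) : AnalyticAt ℂ (cycBranchTerm p₀ f g h) p :=
  ((analyticAt_branchTerm hf hg hh hfg hhf.symm).add
    (analyticAt_branchTerm hg hh hf hgh hfg.symm)).add (analyticAt_branchTerm hh hf hg hhf hgh.symm)

theorem analyticAt_branchFundamentalForm {p₀ : ℂ} {z : ℂ × ℂ} {f g h : ℂ → ℂ}
    (hf : AnalyticAt ℂ f z.1) (hg : AnalyticAt ℂ g z.1) (hh : AnalyticAt ℂ h z.1)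
    (hfg : f z.1 ≠ g z.1) (hgh : g z.1 ≠ h z.1) (hhf : h z.1 ≠ f z.1) (hz : z.2 ≠ 0) :
    AnalyticAt ℂ (branchFundamentalForm p₀ f g h) z := by
  refine AnalyticAt.prod ?_ ?_
  · exact AnalyticAt.comp (((analyticAt_branchTermFst hf hg hh hfg hhf.symm).add
      (analyticAt_branchTermFst hg hh hf hgh hfg.symm)).add
      (analyticAt_branchTermFst hh hf hg hhf hgh.symm)) analyticAt_fst
  · exact ((analyticAt_const (v := (3 : ℂ))).sub
      ((analyticAt_cycBranchTerm hf hg hh hfg hgh hhf).comp analyticAt_fst)).div analyticAt_snd hz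

/-- The `dp`-coefficient does not depend on `q`, so only the `p`-derivative of the `dq`-coefficient
survives. -/
theorem extD_branchFundamentalForm {p₀ : ℂ} {z : ℂ × ℂ} {f g h : ℂ → ℂ}
    (hf : AnalyticAt ℂ f z.1) (hg : AnalyticAt ℂ g z.1) (hh : AnalyticAt ℂ h z.1)
    (hfg : f z.1 ≠ g z.1) (hgh : g z.1 ≠ h z.1) (hhf : h z.1 ≠ f z.1) (hz : z.2 ≠ 0) :
    extD (branchFundamentalForm p₀ f g h) z = -(deriv (cycBranchTerm p₀ f g h) z.1 / z.2) := by
  have hd := (analyticAt_branchFundamentalForm (p₀ := p₀) hf hg hh hfg hgh hhf hz).differentiableAt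
  unfold extD
  rw [fderiv_apply_fst hd.snd, fderiv_apply_snd hd.fst]
  simp only [branchFundamentalForm, deriv_const, sub_zero, deriv_div_const]
  rw [deriv_const_sub]
  ring

end PlanarWeb

/-! ### Curvature of a `d`-web of branches. -/

namespace PlanarWeb

open Filter Topology

theorem IsFundamentalForm3.mono {V V' : Set (ℂ × ℂ)} {ω₁ ω₂ ω₃ η : ℂ × ℂ → ℂ × ℂ}
    (h : IsFundamentalForm3 V ω₁ ω₂ ω₃ η) (hV : V' ⊆ V) : IsFundamentalForm3 V' ω₁ ω₂ ω₃ η :=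
  fun m hm => h m (hV hm)

/-- The `dq / q`-coefficient, up to sign and an additive constant, of the fundamental form of the
web of the branches `m i`. -/
noncomputable def totalBranchTerm {d : ℕ} (p₀ : ℂ) (m : Fin d → ℂ → ℂ) (p : ℂ) : ℂ :=
  ∑ r, ∑ s, ∑ t, if r < s ∧ s < t then cycBranchTerm p₀ (m r) (m s) (m t) p else 0

theorem analyticAt_totalBranchTerm {d : ℕ} {p₀ p : ℂ} {m : Fin d → ℂ → ℂ}
    (hm : ∀ i, AnalyticAt ℂ (m i) p) (hinj : ∀ i j, i ≠ j → m i p ≠ m j p) :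
    AnalyticAt ℂ (totalBranchTerm p₀ m) p := by
  unfold totalBranchTerm
  refine Finset.analyticAt_fun_sum _ fun r _ => Finset.analyticAt_fun_sum _ fun s _ =>
    Finset.analyticAt_fun_sum _ fun t _ => ?_
  by_cases h : r < s ∧ s < t
  · simp only [h, and_self, if_true]
    exact analyticAt_cycBranchTerm (hm r) (hm s) (hm t) (hinj _ _ h.1.ne) (hinj _ _ h.2.ne)
      (hinj _ _ (h.1.trans h.2).ne')
  · simp only [h, if_false]
    exact analyticAt_const

theorem deriv_totalBranchTerm {d : ℕ} {p₀ p : ℂ} {m : Fin d → ℂ → ℂ}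
    (hm : ∀ i, AnalyticAt ℂ (m i) p) (hinj : ∀ i j, i ≠ j → m i p ≠ m j p) :
    deriv (totalBranchTerm p₀ m) p = ∑ r, ∑ s, ∑ t, if r < s ∧ s < t then
      deriv (cycBranchTerm p₀ (m r) (m s) (m t)) p else 0 := by
  unfold totalBranchTerm
  have key : ∀ r s t, HasDerivAt
      (fun p => if r < s ∧ s < t then cycBranchTerm p₀ (m r) (m s) (m t) p else 0)
      (if r < s ∧ s < t then deriv (cycBranchTerm p₀ (m r) (m s) (m t)) p else 0) p := by
    intro r s t
    by_cases h : r < s ∧ s < t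
    · simp only [h, and_self, if_true]
      exact (analyticAt_cycBranchTerm (hm r) (hm s) (hm t) (hinj _ _ h.1.ne) (hinj _ _ h.2.ne)
        (hinj _ _ (h.1.trans h.2).ne')).differentiableAt.hasDerivAt
    · simp only [h, if_false]
      exact hasDerivAt_const _ _
  exact (HasDerivAt.fun_sum fun r _ => HasDerivAt.fun_sum fun s _ => HasDerivAt.fun_sum fun t _ =>
    key r s t).deriv

/-- The exterior derivative of the fundamental form of a web of branches. -/
theorem extD_sum_fundamentalForm {d : ℕ} {p₀ : ℂ} {m : Fin d → ℂ → ℂ} {ρ : Fin d → ℂ × ℂ → ℂ}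
    {z : ℂ × ℂ} {η : Fin d → Fin d → Fin d → ℂ × ℂ → ℂ × ℂ}
    (hm : ∀ i, AnalyticAt ℂ (m i) z.1) (hinj : ∀ i j, i ≠ j → m i z.1 ≠ m j z.1) (hz : z.2 ≠ 0)
    (hρ : ∀ i, AnalyticAt ℂ (ρ i) z) (hρ0 : ∀ i, ρ i z ≠ 0)
    (hη : ∀ r s t, r < s → s < t → η r s t =ᶠ[𝓝 z] fun w =>
      branchFundamentalForm p₀ (m r) (m s) (m t) w + dlog (fun z => ρ r z * ρ s z * ρ t z) w) :
    extD (fun w => ∑ r, ∑ s, ∑ t, if r < s ∧ s < t then η r s t w else 0) z =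
      -(deriv (totalBranchTerm p₀ m) z.1 / z.2) := by
  have hb : ∀ r s t, r < s → s < t →
      AnalyticAt ℂ (branchFundamentalForm p₀ (m r) (m s) (m t)) z := fun r s t h1 h2 =>
    analyticAt_branchFundamentalForm (hm r) (hm s) (hm t) (hinj _ _ h1.ne) (hinj _ _ h2.ne)
      (hinj _ _ (h1.trans h2).ne') hz
  have hR : ∀ r s t, AnalyticAt ℂ (fun z => ρ r z * ρ s z * ρ t z) z := fun r s t =>
    ((hρ r).mul (hρ s)).mul (hρ t)
  have hR0 : ∀ r s t, ρ r z * ρ s z * ρ t z ≠ 0 := fun r s t =>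
    mul_ne_zero (mul_ne_zero (hρ0 r) (hρ0 s)) (hρ0 t)
  have hd : ∀ r s t, DifferentiableAt ℂ (fun w => if r < s ∧ s < t then η r s t w else 0) z := by
    intro r s t
    by_cases h : r < s ∧ s < t
    · simp only [h, and_self, if_true]
      refine DifferentiableAt.congr_of_eventuallyEq ?_ (hη r s t h.1 h.2)
      exact ((hb r s t h.1 h.2).add (analyticAt_dlog (hR r s t) (hR0 r s t))).differentiableAt
    · simp only [h, if_false]
      exact differentiableAt_const _
  have key : ∀ r s t, extD (fun w => if r < s ∧ s < t then η r s t w else 0) z =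
      -((if r < s ∧ s < t then deriv (cycBranchTerm p₀ (m r) (m s) (m t)) z.1 else 0) / z.2) := by
    intro r s t
    by_cases h : r < s ∧ s < t
    · simp only [h, and_self, if_true]
      rw [extD_congr (hη r s t h.1 h.2), extD_add (hb r s t h.1 h.2).differentiableAt
        (analyticAt_dlog (hR r s t) (hR0 r s t)).differentiableAt, extD_dlog (hR r s t) (hR0 r s t),
        extD_branchFundamentalForm (hm r) (hm s) (hm t) (hinj _ _ h.1.ne) (hinj _ _ h.2.ne)
      (hinj _ _ (h.1.trans h.2).ne') hz, add_zero]
    · simp [h, extD]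
  rw [extD_sum _ fun r _ => DifferentiableAt.fun_sum fun s _ => DifferentiableAt.fun_sum fun t _ =>
    hd r s t, deriv_totalBranchTerm hm hinj, Finset.sum_div, ← Finset.sum_neg_distrib]
  refine Finset.sum_congr rfl fun r _ => ?_
  rw [extD_sum _ fun s _ => DifferentiableAt.fun_sum fun t _ => hd r s t, Finset.sum_div,
    ← Finset.sum_neg_distrib]
  refine Finset.sum_congr rfl fun s _ => ?_
  rw [extD_sum _ fun t _ => hd r s t, Finset.sum_div, ← Finset.sum_neg_distrib]
  exact Finset.sum_congr rfl fun t _ => key r s t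

/-- A web which is a product of branch forms has the expected curvature. -/
theorem hasCurvatureNear_of_branches {d : ℕ} (hd : 0 < d) {W : ℂ × ℂ → ℂ × ℂ → ℂ} {p₀ : ℂ}
    {U : Set ℂ} (hU : IsOpen U) {m : Fin d → ℂ → ℂ} {c : ℂ → ℂ} {g : ℂ × ℂ → ℂ}
    (hm : ∀ p ∈ U, ∀ i, AnalyticAt ℂ (m i) p) (hinj : ∀ p ∈ U, ∀ i j, i ≠ j → m i p ≠ m j p)
    (hc : ∀ p ∈ U, AnalyticAt ℂ c p) (hc0 : ∀ p ∈ U, c p ≠ 0)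
    (hW : ∀ z : ℂ × ℂ, z.1 ∈ U → z.2 ≠ 0 → ∀ ξ : ℂ × ℂ, W z ξ = c z.1 *
      ∏ i, ((branchForm p₀ (m i) z).1 * ξ.1 + (branchForm p₀ (m i) z).2 * ξ.2))
    (hg : ∀ z : ℂ × ℂ, z.1 ∈ U → z.2 ≠ 0 → g z = -(deriv (totalBranchTerm p₀ m) z.1 / z.2))
    {z : ℂ × ℂ} (hz : z.1 ∈ U) (hz2 : z.2 ≠ 0) : HasCurvatureNear d W g z := by
  let V : Set (ℂ × ℂ) := {z | z.1 ∈ U ∧ z.2 ≠ 0}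
  have hV : IsOpen V := (hU.preimage continuous_fst).inter
    (isOpen_ne.preimage continuous_snd)
  let i₀ : Fin d := ⟨0, hd⟩
  -- The leading factor `c` of the web is absorbed into a single branch; this is why `d` must be
  -- positive.
  let ρ : Fin d → ℂ × ℂ → ℂ := fun i z => if i = i₀ then c z.1 else 1
  have hρ : ∀ i, ∀ z ∈ V, AnalyticAt ℂ (ρ i) z := by
    intro i z hz
    by_cases h : i = i₀
    · simp only [ρ, h, if_true]
      exact (hc z.1 hz.1).comp analyticAt_fst
    · simp only [ρ, h, if_false]
      exact analyticAt_const
  have hρ0 : ∀ i, ∀ z ∈ V, ρ i z ≠ 0 := by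
    intro i z hz
    by_cases h : i = i₀
    · simpa only [ρ, h, if_true] using hc0 z.1 hz.1
    · simp [ρ, h]
  have hbf : ∀ i, ∀ z ∈ V, AnalyticAt ℂ (branchForm p₀ (m i)) z := by
    intro i z hz
    have h1 : AnalyticAt ℂ (fun z : ℂ × ℂ => m i z.1) z := (hm z.1 hz.1 i).comp analyticAt_fst
    exact (analyticAt_snd.mul h1).prod
      (analyticAt_const.add ((analyticAt_fst.sub analyticAt_const).mul h1)).neg
  refine ⟨V, fun i z => ρ i z • branchForm p₀ (m i) z, fun r s t z =>
    branchFundamentalForm p₀ (m r) (m s) (m t) z + dlog (fun z => ρ r z * ρ s z * ρ t z) z,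
    hV, ⟨hz, hz2⟩, fun i z hz => (hρ i z hz).smul (hbf i z hz), ?_, ?_, ?_⟩
  · intro z hz
    refine ⟨fun i j hij => ?_, fun ξ => ?_⟩
    · rw [wedge_smul_left, wedge_smul_right, wedge_branchForm]
      exact mul_ne_zero (hρ0 i z hz) (mul_ne_zero (hρ0 j z hz) (mul_ne_zero hz.2
        (sub_ne_zero.2 (hinj z.1 hz.1 j i hij.symm))))
    · have h1 : ∏ i, ρ i z = c z.1 := by
        simp [ρ]
      rw [hW z hz.1 hz.2, ← h1, ← Finset.prod_mul_distrib]
      refine Finset.prod_congr rfl fun i _ => ?_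
      simp only [Prod.smul_fst, Prod.smul_snd, smul_eq_mul]
      ring
  · intro r s t h1 h2
    refine ⟨fun z hz => (analyticAt_branchFundamentalForm (hm _ hz.1 r) (hm _ hz.1 s) (hm _ hz.1 t)
      (hinj _ hz.1 _ _ h1.ne) (hinj _ hz.1 _ _ h2.ne) (hinj _ hz.1 _ _ (h1.trans h2).ne') hz.2).add
      (analyticAt_dlog (((hρ r z hz).mul (hρ s z hz)).mul (hρ t z hz))
        (mul_ne_zero (mul_ne_zero (hρ0 r z hz) (hρ0 s z hz)) (hρ0 t z hz))), ?_⟩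
    exact isFundamentalForm3_smul hV (fun z hz => (hm _ hz.1 r).differentiableAt)
      (fun z hz => (hm _ hz.1 s).differentiableAt) (fun z hz => (hm _ hz.1 t).differentiableAt)
      (fun z hz => hz.2) (fun z hz => hinj _ hz.1 _ _ h1.ne) (fun z hz => hinj _ hz.1 _ _ h2.ne)
      (fun z hz => hinj _ hz.1 _ _ (h1.trans h2).ne') (fun z hz => (hρ r z hz).differentiableAt)
      (fun z hz => (hρ s z hz).differentiableAt) (fun z hz => (hρ t z hz).differentiableAt)
      (fun z hz => mul_ne_zero (mul_ne_zero (hρ0 r z hz) (hρ0 s z hz)) (hρ0 t z hz))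
      (fun z _ => rfl) (fun z _ => rfl) (fun z _ => rfl)
  · intro z hz
    rw [hg z hz.1 hz.2]
    exact (extD_sum_fundamentalForm (hm _ hz.1) (hinj _ hz.1) hz.2 (fun i => hρ i z hz)
      (fun i => hρ0 i z hz) fun r s t _ _ => EventuallyEq.rfl).symm

/-- The curvature of a web computed from any local presentation. -/
theorem extD_eq_of_branches {d : ℕ} {p₀ : ℂ} {V : Set (ℂ × ℂ)} (hV : IsOpen V)
    {ω : Fin d → ℂ × ℂ → ℂ × ℂ} {η : Fin d → Fin d → Fin d → ℂ × ℂ → ℂ × ℂ}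
    (hη : ∀ r s t, r < s → s < t → IsFundamentalForm3 V (ω r) (ω s) (ω t) (η r s t))
    {z : ℂ × ℂ} (hzV : z ∈ V) {m : Fin d → ℂ → ℂ} {ρ : Fin d → ℂ × ℂ → ℂ}
    (hm : ∀ i, AnalyticAt ℂ (m i) z.1) (hinj : ∀ i j, i ≠ j → m i z.1 ≠ m j z.1) (hz : z.2 ≠ 0)
    (hρ : ∀ i, AnalyticAt ℂ (ρ i) z) (hρ0 : ∀ i, ρ i z ≠ 0)
    (hω : ∀ i, ∀ᶠ w in 𝓝 z, ω i w = ρ i w • branchForm p₀ (m i) w) :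
    extD (fun w => ∑ r, ∑ s, ∑ t, if r < s ∧ s < t then η r s t w else 0) z =
      -(deriv (totalBranchTerm p₀ m) z.1 / z.2) := by
  have hfst : Tendsto (Prod.fst : ℂ × ℂ → ℂ) (𝓝 z) (𝓝 z.1) := continuous_fst.continuousAt
  have ev : ∀ᶠ w in 𝓝 z, w ∈ V ∧ w.2 ≠ 0 ∧ (∀ i, AnalyticAt ℂ (m i) w.1) ∧
      (∀ i j, i ≠ j → m i w.1 ≠ m j w.1) ∧ (∀ i, AnalyticAt ℂ (ρ i) w) ∧ (∀ i, ρ i w ≠ 0) ∧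
      ∀ i, ω i w = ρ i w • branchForm p₀ (m i) w := by
    refine (hV.eventually_mem hzV).and (Eventually.and ?_ (Eventually.and ?_ (Eventually.and ?_
      (Eventually.and ?_ (Eventually.and ?_ ?_)))))
    · exact continuous_snd.continuousAt.eventually_ne hz
    · exact eventually_all.2 fun i => hfst.eventually (hm i).eventually_analyticAt
    · refine eventually_all.2 fun i => eventually_all.2 fun j => ?_
      by_cases hij : i = j
      · simp [hij]
      · have := hfst.eventually (((hm i).continuousAt.sub (hm j).continuousAt).eventually_ne
          (sub_ne_zero.2 (hinj i j hij)))
        exact this.mono fun w hw _ => sub_ne_zero.1 hw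
    · exact eventually_all.2 fun i => (hρ i).eventually_analyticAt
    · exact eventually_all.2 fun i => (hρ i).continuousAt.eventually_ne (hρ0 i)
    · exact eventually_all.2 hω
  obtain ⟨V', hV', hV'o, hzV'⟩ := eventually_nhds_iff.1 ev
  refine extD_sum_fundamentalForm hm hinj hz hρ hρ0 fun r s t h1 h2 => ?_
  refine eventuallyEq_of_mem (hV'o.mem_nhds hzV') fun w hw => ?_
  have hf := isFundamentalForm3_smul (p₀ := p₀) (f := m r) (g := m s) (h := m t) (ρ₁ := ρ r)
    (ρ₂ := ρ s) (ρ₃ := ρ t) (ω₁ := ω r) (ω₂ := ω s) (ω₃ := ω t) hV'o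
    (fun z hz => ((hV' z hz).2.2.1 r).differentiableAt)
    (fun z hz => ((hV' z hz).2.2.1 s).differentiableAt)
    (fun z hz => ((hV' z hz).2.2.1 t).differentiableAt)
    (fun z hz => (hV' z hz).2.1) (fun z hz => (hV' z hz).2.2.2.1 _ _ h1.ne)
    (fun z hz => (hV' z hz).2.2.2.1 _ _ h2.ne) (fun z hz => (hV' z hz).2.2.2.1 _ _ (h1.trans h2).ne')
    (fun z hz => ((hV' z hz).2.2.2.2.1 r).differentiableAt)
    (fun z hz => ((hV' z hz).2.2.2.2.1 s).differentiableAt)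
    (fun z hz => ((hV' z hz).2.2.2.2.1 t).differentiableAt)
    (fun z hz => mul_ne_zero (mul_ne_zero ((hV' z hz).2.2.2.2.2.1 r) ((hV' z hz).2.2.2.2.2.1 s))
      ((hV' z hz).2.2.2.2.2.1 t))
    (fun z hz => (hV' z hz).2.2.2.2.2.2 r) (fun z hz => (hV' z hz).2.2.2.2.2.2 s)
    (fun z hz => (hV' z hz).2.2.2.2.2.2 t)
  have hw' := hV' w hw
  have hne : ∀ i j, i ≠ j → wedge (ω i w) (ω j w) ≠ 0 := by
    intro i j hij
    rw [hw'.2.2.2.2.2.2 i, hw'.2.2.2.2.2.2 j, wedge_smul_left, wedge_smul_right, wedge_branchForm]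
    exact mul_ne_zero (hw'.2.2.2.2.2.1 i) (mul_ne_zero (hw'.2.2.2.2.2.1 j) (mul_ne_zero hw'.2.1
        (sub_ne_zero.2 (hw'.2.2.2.1 j i hij.symm))))
  exact ((hη r s t h1 h2).mono fun z hz => (hV' z hz).1).unique hf hw (hne _ _ h1.ne)
    (hne _ _ h2.ne) (hne _ _ (h1.trans h2).ne')

end PlanarWeb

/-! ### Sums over triples of indices. -/

section Combinatorics

/-- A sum over increasing triples of cyclic sums, as a sum over triples of distinct indices. -/
theorem two_mul_sum_increasing_cyc {d : ℕ} (T : Fin d → Fin d → Fin d → ℂ)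
    (hT : ∀ i j k, T i j k = T i k j) :
    2 * ∑ r, ∑ s, ∑ t, (if r < s ∧ s < t then T r s t + T s t r + T t r s else 0) =
      ∑ i, ∑ j, ∑ k, if i ≠ j ∧ i ≠ k ∧ j ≠ k then T i j k else 0 := by
  let I : Fin d → Fin d → Fin d → ℂ → ℂ := fun r s t x => if r < s ∧ s < t then x else 0
  have c12 : ∀ f : Fin d → Fin d → Fin d → ℂ, ∑ i, ∑ j, ∑ k, f i j k = ∑ i, ∑ j, ∑ k, f j i k :=
    fun f => Finset.sum_comm
  have c23 : ∀ f : Fin d → Fin d → Fin d → ℂ, ∑ i, ∑ j, ∑ k, f i j k = ∑ i, ∑ j, ∑ k, f i k j :=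
    fun f => Finset.sum_congr rfl fun _ _ => Finset.sum_comm
  -- A triple of distinct indices has exactly one of six orderings. After renaming, the six sums
  -- pair up by the symmetry of `T` in its last two arguments, which gives the factor `2`.
  have h : ∀ i j k, (if i ≠ j ∧ i ≠ k ∧ j ≠ k then T i j k else 0) =
      I i j k (T i j k) + I i k j (T i j k) + I j i k (T i j k) + I j k i (T i j k) +
        I k i j (T i j k) + I k j i (T i j k) := by
    intro i j k
    simp only [I]
    by_cases hij : i = j
    · subst hij
      have : ∀ a : Fin d, ¬ (i < a ∧ a < i) := fun a h => h.1.not_gt h.2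
      simp [this]
    by_cases hik : i = k
    · subst hik
      have : ∀ a : Fin d, ¬ (i < a ∧ a < i) := fun a h => h.1.not_gt h.2
      simp [this]
    by_cases hjk : j = k
    · subst hjk
      have : ∀ a : Fin d, ¬ (j < a ∧ a < j) := fun a h => h.1.not_gt h.2
      simp [this]
    rcases lt_or_gt_of_ne hij with h1 | h1 <;> rcases lt_or_gt_of_ne hik with h2 | h2 <;>
      rcases lt_or_gt_of_ne hjk with h3 | h3 <;>
      first
      | exact absurd (h1.trans h3) h2.not_gt
      | exact absurd (h3.trans h1) h2.not_gt
      | simp [h1, h2, h3, h1.not_gt, h2.not_gt, h3.not_gt, hij, hik, hjk]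
  simp only [h, Finset.sum_add_distrib]
  have e2 : ∑ i, ∑ j, ∑ k, I i k j (T i j k) = ∑ i, ∑ j, ∑ k, I i j k (T i k j) :=
    c23 fun i j k => I i k j (T i j k)
  have e3 : ∑ i, ∑ j, ∑ k, I j i k (T i j k) = ∑ i, ∑ j, ∑ k, I i j k (T j i k) :=
    c12 fun i j k => I j i k (T i j k)
  have e4 : ∑ i, ∑ j, ∑ k, I j k i (T i j k) = ∑ i, ∑ j, ∑ k, I i j k (T k i j) :=
    (c12 fun i j k => I j k i (T i j k)).trans (c23 fun i j k => I i k j (T j i k))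
  have e5 : ∑ i, ∑ j, ∑ k, I k i j (T i j k) = ∑ i, ∑ j, ∑ k, I i j k (T j k i) :=
    (c23 fun i j k => I k i j (T i j k)).trans (c12 fun i j k => I j i k (T i k j))
  have e6 : ∑ i, ∑ j, ∑ k, I k j i (T i j k) = ∑ i, ∑ j, ∑ k, I i j k (T k j i) :=
    ((c12 fun i j k => I k j i (T i j k)).trans (c23 fun i j k => I k i j (T j i k))).trans
      (c12 fun i j k => I j i k (T k i j))
  rw [e2, e3, e4, e5, e6, Finset.mul_sum]
  simp only [← Finset.sum_add_distrib]
  refine Finset.sum_congr rfl fun r _ => ?_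
  rw [Finset.mul_sum]
  refine Finset.sum_congr rfl fun s _ => ?_
  rw [Finset.mul_sum]
  refine Finset.sum_congr rfl fun t _ => ?_
  simp only [I]
  by_cases hrs : r < s ∧ s < t
  · simp only [hrs, and_self, if_true]
    rw [hT r t s, hT s r t, hT t s r]
    ring
  · simp [hrs]

/-- Since `x i = 0`, the conditions `i ≠ j` and `i ≠ k` are automatic; only the diagonal `j = k` has
to be removed from the square of the sum. -/
theorem sum_sum_ite_ne_mul {ι : Type*} [Fintype ι] [DecidableEq ι] (i : ι) (x : ι → ℂ) (hx : x i = 0) :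
    ∑ j, ∑ k, (if i ≠ j ∧ i ≠ k ∧ j ≠ k then x j * x k else 0) = (∑ j, x j) ^ 2 - ∑ j, x j ^ 2 := by
  have h : ∀ j k, (if i ≠ j ∧ i ≠ k ∧ j ≠ k then x j * x k else 0) =
      x j * x k - if j = k then x j ^ 2 else 0 := by
    intro j k
    by_cases h1 : i = j
    · subst h1; simp [hx]
    by_cases h2 : i = k
    · subst h2; simp [hx, h1]
      intro h; simp [h, hx]
    by_cases h3 : j = k
    · subst h3; simp [sq]
    · simp [h1, h2, h3]
  simp only [h, Finset.sum_sub_distrib, ← Finset.mul_sum, ← Finset.sum_mul, sq]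
  simp

end Combinatorics

/-! ### The curvature as a sum over the roots of a pencil. -/

namespace Polynomial

/-- Logarithmic differentiation, written so that the power sums of `1 / (x - r j)` can be read off
from derivatives. -/
theorem eval_derivative_prod_X_sub_C {ι : Type*} [DecidableEq ι] (s : Finset ι) (r : ι → ℂ) (x : ℂ)
    (hx : ∀ j ∈ s, x - r j ≠ 0) :
    (derivative (∏ j ∈ s, (X - C (r j)))).eval x =
      (∏ j ∈ s, (x - r j)) * ∑ j ∈ s, (x - r j)⁻¹ ∧
    (derivative (derivative (∏ j ∈ s, (X - C (r j))))).eval x =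
      (∏ j ∈ s, (x - r j)) * ((∑ j ∈ s, (x - r j)⁻¹) ^ 2 - ∑ j ∈ s, ((x - r j)⁻¹) ^ 2) := by
  induction s using Finset.induction_on with
  | empty => simp
  | insert a s ha ih =>
    obtain ⟨h1, h2⟩ := ih fun j hj => hx j (Finset.mem_insert_of_mem hj)
    have h0 := hx a (Finset.mem_insert_self _ _)
    have hp : (∏ j ∈ s, (X - C (r j))).eval x = ∏ j ∈ s, (x - r j) := by
      simp [eval_prod]
    rw [Finset.prod_insert ha, Finset.prod_insert ha, Finset.sum_insert ha, Finset.sum_insert ha]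
    constructor
    · simp only [derivative_mul, derivative_sub, derivative_X, derivative_C, eval_add, eval_mul,
        eval_sub, eval_X, eval_C, sub_zero, eval_one, h1, hp]
      field_simp
    · simp only [derivative_mul, derivative_sub, derivative_X, derivative_C, eval_add, eval_mul,
        eval_sub, eval_X, eval_C, sub_zero, eval_one, h1, h2, hp, derivative_add, derivative_one,
        eval_zero]
      field_simp
      ring

/-- The derivatives at a root of a polynomial with distinct roots. -/
theorem eval_derivative_at_root {d : ℕ} {φ : ℂ[X]} {l : ℂ} {r : Fin d → ℂ} (hr : Function.Injective r)
    (hφ : φ = C l * ∏ i, (X - C (r i))) (i : Fin d) :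
    (derivative φ).eval (r i) = l * ∏ j ∈ Finset.univ.erase i, (r i - r j) ∧
    (derivative (derivative φ)).eval (r i) =
      2 * (derivative φ).eval (r i) * ∑ j ∈ Finset.univ.erase i, (r i - r j)⁻¹ ∧
    (derivative (derivative (derivative φ))).eval (r i) =
      3 * (derivative φ).eval (r i) * ((∑ j ∈ Finset.univ.erase i, (r i - r j)⁻¹) ^ 2 -
        ∑ j ∈ Finset.univ.erase i, ((r i - r j)⁻¹) ^ 2) := by
  have hne : ∀ j ∈ Finset.univ.erase i, r i - r j ≠ 0 := fun j hj =>
    sub_ne_zero.2 fun h => (Finset.ne_of_mem_erase hj) (hr h).symm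
  obtain ⟨h1, h2⟩ := eval_derivative_prod_X_sub_C (Finset.univ.erase i) r (r i) hne
  have hp : (∏ j ∈ Finset.univ.erase i, (X - C (r j))).eval (r i) =
      ∏ j ∈ Finset.univ.erase i, (r i - r j) := by
    simp [eval_prod]
  rw [← Finset.mul_prod_erase _ _ (Finset.mem_univ i)] at hφ
  have e1 : (derivative φ).eval (r i) = l * ∏ j ∈ Finset.univ.erase i, (r i - r j) := by
    rw [hφ]
    simp [derivative_mul, hp]
  refine ⟨e1, ?_, ?_⟩
  · rw [e1, hφ]
    simp only [derivative_mul, derivative_sub, derivative_X, derivative_C, eval_add, eval_mul,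
        eval_sub, eval_X, eval_C, sub_zero, eval_one, h1, derivative_add, derivative_one,
        eval_zero, zero_mul, sub_self, derivative_zero]
    ring
  · rw [e1, hφ]
    simp only [derivative_mul, derivative_sub, derivative_X, derivative_C, eval_add, eval_mul,
        eval_sub, eval_X, eval_C, sub_zero, eval_one, h2, derivative_add, derivative_one,
        eval_zero, zero_mul, sub_self, derivative_zero]
    ring

theorem eval_derivative_root_ne_zero {d : ℕ} {φ : ℂ[X]} {l : ℂ} (hl : l ≠ 0) {r : Fin d → ℂ}
    (hr : Function.Injective r) (hφ : φ = C l * ∏ i, (X - C (r i))) (i : Fin d) :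
    (derivative φ).eval (r i) ≠ 0 := by
  rw [(eval_derivative_at_root hr hφ i).1]
  exact mul_ne_zero hl (Finset.prod_ne_zero_iff.2 fun j hj =>
    sub_ne_zero.2 fun h => (Finset.ne_of_mem_erase hj) (hr h).symm)

/-- The members `F + π b` of a pencil of polynomials. -/
noncomputable def pencil (F b : ℂ[X]) (π : ℂ) : ℂ[X] := F + C π * b

theorem eval_pencil (F b : ℂ[X]) (π μ : ℂ) : (pencil F b π).eval μ = F.eval μ + π * b.eval μ := by
  simp [pencil]

/-- The contribution of the root `μ` of `φ = F + π b` to the curvature. -/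
noncomputable def pencilTerm (d : ℕ) (F b : ℂ[X]) (π μ : ℂ) : ℂ :=
  b.eval μ / (2 * (derivative (pencil F b π)).eval μ) *
    ((1 + π * μ) ^ 2 * ((derivative (derivative (derivative (pencil F b π)))).eval μ /
        (3 * (derivative (pencil F b π)).eval μ))
      - (d - 2) * π * (1 + π * μ) * ((derivative (derivative (pencil F b π))).eval μ /
        (derivative (pencil F b π)).eval μ)
      + (d - 1) * (d - 2) * π ^ 2)

/-- Summing over the multiset of roots requires no labelling, so this is single-valued around a
multiple root even though the individual branches may be permuted. -/
noncomputable def pencilSum (d : ℕ) (F b : ℂ[X]) (π : ℂ) : ℂ :=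
  ((pencil F b π).roots.map (pencilTerm d F b π)).sum

theorem roots_C_mul_prod {d : ℕ} {l : ℂ} (hl : l ≠ 0) (r : Fin d → ℂ) :
    (C l * ∏ i, (X - C (r i))).roots = Finset.univ.val.map r := by
  rw [roots_C_mul _ hl, roots_prod _ _ (Finset.prod_ne_zero_iff.2 fun i _ => X_sub_C_ne_zero _)]
  simp [Multiset.bind_singleton]

theorem pencilSum_eq {d : ℕ} {F b : ℂ[X]} {π l : ℂ} (hl : l ≠ 0) {r : Fin d → ℂ}
    (hφ : pencil F b π = C l * ∏ i, (X - C (r i))) :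
    pencilSum d F b π = ∑ i, pencilTerm d F b π (r i) := by
  unfold pencilSum
  rw [hφ, roots_C_mul_prod hl, Multiset.map_map]
  rfl

open PlanarWeb in
/-- The fundamental form of the web of the roots of a pencil is a sum over the roots. -/
theorem totalBranchTerm_eq_neg_pencilSum {d : ℕ} (hd : 0 < d) {F b : ℂ[X]} {p₀ p l : ℂ} (hl : l ≠ 0)
    {m : Fin d → ℂ → ℂ} (hinj : Function.Injective fun i => m i p)
    (hφ : pencil F b (p - p₀) = C l * ∏ i, (X - C (m i p)))
    (hm : ∀ i, deriv (m i) p = -(b.eval (m i p) / (derivative (pencil F b (p - p₀))).eval (m i p))) :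
    totalBranchTerm p₀ m p = -pencilSum d F b (p - p₀) := by
  have key := two_mul_sum_increasing_cyc (fun i j k => branchTerm p₀ (m i) (m j) (m k) p)
    (fun i j k => by simp only [branchTerm]; ring)
  have h2 : (2 : ℂ) * totalBranchTerm p₀ m p = ∑ i, ∑ j, ∑ k, if i ≠ j ∧ i ≠ k ∧ j ≠ k then
      branchTerm p₀ (m i) (m j) (m k) p else 0 := key
  rw [← mul_right_inj' (two_ne_zero (α := ℂ)), h2, pencilSum_eq hl hφ, ← Finset.sum_neg_distrib,
    Finset.mul_sum]
  refine Finset.sum_congr rfl fun i _ => ?_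
  set π := p - p₀ with hπ
  set x : Fin d → ℂ := fun j => (1 + π * m j p) / (m i p - m j p) with hx
  have h3 : ∀ j k, (if i ≠ j ∧ i ≠ k ∧ j ≠ k then branchTerm p₀ (m i) (m j) (m k) p else 0) =
      deriv (m i) p * if i ≠ j ∧ i ≠ k ∧ j ≠ k then x j * x k else 0 := by
    intro j k
    split_ifs
    · simp only [branchTerm, hx]
      ring
    · simp
  simp only [h3, ← Finset.mul_sum]
  rw [sum_sum_ite_ne_mul i x (by simp [hx])]
  -- Each `x j` is affine in `1 / (mᵢ - mⱼ)`, so the two power sums of the `x j` reduce to those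
  -- expressed by the second and third derivatives at the root.
  have hdisj : ∀ j ∈ Finset.univ.erase i, x j = (1 + π * m i p) * (m i p - m j p)⁻¹ - π := by
    intro j hj
    have : m i p - m j p ≠ 0 := sub_ne_zero.2 fun h => (Finset.ne_of_mem_erase hj) (hinj h).symm
    simp only [hx]
    field_simp
    ring
  have hxi : x i = 0 := by simp [hx]
  have hcard : ((Finset.univ.erase i).card : ℂ) = d - 1 := by
    rw [Finset.card_erase_of_mem (Finset.mem_univ i), Finset.card_univ, Fintype.card_fin,
      Nat.cast_sub hd]
    simp
  obtain ⟨-, e2, e3⟩ := eval_derivative_at_root hinj hφ i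
  have e0 := eval_derivative_root_ne_zero hl hinj hφ i
  have hs1 : ∑ j, x j = (1 + π * m i p) * (∑ j ∈ Finset.univ.erase i, (m i p - m j p)⁻¹) -
      (d - 1) * π := by
    rw [← Finset.add_sum_erase _ _ (Finset.mem_univ i), hxi, zero_add, Finset.sum_congr rfl hdisj,
      Finset.sum_sub_distrib, ← Finset.mul_sum, Finset.sum_const, nsmul_eq_mul, hcard]
  have hs2 : ∑ j, x j ^ 2 = (1 + π * m i p) ^ 2 *
      (∑ j ∈ Finset.univ.erase i, ((m i p - m j p)⁻¹) ^ 2) -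
      2 * π * (1 + π * m i p) * (∑ j ∈ Finset.univ.erase i, (m i p - m j p)⁻¹) +
      (d - 1) * π ^ 2 := by
    rw [← Finset.add_sum_erase _ _ (Finset.mem_univ i), hxi,
      Finset.sum_congr rfl fun j hj => by rw [hdisj j hj], ← hcard, ← nsmul_eq_mul,
      ← Finset.sum_const, Finset.mul_sum, Finset.mul_sum, ← Finset.sum_sub_distrib,
      ← Finset.sum_add_distrib, zero_pow two_ne_zero, zero_add]
    exact Finset.sum_congr rfl fun j _ => by ring
  rw [hs1, hs2, hm i]
  unfold pencilTerm
  rw [e2, e3]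
  generalize (∑ j ∈ Finset.univ.erase i, (m i p - m j p)⁻¹) = S1
  generalize (∑ j ∈ Finset.univ.erase i, ((m i p - m j p)⁻¹) ^ 2) = S2
  generalize Polynomial.eval (m i p) (derivative (pencil F b π)) = D at *
  field_simp
  ring

end Polynomial

/-! ### Analytic branches of roots of a pencil. -/

namespace Polynomial

open Filter Topology

theorem eq_C_mul_prod_of_roots {d : ℕ} {φ : ℂ[X]} (hd : φ.natDegree ≤ d) (hc : φ.coeff d ≠ 0)
    {r : Fin d → ℂ} (hr : Function.Injective r) (h0 : ∀ i, φ.eval (r i) = 0) :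
    φ = C (φ.coeff d) * ∏ i, (X - C (r i)) := by
  have hn : φ.natDegree = d := le_antisymm hd (le_natDegree_of_ne_zero hc)
  have hm : (∏ i, (X - C (r i))).Monic := monic_prod_of_monic _ _ fun i _ => monic_X_sub_C _
  have hφ0 : φ ≠ 0 := fun h => hc (by simp [h])
  have hpd : (∏ i, (X - C (r i))).degree = (d : WithBot ℕ) := by
    rw [degree_prod]
    simp
  refine eq_of_degree_sub_lt_of_eval_index_eq (s := Finset.univ) (v := r)
    hr.injOn ?_ fun i _ => ?_
  · rw [Finset.card_univ, Fintype.card_fin]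
    have hφd : φ.degree = (d : WithBot ℕ) := by rw [degree_eq_natDegree hφ0, hn]
    refine (degree_sub_lt_left ?_ hφ0 ?_).trans_eq hφd
    · rw [degree_C_mul hc, hpd, hφd]
    · rw [leadingCoeff_mul, hm.leadingCoeff, leadingCoeff_C, mul_one, leadingCoeff, hn]
  · rw [h0 i, eval_mul, eval_prod, Finset.prod_eq_zero (Finset.mem_univ i) (by simp), mul_zero]

theorem exists_injective_roots {d : ℕ} {φ : ℂ[X]} (hd : φ.natDegree ≤ d) (hc : φ.coeff d ≠ 0)
    (hs : ∀ μ, φ.eval μ = 0 → (derivative φ).eval μ ≠ 0) :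
    ∃ r : Fin d → ℂ, Function.Injective r ∧ φ = C (φ.coeff d) * ∏ i, (X - C (r i)) := by
  have hn : φ.natDegree = d := le_antisymm hd (le_natDegree_of_ne_zero hc)
  have hφ0 : φ ≠ 0 := fun h => hc (by simp [h])
  have hnd : φ.roots.Nodup := by
    refine Multiset.nodup_iff_count_le_one.2 fun a => ?_
    rw [count_roots]
    by_contra! h
    obtain ⟨h1, h2⟩ := (one_lt_rootMultiplicity_iff_isRoot hφ0).1 h
    exact hs a h1 h2
  have hcard : φ.roots.toFinset.card = d := by
    rw [Multiset.toFinset_card_of_nodup hnd, ← hn]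
    exact ((IsAlgClosed.splits φ).natDegree_eq_card_roots).symm
  let e := (φ.roots.toFinset.equivFinOfCardEq hcard).symm
  have hinj : Function.Injective fun i => ((e i : φ.roots.toFinset) : ℂ) :=
    Subtype.val_injective.comp e.injective
  refine ⟨fun i => e i, hinj, eq_C_mul_prod_of_roots hd hc hinj fun i => ?_⟩
  have := (e i).2
  rw [Multiset.mem_toFinset, mem_roots hφ0] at this
  exact this

/-- The parameters of the pencil `F + π b` for which the binary form of degree `d` with
dehomogenization `F + π b` has `d` distinct roots, none of them at infinity. -/
def IsRegularParam (d : ℕ) (F b : ℂ[X]) (π : ℂ) : Prop :=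
  (pencil F b π).coeff d ≠ 0 ∧
    ∀ μ, (pencil F b π).eval μ = 0 → (derivative (pencil F b π)).eval μ ≠ 0

theorem natDegree_pencil_le {d : ℕ} {F b : ℂ[X]} (hF : F.natDegree ≤ d) (hb : b.natDegree ≤ d)
    (π : ℂ) : (pencil F b π).natDegree ≤ d :=
  natDegree_add_le_of_degree_le hF ((natDegree_C_mul_le _ _).trans hb)

theorem hasDerivAt_eval_pencil_comp {F b : ℂ[X]} {p₀ p m' : ℂ} {m : ℂ → ℂ} (hm : HasDerivAt m m' p) :
    HasDerivAt (fun p => (pencil F b (p - p₀)).eval (m p))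
      (b.eval (m p) + (derivative (pencil F b (p - p₀))).eval (m p) * m') p := by
  simp only [eval_pencil]
  have h1 := (F.hasDerivAt (m p)).comp p hm
  have h2 := ((hasDerivAt_id p).sub_const p₀).mul ((b.hasDerivAt (m p)).comp p hm)
  refine (h1.add h2).congr_deriv ?_
  simp [pencil]
  ring

/-- Implicit differentiation of `F(m) + (p - p₀) b(m) = 0`. -/
theorem deriv_root_branch {F b : ℂ[X]} {p₀ p : ℂ} {m : ℂ → ℂ} (hm : DifferentiableAt ℂ m p)
    (h0 : ∀ᶠ p in 𝓝 p, (pencil F b (p - p₀)).eval (m p) = 0)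
    (hs : (derivative (pencil F b (p - p₀))).eval (m p) ≠ 0) :
    deriv m p = -(b.eval (m p) / (derivative (pencil F b (p - p₀))).eval (m p)) := by
  have h1 := (hasDerivAt_eval_pencil_comp (F := F) (b := b) (p₀ := p₀) hm.hasDerivAt).deriv
  have h2 : (fun p => (pencil F b (p - p₀)).eval (m p)) =ᶠ[𝓝 p] fun _ => 0 := h0
  rw [h2.deriv_eq, deriv_const] at h1
  field_simp
  linear_combination -h1

/-- A simple root of a member of a pencil extends to a locally unique analytic branch of roots. -/
theorem exists_root_branch {F b : ℂ[X]} (hco : ∀ μ, F.eval μ = 0 → b.eval μ ≠ 0) {p₀ p₁ r : ℂ}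
    (h0 : (pencil F b (p₁ - p₀)).eval r = 0)
    (hs : (derivative (pencil F b (p₁ - p₀))).eval r ≠ 0) :
    ∃ m : ℂ → ℂ, AnalyticAt ℂ m p₁ ∧ m p₁ = r ∧
      (∀ᶠ p in 𝓝 p₁, (pencil F b (p - p₀)).eval (m p) = 0) ∧
      ∀ᶠ w : ℂ × ℂ in 𝓝 (p₁, r), (pencil F b (w.1 - p₀)).eval w.2 = 0 → m w.1 = w.2 := by
  have hb : b.eval r ≠ 0 := by
    intro hb
    rw [eval_pencil, hb, mul_zero, add_zero] at h0
    exact hco r h0 hb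
  have hroot : ∀ p μ, b.eval μ ≠ 0 →
      ((pencil F b (p - p₀)).eval μ = 0 ↔ p₀ - F.eval μ / b.eval μ = p) := by
    intro p μ h
    rw [eval_pencil]
    constructor
    · intro h1
      field_simp
      linear_combination -h1
    · rintro rfl
      field_simp
      ring
  -- The pencil is linear in the parameter, so the parameter is an explicit function of the root.
  -- Simplicity of the root says `G' ≠ 0`, and the branch is the local inverse of `G`.
  let G : ℂ → ℂ := fun μ => p₀ - F.eval μ / b.eval μ
  have hFa : AnalyticAt ℂ (fun μ => F.eval μ) r := AnalyticOnNhd.eval_polynomial F r (Set.mem_univ _)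
  have hba : AnalyticAt ℂ (fun μ => b.eval μ) r := AnalyticOnNhd.eval_polynomial b r (Set.mem_univ _)
  have hG : AnalyticAt ℂ G r := analyticAt_const.sub (hFa.div hba hb)
  have hGr : G r = p₁ := (hroot p₁ r hb).1 h0
  have hG' : deriv G r ≠ 0 := by
    have h1 := ((F.hasDerivAt r).div (b.hasDerivAt r) hb).const_sub p₀
    have h2 : deriv G r = _ := h1.deriv
    rw [h2]
    simp only [eval_pencil] at h0
    simp only [pencil, derivative_add, derivative_C_mul, eval_add, eval_mul, eval_C] at hs
    intro h3
    apply hs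
    rw [neg_eq_zero, div_eq_zero_iff, or_iff_left (pow_ne_zero 2 hb)] at h3
    apply mul_right_cancel₀ hb
    linear_combination h3 + (eval r (derivative b)) * h0
  have hst := hG.hasStrictDerivAt
  refine ⟨hst.localInverse _ _ _ hG', ?_, ?_, ?_, ?_⟩
  · rw [← hGr]; exact hG.analyticAt_localInverse hG'
  · rw [← hGr]; exact HasStrictFDerivAt.localInverse_apply_image ..
  · have h1 := hst.eventually_right_inverse hG'
    have hc : ContinuousAt (hst.localInverse _ _ _ hG') (G r) :=
      (hG.analyticAt_localInverse hG').continuousAt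
    have h2 : (hst.localInverse _ _ _ hG') (G r) = r := HasStrictFDerivAt.localInverse_apply_image ..
    have h3 : ∀ᶠ p in 𝓝 (G r), b.eval (hst.localInverse _ _ _ hG' p) ≠ 0 :=
      hc.eventually (p := fun μ => b.eval μ ≠ 0)
        (by rw [h2]; exact b.continuous.continuousAt.eventually_ne hb)
    rw [hGr] at h1 h3
    filter_upwards [h1, h3] with p hp hp'
    exact (hroot _ _ hp').2 hp
  · have h1 := hst.eventually_left_inverse hG'
    have h2 : ∀ᶠ μ in 𝓝 r, b.eval μ ≠ 0 := b.continuous.continuousAt.eventually_ne hb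
    have hsnd : Tendsto (Prod.snd : ℂ × ℂ → ℂ) (𝓝 (p₁, r)) (𝓝 r) := continuous_snd.continuousAt
    filter_upwards [hsnd.eventually h1, hsnd.eventually h2] with w hw hw' h
    rw [← (hroot _ _ hw').1 h]
    exact hw

theorem continuous_coeff_pencil (d : ℕ) (F b : ℂ[X]) (p₀ : ℂ) :
    Continuous fun p => (pencil F b (p - p₀)).coeff d := by
  simp only [pencil, coeff_add, coeff_C_mul]
  fun_prop

open PlanarWeb in
/-- Near a regular parameter, the roots of the pencil are analytic branches, and the curvature of
their web is given by the sum over the roots. -/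
theorem exists_root_branches {d : ℕ} (hd : 0 < d) {F b : ℂ[X]} (hF : F.natDegree ≤ d)
    (hb : b.natDegree ≤ d) (hco : ∀ μ, F.eval μ = 0 → b.eval μ ≠ 0) {p₀ p₁ : ℂ}
    (hreg : IsRegularParam d F b (p₁ - p₀)) {r : Fin d → ℂ} (hr : Function.Injective r)
    (hr0 : ∀ i, (pencil F b (p₁ - p₀)).eval (r i) = 0) :
    ∃ m : Fin d → ℂ → ℂ, (∀ i, m i p₁ = r i) ∧
      (∀ i, ∀ᶠ w : ℂ × ℂ in 𝓝 (p₁, r i), (pencil F b (w.1 - p₀)).eval w.2 = 0 → m i w.1 = w.2) ∧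
      ∃ U : Set ℂ, IsOpen U ∧ p₁ ∈ U ∧ (∀ p ∈ U, ∀ i, AnalyticAt ℂ (m i) p) ∧
        (∀ p ∈ U, ∀ i j, i ≠ j → m i p ≠ m j p) ∧
        (∀ p ∈ U, (pencil F b (p - p₀)).coeff d ≠ 0) ∧
        (∀ p ∈ U, pencil F b (p - p₀) =
          C ((pencil F b (p - p₀)).coeff d) * ∏ i, (X - C (m i p))) ∧
        ∀ p ∈ U, totalBranchTerm p₀ m p = -pencilSum d F b (p - p₀) := by
  choose m hma hmr hm0 hmu using fun i =>
    exists_root_branch hco (hr0 i) (hreg.2 (r i) (hr0 i))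
  have ev : ∀ᶠ p in 𝓝 p₁, (∀ i, AnalyticAt ℂ (m i) p) ∧ (∀ i j, i ≠ j → m i p ≠ m j p) ∧
      (pencil F b (p - p₀)).coeff d ≠ 0 ∧ (∀ i, (pencil F b (p - p₀)).eval (m i p) = 0) := by
    refine (eventually_all.2 fun i => (hma i).eventually_analyticAt).and
      ((eventually_all.2 fun i => eventually_all.2 fun j => ?_).and
        (((continuous_coeff_pencil d F b p₀).continuousAt.eventually_ne hreg.1).and
          (eventually_all.2 hm0)))
    by_cases hij : i = j
    · simp [hij]
    · have := ((hma i).continuousAt.sub (hma j).continuousAt).eventually_ne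
        (sub_ne_zero.2 (by rw [hmr, hmr]; exact fun h => hij (hr h)))
      exact this.mono fun w hw _ => sub_ne_zero.1 hw
  obtain ⟨U, hU, hUo, hp₁⟩ := eventually_nhds_iff.1 ev
  have hinj : ∀ p ∈ U, Function.Injective fun i => m i p := fun p hp i j hij => by
    by_contra h
    exact (hU p hp).2.1 i j h hij
  have hfac : ∀ p ∈ U, pencil F b (p - p₀) =
      C ((pencil F b (p - p₀)).coeff d) * ∏ i, (X - C (m i p)) := fun p hp =>
    eq_C_mul_prod_of_roots (natDegree_pencil_le hF hb _) (hU p hp).2.2.1 (hinj p hp)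
      (hU p hp).2.2.2
  refine ⟨m, hmr, hmu, U, hUo, hp₁, fun p hp => (hU p hp).1, fun p hp => (hU p hp).2.1,
    fun p hp => (hU p hp).2.2.1, hfac, fun p hp => ?_⟩
  refine totalBranchTerm_eq_neg_pencilSum hd (hU p hp).2.2.1 (hinj p hp) (hfac p hp) fun i => ?_
  refine deriv_root_branch ((hU p hp).1 i).differentiableAt ?_
    (eval_derivative_root_ne_zero (hU p hp).2.2.1 (hinj p hp) (hfac p hp) i)
  exact eventually_of_mem (hUo.mem_nhds hp) fun p hp => (hU p hp).2.2.2 i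

end Polynomial

/-! ### Behaviour at infinity, partial fractions, and roots for small parameters. -/

namespace Polynomial

open Filter Topology Bornology

theorem tendsto_eval_div_pow_cobounded {P : ℂ[X]} {n : ℕ} (hP : P.natDegree ≤ n) :
    Tendsto (fun z => P.eval z / z ^ n) (cobounded ℂ) (𝓝 (P.coeff n)) := by
  have h1 : (fun z => P.eval z / z ^ n) =
      fun z => ∑ i ∈ Finset.range (n + 1), P.coeff i * (z ^ i / z ^ n) := by
    funext z
    rw [eval_eq_sum_range' (Nat.lt_succ_of_le hP), Finset.sum_div]
    exact Finset.sum_congr rfl fun i _ => mul_div_assoc _ _ _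
  have h2 : P.coeff n = ∑ i ∈ Finset.range (n + 1), P.coeff i * (if i = n then 1 else 0) := by
    simp
  rw [h1, h2]
  refine tendsto_finsetSum _ fun i hi => Tendsto.const_mul _ ?_
  have hne : ∀ᶠ z : ℂ in cobounded ℂ, z ≠ 0 := eventually_ne_cobounded 0
  split_ifs with h
  · subst h
    exact tendsto_const_nhds.congr' (hne.mono fun z hz => (div_self (pow_ne_zero _ hz)).symm)
  · have hlt : i < n := lt_of_le_of_ne (Nat.lt_succ_iff.1 (Finset.mem_range.1 hi)) h
    have h3 : Tendsto (fun z : ℂ => (z⁻¹) ^ (n - i)) (cobounded ℂ) (𝓝 0) := by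
      have := (tendsto_inv₀_cobounded (α := ℂ)).pow (n - i)
      rwa [zero_pow (Nat.sub_ne_zero_of_lt hlt)] at this
    refine h3.congr' (hne.mono fun z hz => ?_)
    rw [inv_pow, eq_div_iff (pow_ne_zero _ hz), inv_mul_eq_div, div_eq_iff (pow_ne_zero _ hz),
      ← pow_add]
    congr 1
    omega

theorem tendsto_eval_div_eval_cobounded {N D : ℂ[X]} {a c : ℕ} (hN : N.natDegree ≤ a)
    (hD : D.natDegree ≤ c) (hc : D.coeff c ≠ 0) (hac : a < c) :
    Tendsto (fun z => N.eval z / D.eval z) (cobounded ℂ) (𝓝 0) := by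
  have hne : ∀ᶠ z : ℂ in cobounded ℂ, z ≠ 0 := eventually_ne_cobounded 0
  have h1 := (tendsto_eval_div_pow_cobounded (hN.trans hac.le)).div
    (tendsto_eval_div_pow_cobounded hD) hc
  rw [coeff_eq_zero_of_natDegree_lt (hN.trans_lt hac), zero_div] at h1
  refine h1.congr' (hne.mono fun z hz => ?_)
  exact div_div_div_cancel_right₀ (pow_ne_zero _ hz) _ _

/-- The partial fraction expansion of `b / φ`. -/
theorem sum_div_derivative_root {d : ℕ} {φ b : ℂ[X]} {l : ℂ} (hl : l ≠ 0) {r : Fin d → ℂ}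
    (hr : Function.Injective r) (hφ : φ = C l * ∏ i, (X - C (r i))) (hb : b.natDegree ≤ d) {z : ℂ}
    (hz : φ.eval z ≠ 0) :
    ∑ i, b.eval (r i) / (derivative φ).eval (r i) * (z - r i)⁻¹ =
      b.eval z / φ.eval z - b.coeff d / l := by
  set N := Lagrange.nodal Finset.univ r with hN
  have hφN : φ = C l * N := hφ
  have hNm : N.Monic := Lagrange.nodal_monic
  have hNd : N.natDegree = d := by rw [hN, Lagrange.natDegree_nodal]; simp
  have hφr : ∀ i, φ.eval (r i) = 0 := fun i => by
    rw [hφN, eval_mul, Lagrange.eval_nodal_at_node (Finset.mem_univ i), mul_zero]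
  have hzr : ∀ i ∈ Finset.univ, z ≠ r i := fun i _ h => hz (h ▸ hφr i)
  -- Subtracting this multiple of `φ` brings the degree below `d` without changing the values at the
  -- roots, so Lagrange interpolation recovers `q` exactly. The constant `b.coeff d / l` is the
  -- polynomial part of `b / φ`.
  let q : ℂ[X] := b - C (b.coeff d / l) * φ
  have hqd : q.degree < (Finset.univ : Finset (Fin d)).card := by
    rw [Finset.card_univ, Fintype.card_fin]
    refine (degree_lt_iff_coeff_zero _ _).2 fun m hm => ?_
    rcases hm.eq_or_lt with rfl | hm
    · have : N.coeff d = 1 := by rw [← hNd]; exact hNm.coeff_natDegree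
      simp [q, hφN, this, hl]
    · have h1 : b.coeff m = 0 := coeff_eq_zero_of_natDegree_lt (hb.trans_lt hm)
      have h2 : N.coeff m = 0 := coeff_eq_zero_of_natDegree_lt (hNd.trans_lt hm)
      simp [q, hφN, h1, h2]
  have h1 := congrArg (eval z) (Lagrange.eq_interpolate hr.injOn hqd)
  rw [Lagrange.eval_interpolate_not_at_node _ hzr] at h1
  have h2 : ∀ i, Lagrange.nodalWeight Finset.univ r i = l / (derivative φ).eval (r i) := by
    intro i
    rw [Lagrange.nodalWeight_eq_eval_derivative_nodal (Finset.mem_univ i), hφN, derivative_C_mul,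
      eval_mul, eval_C, ← hN]
    field_simp
  have h3 : ∀ i, q.eval (r i) = b.eval (r i) := fun i => by
    simp [q, hφr i]
  have h4 : N.eval z = φ.eval z / l := by
    rw [hφN, eval_mul, eval_C]; field_simp
  have h5 : q.eval z = b.eval z - b.coeff d / l * φ.eval z := by simp [q]
  simp only [h2, h3] at h1
  rw [← hN, h4, h5] at h1
  have h6 : ∑ i, l / (derivative φ).eval (r i) * (z - r i)⁻¹ * b.eval (r i) =
      l * ∑ i, b.eval (r i) / (derivative φ).eval (r i) * (z - r i)⁻¹ := by
    rw [Finset.mul_sum]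
    exact Finset.sum_congr rfl fun i _ => by ring
  rw [h6] at h1
  field_simp
  field_simp at h1
  linear_combination -h1

/-- The derivative in `z` of the partial fraction expansion, up to sign. -/
theorem sum_div_derivative_root_sq {d : ℕ} {φ b : ℂ[X]} {l : ℂ} (hl : l ≠ 0) {r : Fin d → ℂ}
    (hr : Function.Injective r) (hφ : φ = C l * ∏ i, (X - C (r i))) (hb : b.natDegree ≤ d) {z : ℂ}
    (hz : φ.eval z ≠ 0) :
    ∑ i, b.eval (r i) / (derivative φ).eval (r i) * ((z - r i)⁻¹) ^ 2 =
      (b.eval z * (derivative φ).eval z - (derivative b).eval z * φ.eval z) / φ.eval z ^ 2 := by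
  have hzr : ∀ i, z - r i ≠ 0 := fun i h => hz (by
    rw [hφ, sub_eq_zero.1 h, eval_mul, eval_prod, Finset.prod_eq_zero (Finset.mem_univ i) (by simp),
      mul_zero])
  have ev : (fun z => ∑ i, b.eval (r i) / (derivative φ).eval (r i) * (z - r i)⁻¹) =ᶠ[𝓝 z]
      fun z => b.eval z / φ.eval z - b.coeff d / l :=
    (φ.continuous.continuousAt.eventually_ne hz).mono fun w hw =>
      sum_div_derivative_root hl hr hφ hb hw
  have h1 : HasDerivAt (fun z => ∑ i, b.eval (r i) / (derivative φ).eval (r i) * (z - r i)⁻¹)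
      (∑ i, b.eval (r i) / (derivative φ).eval (r i) * (-1 / (z - r i) ^ 2)) z :=
    HasDerivAt.fun_sum fun i _ =>
      (((hasDerivAt_id z).sub_const (r i)).fun_inv (hzr i)).const_mul _
  have h2 := ((b.hasDerivAt z).div (φ.hasDerivAt z) hz).sub_const (b.coeff d / l)
  have h3 := h1.unique (h2.congr_of_eventuallyEq ev)
  have h4 : ∑ i, b.eval (r i) / (derivative φ).eval (r i) * ((z - r i)⁻¹) ^ 2 =
      -∑ i, b.eval (r i) / (derivative φ).eval (r i) * (-1 / (z - r i) ^ 2) := by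
    rw [← Finset.sum_neg_distrib]
    refine Finset.sum_congr rfl fun i _ => ?_
    rw [inv_pow]
    ring
  rw [h4, h3]
  ring

/-- A function tending to zero at the zeros of `F` and at infinity is uniformly small on the zeros
of `F + π b` for small `π`. -/
theorem eventually_forall_root_lt {d : ℕ} {F b : ℂ[X]} (hF : F.natDegree ≤ d) (hb : b.natDegree ≤ d)
    (hco : ∀ μ, F.eval μ = 0 → b.eval μ ≠ 0) {R : ℂ → ℂ} (hR : ∀ r, F.eval r = 0 → Tendsto R (𝓝[≠] r) (𝓝 0))
    (hinf : F.coeff d ≠ 0 ∨ Tendsto R (cobounded ℂ) (𝓝 0)) {ε : ℝ} (hε : 0 < ε) :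
    ∀ᶠ π in 𝓝[≠] (0 : ℂ), ∀ μ, (pencil F b π).eval μ = 0 → ‖R μ‖ < ε := by
  have hnear : ∀ r, F.eval r = 0 → ∃ U : Set ℂ, IsOpen U ∧ r ∈ U ∧ ∀ μ ∈ U, μ ≠ r → ‖R μ‖ < ε := by
    intro r hr
    have h1 : ∀ᶠ μ in 𝓝[≠] r, ‖R μ‖ < ε := by
      have := (hR r hr).norm
      rw [norm_zero] at this
      exact this.eventually_lt_const hε
    rw [eventually_nhdsWithin_iff] at h1
    obtain ⟨U, hU, hUo, hrU⟩ := eventually_nhds_iff.1 h1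
    exact ⟨U, hUo, hrU, fun μ hμ hne => hU μ hμ hne⟩
  choose! U hUo hUr hU using hnear
  -- If `F` has full degree, roots cannot escape to infinity for small `π`; otherwise `R` is small
  -- there by hypothesis.
  have hfar : ∃ M : ℝ, ∀ᶠ π in 𝓝[≠] (0 : ℂ), ∀ μ, M < ‖μ‖ → (pencil F b π).eval μ = 0 →
      ‖R μ‖ < ε := by
    rcases hinf with h | h
    · have h1 := (tendsto_eval_div_pow_cobounded hF).norm
      have h2 := (tendsto_eval_div_pow_cobounded hb).norm
      have hpos : 0 < ‖F.coeff d‖ := norm_pos_iff.2 h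
      have h3 := h1.eventually_const_lt (half_lt_self hpos)
      have h4 := h2.eventually_lt_const (lt_add_one ‖b.coeff d‖)
      obtain ⟨M, hM⟩ := ((h3.and h4).and (eventually_ne_cobounded (0 : ℂ))).exists_mem.imp fun s hs => hs
      obtain ⟨hMs, hM⟩ := hM
      obtain ⟨K, -, hK⟩ := (hasBasis_cobounded_norm (E := ℂ)).mem_iff.1 hMs
      refine ⟨K, ?_⟩
      have h5 : ∀ᶠ π in 𝓝[≠] (0 : ℂ), ‖π‖ * (‖b.coeff d‖ + 1) < ‖F.coeff d‖ / 2 := by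
        have h6 : Tendsto (fun π : ℂ => ‖π‖ * (‖b.coeff d‖ + 1)) (𝓝 0) (𝓝 (‖(0 : ℂ)‖ * (‖b.coeff d‖ + 1))) :=
          (by fun_prop : Continuous fun π : ℂ => ‖π‖ * (‖b.coeff d‖ + 1)).tendsto 0
        rw [norm_zero, zero_mul] at h6
        exact (h6.mono_left nhdsWithin_le_nhds).eventually_lt_const (half_pos hpos)
      filter_upwards [h5] with π hπ μ hμ h0
      exfalso
      obtain ⟨⟨h7, h8⟩, h9⟩ := hM μ (hK hμ.le)
      rw [eval_pencil] at h0
      have h10 : F.eval μ / μ ^ d = -(π * (b.eval μ / μ ^ d)) := by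
        rw [eq_neg_of_add_eq_zero_left h0]; ring
      rw [h10, norm_neg, norm_mul] at h7
      have := mul_le_mul_of_nonneg_left h8.le (norm_nonneg π)
      linarith
    · have h1 := h.norm
      rw [norm_zero] at h1
      have h2 := h1.eventually_lt_const hε
      obtain ⟨K, -, hK⟩ := (hasBasis_cobounded_norm (E := ℂ)).mem_iff.1 h2
      exact ⟨K, Eventually.of_forall fun π μ hμ _ => hK hμ.le⟩
  obtain ⟨M, hM⟩ := hfar
  -- On this compact set `|F|` is bounded below and `|b|` above, so `F + π b` has no zero there for
  -- small `π`.
  let K : Set ℂ := Metric.closedBall 0 M \ ⋃ r ∈ {r | F.eval r = 0}, U r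
  have hK : IsCompact K := (isCompact_closedBall 0 M).diff (isOpen_biUnion fun r hr => hUo r hr)
  have hmid : ∀ᶠ π in 𝓝[≠] (0 : ℂ), ∀ μ ∈ K, (pencil F b π).eval μ ≠ 0 := by
    have hFK : ∀ μ ∈ K, F.eval μ ≠ 0 := fun μ hμ h0 =>
      hμ.2 (Set.mem_biUnion (show μ ∈ {r | F.eval r = 0} from h0) (hUr μ h0))
    rcases K.eq_empty_or_nonempty with hKe | hKn
    · exact Eventually.of_forall fun π μ hμ => by simp [hKe] at hμ
    · obtain ⟨x, hx, hxm⟩ := hK.exists_isMinOn hKn (F.continuous.norm.continuousOn)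
      obtain ⟨y, hy, hym⟩ := hK.exists_isMaxOn hKn (b.continuous.norm.continuousOn)
      have hpos : 0 < ‖F.eval x‖ := norm_pos_iff.2 (hFK x hx)
      have h6 : Tendsto (fun π : ℂ => ‖π‖ * ‖b.eval y‖) (𝓝 0) (𝓝 (‖(0 : ℂ)‖ * ‖b.eval y‖)) :=
        (by fun_prop : Continuous fun π : ℂ => ‖π‖ * ‖b.eval y‖).tendsto 0
      rw [norm_zero, zero_mul] at h6
      filter_upwards [(h6.mono_left nhdsWithin_le_nhds).eventually_lt_const hpos] with π hπ μ hμ h0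
      rw [eval_pencil] at h0
      have h7 := congrArg norm (eq_neg_of_add_eq_zero_left h0)
      rw [norm_neg, norm_mul] at h7
      have h8 := hxm hμ
      have h9 := hym hμ
      simp only [Set.mem_ofPred_eq] at h8 h9
      have := mul_le_mul_of_nonneg_left h9 (norm_nonneg π)
      linarith
  filter_upwards [hM, hmid, self_mem_nhdsWithin] with π h1 h2 hπ0 μ hμ
  by_cases hn : M < ‖μ‖
  · exact h1 μ hn hμ
  · by_cases hUμ : μ ∈ ⋃ r ∈ {r | F.eval r = 0}, U r
    · obtain ⟨r, hr, hμr⟩ := Set.mem_iUnion₂.1 hUμ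
      -- A punctured limit suffices: a zero of `F` is never a root of `F + π b` when `π ≠ 0`, since
      -- `b` does not vanish there.
      by_cases hne : μ = r
      · subst hne
        rw [eval_pencil, show F.eval μ = 0 from hr, zero_add] at hμ
        exact absurd hμ (mul_ne_zero hπ0 (hco μ hr))
      · exact hU r hr μ hμr hne
    · exact absurd hμ (h2 μ ⟨by simpa using hn, hUμ⟩)

end Polynomial

/-! ### Root contributions as rational functions of the root. -/

namespace Polynomial

open Filter Topology Bornology

/-- `F⁽ʲ⁾ b - F b⁽ʲ⁾`. -/
noncomputable def wronskian' (j : ℕ) (F b : ℂ[X]) : ℂ[X] :=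
  derivative^[j] F * b - F * derivative^[j] b

/-- At a root, `π = -F / b`; this eliminates the parameter and leaves a function of the root alone.
-/
theorem eval_iterate_derivative_pencil {F b : ℂ[X]} {π μ : ℂ} (hb : b.eval μ ≠ 0)
    (h0 : (pencil F b π).eval μ = 0) (j : ℕ) :
    (derivative^[j] (pencil F b π)).eval μ = (wronskian' j F b).eval μ / b.eval μ := by
  have : derivative^[j] (pencil F b π) = derivative^[j] F + C π * derivative^[j] b := by
    rw [pencil, iterate_map_add, iterate_derivative_C_mul]
  rw [eval_pencil] at h0
  rw [this, wronskian', eq_div_iff hb]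
  simp only [eval_add, eval_mul, eval_sub, eval_C]
  linear_combination (eval μ (derivative^[j] b)) * h0

/-- The product of `π` with the contribution to the curvature of the root `μ` of `F + π b`, from
which the singular part `c₂ / (μ - μ₀)² + c₁ / (μ - μ₀)` has been removed. -/
noncomputable def regularizedTerm (d : ℕ) (F b : ℂ[X]) (μ₀ ρ c₁ c₂ μ : ℂ) : ℂ :=
  -(F.eval μ * (b.eval μ - μ * F.eval μ) ^ 2 * (wronskian' 3 F b).eval μ /
      (6 * b.eval μ * (wronskian' 1 F b).eval μ ^ 2)) -
    (d - 2) * (F.eval μ ^ 2 * (b.eval μ - μ * F.eval μ) * (wronskian' 2 F b).eval μ /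
      (2 * b.eval μ * (wronskian' 1 F b).eval μ ^ 2)) -
    (d - 1) * (d - 2) * (F.eval μ ^ 3 / (2 * b.eval μ * (wronskian' 1 F b).eval μ)) -
    F.eval μ * b.eval μ / (wronskian' 1 F b).eval μ *
      (c₂ / (μ - μ₀) ^ 2 + c₁ * (1 / (μ - μ₀) - 1 / (μ - ρ)))

/-- Separates the part that tends to zero from a principal part whose sum over the roots is known
from partial fractions. The weight is `π b / φ' = -F b / (F' b - F b')` at the root. -/
theorem mul_pencilTerm_eq {d : ℕ} {F b : ℂ[X]} {π μ : ℂ} (hb : b.eval μ ≠ 0)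
    (h0 : (pencil F b π).eval μ = 0) (hs : (derivative (pencil F b π)).eval μ ≠ 0) (μ₀ ρ c₁ c₂ : ℂ) :
    π * pencilTerm d F b π μ = regularizedTerm d F b μ₀ ρ c₁ c₂ μ -
      π * (b.eval μ / (derivative (pencil F b π)).eval μ) *
        (c₂ / (μ - μ₀) ^ 2 + c₁ * (1 / (μ - μ₀) - 1 / (μ - ρ))) := by
  have h1 := eval_iterate_derivative_pencil hb h0 1
  have h2 := eval_iterate_derivative_pencil hb h0 2
  have h3 := eval_iterate_derivative_pencil hb h0 3
  simp only [Function.iterate_succ, Function.iterate_zero, Function.comp_apply, id] at h1 h2 h3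
  have hπ : π = -(F.eval μ) / b.eval μ := by
    rw [eval_pencil] at h0
    field_simp
    linear_combination h0
  have hW : (wronskian' 1 F b).eval μ ≠ 0 := by
    intro h
    rw [h1, h, zero_div] at hs
    exact hs rfl
  unfold pencilTerm regularizedTerm
  rw [h1, h2, h3]
  generalize c₂ / (μ - μ₀) ^ 2 + c₁ * (1 / (μ - μ₀) - 1 / (μ - ρ)) = Z
  generalize (wronskian' 1 F b).eval μ = W1 at *
  generalize (wronskian' 2 F b).eval μ = W2 at *
  generalize (wronskian' 3 F b).eval μ = W3 at *
  rw [hπ]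
  generalize eval μ F = f at *
  generalize eval μ b = B at *
  field_simp
  ring

/-- Every summand carries a factor `F`, and no denominator vanishes at a simple zero other than
`μ₀`. -/
theorem regularizedTerm_tendsto_of_simple {d : ℕ} {F b : ℂ[X]} {μ₀ ρ c₁ c₂ r : ℂ}
    (hr : F.eval r = 0) (hb : b.eval r ≠ 0) (hs : (derivative F).eval r ≠ 0) (h1 : r ≠ μ₀)
    (h2 : r ≠ ρ) : Tendsto (regularizedTerm d F b μ₀ ρ c₁ c₂) (𝓝[≠] r) (𝓝 0) := by
  have hW : (wronskian' 1 F b).eval r ≠ 0 := by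
    simp [wronskian', hr, hb, hs]
  have h1' := sub_ne_zero.2 h1
  have h2' := sub_ne_zero.2 h2
  have hc : ContinuousAt (regularizedTerm d F b μ₀ ρ c₁ c₂) r := by
    unfold regularizedTerm
    have hp : ∀ P : ℂ[X], ContinuousAt (fun μ => P.eval μ) r := fun P => P.continuous.continuousAt
    have hF := hp F
    have hb' := hp b
    have hw1 := hp (wronskian' 1 F b)
    have hw2 := hp (wronskian' 2 F b)
    have hw3 := hp (wronskian' 3 F b)
    fun_prop (disch := simp [hb, hW, h1'])
  have h0 : regularizedTerm d F b μ₀ ρ c₁ c₂ r = 0 := by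
    simp [regularizedTerm, hr]
  have := hc.tendsto
  rw [h0] at this
  exact this.mono_left nhdsWithin_le_nhds

theorem natDegree_X_pow_mul_iterate_derivative_le (P : ℂ[X]) (j : ℕ) :
    (X ^ j * derivative^[j] P).natDegree ≤ P.natDegree := by
  rcases lt_or_ge P.natDegree j with h | h
  · rw [iterate_derivative_eq_zero h]
    simp
  · refine natDegree_mul_le.trans ?_
    have := natDegree_iterate_derivative P j
    rw [natDegree_X_pow]
    omega

/-- Multiplication by `X ^ j` compensates the degree lost by differentiation and avoids subtraction
of natural numbers in degree counts. -/
theorem natDegree_X_pow_mul_wronskian'_le (F b : ℂ[X]) (j : ℕ) :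
    (X ^ j * wronskian' j F b).natDegree ≤ F.natDegree + b.natDegree := by
  have : X ^ j * wronskian' j F b =
      X ^ j * derivative^[j] F * b - F * (X ^ j * derivative^[j] b) := by
    rw [wronskian']; ring
  rw [this]
  refine (natDegree_sub_le _ _).trans (max_le (natDegree_mul_le.trans ?_) (natDegree_mul_le.trans ?_))
  · exact Nat.add_le_add_right (natDegree_X_pow_mul_iterate_derivative_le _ _) _
  · exact Nat.add_le_add_left (natDegree_X_pow_mul_iterate_derivative_le _ _) _

theorem coeff_X_mul_wronskian' (F b : ℂ[X]) :
    (X * wronskian' 1 F b).coeff (F.natDegree + b.natDegree) =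
      ((F.natDegree : ℂ) - b.natDegree) * F.leadingCoeff * b.leadingCoeff := by
  have h : ∀ P : ℂ[X], (X * derivative P).natDegree ≤ P.natDegree := fun P => by
    simpa using natDegree_X_pow_mul_iterate_derivative_le P 1
  have hc : ∀ P : ℂ[X], (X * derivative P).coeff P.natDegree = P.natDegree * P.leadingCoeff := by
    intro P
    rcases hP : P.natDegree with _ | n
    · simp
    · rw [coeff_X_mul, coeff_derivative, leadingCoeff, hP]
      push_cast
      ring
  have : X * wronskian' 1 F b = X * derivative F * b - F * (X * derivative b) := by
    simp [wronskian']; ring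
  rw [this, coeff_sub, coeff_mul_add_eq_of_natDegree_le (h F) le_rfl,
    coeff_mul_add_eq_of_natDegree_le le_rfl (h b),
    hc, hc, coeff_natDegree, coeff_natDegree]
  ring

theorem natDegree_X_mul_le (P : ℂ[X]) : (X * P).natDegree ≤ P.natDegree + 1 := by
  refine natDegree_mul_le.trans ?_
  rw [natDegree_X, add_comm]

/-- Puts each summand in the form of a quotient with `z ^ j` attached to the `j`-th Wronskian, ready
for a comparison of degrees. -/
theorem regularizedTerm_eq_of_ne (d : ℕ) (F b : ℂ[X]) {μ₀ ρ : ℂ} (c₁ c₂ : ℂ) {z : ℂ} (hz : z ≠ 0)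
    (h1 : z ≠ μ₀) (h2 : z ≠ ρ) : regularizedTerm d F b μ₀ ρ c₁ c₂ z =
      -(1 / 6 * (F.eval z * (b.eval z - z * F.eval z) ^ 2 * (z ^ 3 * (wronskian' 3 F b).eval z) /
        (b.eval z * (z * (wronskian' 1 F b).eval z) ^ 2 * z))) -
      (d - 2) * (1 / 2 * (F.eval z ^ 2 * (b.eval z - z * F.eval z) *
        (z ^ 2 * (wronskian' 2 F b).eval z) / (b.eval z * (z * (wronskian' 1 F b).eval z) ^ 2))) -
      (d - 1) * (d - 2) *
        (1 / 2 * (F.eval z ^ 3 * z / (b.eval z * (z * (wronskian' 1 F b).eval z)))) -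
      (c₂ * (F.eval z * b.eval z * z /
          (z * (wronskian' 1 F b).eval z * ((z - μ₀) * (z - μ₀)))) +
        c₁ * (μ₀ - ρ) * (F.eval z * b.eval z * z /
          (z * (wronskian' 1 F b).eval z * ((z - μ₀) * (z - ρ))))) := by
  have h1' := sub_ne_zero.2 h1
  have h2' := sub_ne_zero.2 h2
  unfold regularizedTerm
  generalize F.eval z = f
  generalize b.eval z = B
  generalize (wronskian' 1 F b).eval z = W1
  generalize (wronskian' 2 F b).eval z = W2
  generalize (wronskian' 3 F b).eval z = W3
  have e4 : ∀ c, f * B * z / (z * W1 * ((z - μ₀) * (z - c))) =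
      f * B / W1 * (1 / ((z - μ₀) * (z - c))) := by
    intro c
    rw [mul_comm z, div_mul_div_comm, mul_one, mul_right_comm W1, mul_div_mul_right _ _ hz]
  have e1 : f * (B - z * f) ^ 2 * (z ^ 3 * W3) / (B * (z * W1) ^ 2 * z) =
      f * (B - z * f) ^ 2 * W3 / (B * W1 ^ 2) := by
    rw [← mul_div_mul_right _ (B * W1 ^ 2) (pow_ne_zero 3 hz)]
    ring
  have e2 : f ^ 2 * (B - z * f) * (z ^ 2 * W2) / (B * (z * W1) ^ 2) =
      f ^ 2 * (B - z * f) * W2 / (B * W1 ^ 2) := by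
    rw [← mul_div_mul_right _ (B * W1 ^ 2) (pow_ne_zero 2 hz)]
    ring
  have e3 : f ^ 3 * z / (B * (z * W1)) = f ^ 3 / (B * W1) := by
    rw [← mul_div_mul_right _ (B * W1) hz]
    ring
  have e5 : 1 / (z - μ₀) - 1 / (z - ρ) = (μ₀ - ρ) * (1 / ((z - μ₀) * (z - ρ))) := by
    field_simp
    ring
  rw [e4, e4, e1, e2, e3, e5]
  ring

/-- Since `deg F < deg b`, the polynomial `X (F' b - F b')` has exact degree `deg F + deg b`, and
each numerator then has smaller degree than its denominator. For the simple pole this needs `1 / (z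
- μ₀) - 1 / (z - ρ)`, which decays quadratically; `1 / (z - μ₀)` alone would not suffice. -/
theorem regularizedTerm_tendsto_cobounded {d : ℕ} {F b : ℂ[X]} {μ₀ ρ c₁ c₂ : ℂ}
    (hF0 : F ≠ 0) (hF : F.natDegree < b.natDegree) :
    Tendsto (regularizedTerm d F b μ₀ ρ c₁ c₂) (cobounded ℂ) (𝓝 0) := by
  set e := F.natDegree with he
  set k := b.natDegree with hk
  have hb0 : b ≠ 0 := fun h => by simp [hk, h] at hF
  set V := X * wronskian' 1 F b with hV
  have hVd : V.natDegree ≤ e + k := by simpa using natDegree_X_pow_mul_wronskian'_le F b 1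
  have hVc : V.coeff (e + k) ≠ 0 := by
    rw [hV, coeff_X_mul_wronskian']
    -- The top coefficient is `(deg F - deg b)` times the two leading coefficients.
    refine mul_ne_zero (mul_ne_zero (sub_ne_zero.2 ?_) (leadingCoeff_ne_zero.2 hF0))
      (leadingCoeff_ne_zero.2 hb0)
    exact_mod_cast hF.ne
  have hVn : V.natDegree = e + k := le_antisymm hVd (le_natDegree_of_ne_zero hVc)
  have hV0 : V ≠ 0 := fun h => hVc (by simp [h])
  have hW2 : (X ^ 2 * wronskian' 2 F b).natDegree ≤ e + k := natDegree_X_pow_mul_wronskian'_le F b 2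
  have hW3 : (X ^ 3 * wronskian' 3 F b).natDegree ≤ e + k := natDegree_X_pow_mul_wronskian'_le F b 3
  have hbF : (b - X * F).natDegree ≤ k := (natDegree_sub_le _ _).trans
    (max_le le_rfl ((natDegree_X_mul_le F).trans (by omega)))
  have key : ∀ (N D : ℂ[X]), D ≠ 0 → N.natDegree < D.natDegree →
      Tendsto (fun z => N.eval z / D.eval z) (cobounded ℂ) (𝓝 0) := fun N D hD h =>
    tendsto_eval_div_eval_cobounded le_rfl le_rfl (leadingCoeff_ne_zero.2 hD) h
  have t1 := key (F * (b - X * F) ^ 2 * (X ^ 3 * wronskian' 3 F b)) (b * V ^ 2 * X)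
    (mul_ne_zero (mul_ne_zero hb0 (pow_ne_zero _ hV0)) X_ne_zero) (by
      rw [natDegree_mul (mul_ne_zero hb0 (pow_ne_zero _ hV0)) X_ne_zero,
        natDegree_mul hb0 (pow_ne_zero _ hV0), natDegree_pow, natDegree_X, hVn, ← hk]
      have h1 := natDegree_mul_le (p := F * (b - X * F) ^ 2) (q := X ^ 3 * wronskian' 3 F b)
      have h2 := natDegree_mul_le (p := F) (q := (b - X * F) ^ 2)
      have h3 := natDegree_pow_le (p := b - X * F) (n := 2)
      omega)
  have t2 := key (F ^ 2 * (b - X * F) * (X ^ 2 * wronskian' 2 F b)) (b * V ^ 2)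
    (mul_ne_zero hb0 (pow_ne_zero _ hV0)) (by
      rw [natDegree_mul hb0 (pow_ne_zero _ hV0), natDegree_pow, hVn, ← hk]
      have h1 := natDegree_mul_le (p := F ^ 2 * (b - X * F)) (q := X ^ 2 * wronskian' 2 F b)
      have h2 := natDegree_mul_le (p := F ^ 2) (q := b - X * F)
      have h3 := natDegree_pow_le (p := F) (n := 2)
      omega)
  have t3 := key (F ^ 3 * X) (b * V) (mul_ne_zero hb0 hV0) (by
      rw [natDegree_mul hb0 hV0, hVn, ← hk]
      have h1 := natDegree_mul_le (p := F ^ 3) (q := (X : ℂ[X]))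
      have h3 := natDegree_pow_le (p := F) (n := 3)
      rw [natDegree_X] at h1
      omega)
  have t4 : ∀ c : ℂ, Tendsto (fun z => (F * b * X).eval z / (V * ((X - C μ₀) * (X - C c))).eval z)
      (cobounded ℂ) (𝓝 0) := by
    intro c
    have h0 := mul_ne_zero (X_sub_C_ne_zero μ₀) (X_sub_C_ne_zero c)
    refine key _ _ (mul_ne_zero hV0 h0) ?_
    rw [natDegree_mul hV0 h0, hVn, natDegree_mul (X_sub_C_ne_zero μ₀) (X_sub_C_ne_zero c),
      natDegree_X_sub_C, natDegree_X_sub_C]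
    have h1 := natDegree_mul_le (p := F * b) (q := (X : ℂ[X]))
    have h2 := natDegree_mul_le (p := F) (q := b)
    rw [natDegree_X] at h1
    omega
  have T := ((((t1.const_mul (1 / 6)).neg.sub ((t2.const_mul (1 / 2)).const_mul ((d : ℂ) - 2))).sub
    ((t3.const_mul (1 / 2)).const_mul (((d : ℂ) - 1) * (d - 2)))).sub
    (((t4 μ₀).const_mul c₂).add ((t4 ρ).const_mul (c₁ * (μ₀ - ρ)))))
  simp only [mul_zero, sub_zero, neg_zero, add_zero] at T
  refine T.congr' ?_
  filter_upwards [eventually_ne_cobounded (0 : ℂ), eventually_ne_cobounded μ₀,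
    eventually_ne_cobounded ρ] with z hz h1 h2
  simp only [hV, eval_mul, eval_pow, eval_X, eval_sub, eval_C]
  exact (regularizedTerm_eq_of_ne d F b c₁ c₂ hz h1 h2).symm

end Polynomial

/-! ### The multiple root and the residue of the sum over the roots. -/

namespace Polynomial

open Filter Topology Bornology

theorem derivative_X_sub_C_pow_succ_mul (μ₀ : ℂ) (n : ℕ) (K : ℂ[X]) :
    derivative ((X - C μ₀) ^ (n + 1) * K) =
      (X - C μ₀) ^ n * (C ((n : ℂ) + 1) * K + (X - C μ₀) * derivative K) := by
  rw [derivative_mul, derivative_X_sub_C_pow]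
  simp only [Nat.cast_add, Nat.cast_one, add_tsub_cancel_right, C_add, C_1, C_eq_natCast]
  ring

theorem X_sub_C_mul_derivative_X_sub_C_pow_mul (μ₀ : ℂ) (n : ℕ) (K : ℂ[X]) :
    (X - C μ₀) * derivative ((X - C μ₀) ^ n * K) =
      (X - C μ₀) ^ n * (C (n : ℂ) * K + (X - C μ₀) * derivative K) := by
  rcases n with _ | n
  · simp
  · rw [derivative_X_sub_C_pow_succ_mul]
    push_cast
    ring

/-- Recursion for the cofactors of `X - μ₀` in the successive derivatives of `(X - μ₀) ^ n * K`:
their first two Taylor coefficients at `μ₀` are all that the residue needs. -/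
theorem eval_derivative_C_mul_add_X_sub_C_mul (c μ₀ : ℂ) (K : ℂ[X]) :
    (C c * K + (X - C μ₀) * derivative K).eval μ₀ = c * K.eval μ₀ ∧
    (derivative (C c * K + (X - C μ₀) * derivative K)).eval μ₀ =
      (c + 1) * (derivative K).eval μ₀ := by
  constructor
  · simp
  · simp
    ring

/-- With `s = μ - μ₀`, the Wronskians of orders `1, 2, 3` are `s ^ (n+1) w`, `s ^ n v` and `s ^
(n-1) Y`. Up to terms divisible by `s`, the term without its correction is `(G b / w) h / s` with `h
= -Y / (6 w)`. The constants `c₂` and `c₁` are the value and the derivative of `h` at `μ₀`, so the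
correction cancels the singular and the constant part. -/
theorem regularizedTerm_tendsto_of_multiple {d n : ℕ} {F b G : ℂ[X]} {μ₀ ρ c₁ c₂ : ℂ}
    (hFG : F = (X - C μ₀) ^ (n + 2) * G) (hG : G.eval μ₀ ≠ 0) (hb : b.eval μ₀ ≠ 0) (hρ : μ₀ ≠ ρ)
    (hc₂ : c₂ = -((n + 1) * n / 6))
    (hc₁ : c₁ = -((n + 1) / (6 * (n + 2)) * (2 * (n + 3) * ((derivative G).eval μ₀ / G.eval μ₀) +
      n * ((derivative b).eval μ₀ / b.eval μ₀)))) :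
    Tendsto (regularizedTerm d F b μ₀ ρ c₁ c₂) (𝓝[≠] μ₀) (𝓝 0) := by
  set K₁ : ℂ[X] := C (((n + 1 : ℕ) : ℂ) + 1) * G + (X - C μ₀) * derivative G with hK₁
  set K₂ : ℂ[X] := C ((n : ℂ) + 1) * K₁ + (X - C μ₀) * derivative K₁ with hK₂
  set K₃ : ℂ[X] := C (n : ℂ) * K₂ + (X - C μ₀) * derivative K₂ with hK₃
  have hF1 : derivative F = (X - C μ₀) ^ (n + 1) * K₁ := by
    rw [hFG, derivative_X_sub_C_pow_succ_mul]
  have hF2 : derivative (derivative F) = (X - C μ₀) ^ n * K₂ := by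
    rw [hF1, derivative_X_sub_C_pow_succ_mul]
  -- The extra factor `X - μ₀` covers `n = 0`, where the exponent `n - 1` would be negative.
  have hF3 : (X - C μ₀) * derivative (derivative (derivative F)) = (X - C μ₀) ^ n * K₃ := by
    rw [hF2, X_sub_C_mul_derivative_X_sub_C_pow_mul]
  obtain ⟨k1, k1'⟩ := eval_derivative_C_mul_add_X_sub_C_mul (((n + 1 : ℕ) : ℂ) + 1) μ₀ G
  obtain ⟨k2, k2'⟩ := eval_derivative_C_mul_add_X_sub_C_mul ((n : ℂ) + 1) μ₀ K₁
  obtain ⟨k3, k3'⟩ := eval_derivative_C_mul_add_X_sub_C_mul (n : ℂ) μ₀ K₂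
  rw [← hK₁] at k1 k1'
  rw [← hK₂] at k2 k2'
  rw [← hK₃] at k3 k3'
  push_cast at k1 k1'
  set w : ℂ[X] := K₁ * b - (X - C μ₀) * G * derivative b with hw
  set v : ℂ[X] := K₂ * b - (X - C μ₀) ^ 2 * G * derivative (derivative b) with hv
  set Y : ℂ[X] := K₃ * b - (X - C μ₀) ^ 3 * G * derivative (derivative (derivative b)) with hY
  have hW1 : wronskian' 1 F b = (X - C μ₀) ^ (n + 1) * w := by
    simp only [wronskian', Function.iterate_succ, Function.iterate_zero, Function.comp_apply, id]
    rw [hF1, hFG, hw]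
    ring
  have hW2 : wronskian' 2 F b = (X - C μ₀) ^ n * v := by
    simp only [wronskian', Function.iterate_succ, Function.iterate_zero, Function.comp_apply, id]
    rw [hF2, hFG, hv]
    ring
  have hW3 : (X - C μ₀) ^ 2 * wronskian' 3 F b = (X - C μ₀) ^ (n + 1) * Y := by
    simp only [wronskian', Function.iterate_succ, Function.iterate_zero, Function.comp_apply, id]
    rw [mul_sub, ← mul_assoc, pow_two, mul_assoc (X - C μ₀), hF3, hFG, hY]
    ring
  have hw0 : w.eval μ₀ = (n + 2) * G.eval μ₀ * b.eval μ₀ := by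
    simp only [hw, eval_sub, eval_mul, k1, eval_X, eval_C, sub_self]
    ring
  have hw1 : (derivative w).eval μ₀ = (n + 3) * (derivative G).eval μ₀ * b.eval μ₀ +
      (n + 1) * G.eval μ₀ * (derivative b).eval μ₀ := by
    simp only [hw, derivative_sub, derivative_mul, eval_sub, eval_add, eval_mul, k1, k1',
      derivative_X, derivative_C, eval_X, eval_C, eval_one, eval_zero, sub_self]
    ring
  have hY0 : Y.eval μ₀ = n * (n + 1) * (n + 2) * G.eval μ₀ * b.eval μ₀ := by
    simp only [hY, eval_sub, eval_mul, eval_pow, k3, k2, k1, eval_X, eval_C, sub_self]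
    ring
  have hY1 : (derivative Y).eval μ₀ = (n + 1) * (n + 2) * (n + 3) * (derivative G).eval μ₀ *
      b.eval μ₀ + n * (n + 1) * (n + 2) * G.eval μ₀ * (derivative b).eval μ₀ := by
    simp only [hY, derivative_sub, derivative_mul, derivative_pow, eval_sub, eval_add, eval_mul,
      eval_pow, k1, k1', k2, k2', k3, k3', derivative_X, derivative_C, eval_X, eval_C, eval_one,
      eval_zero, sub_self]
    norm_num
    ring
  have hn2 : (n : ℂ) + 2 ≠ 0 := by exact_mod_cast (Nat.succ_ne_zero (n + 1))
  have hwne : w.eval μ₀ ≠ 0 := by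
    rw [hw0]
    exact mul_ne_zero (mul_ne_zero hn2 hG) hb
  let h : ℂ → ℂ := fun z => -(Y.eval z / (6 * w.eval z))
  have hh : HasDerivAt h c₁ μ₀ := by
    have := ((Y.hasDerivAt μ₀).div ((w.hasDerivAt μ₀).const_mul 6)
      (mul_ne_zero (by norm_num) hwne)).neg
    refine this.congr_deriv ?_
    rw [hY0, hY1, hw0, hw1, hc₁]
    field_simp
    ring
  have hh0 : h μ₀ = c₂ := by
    simp only [h]
    rw [hY0, hw0, hc₂]
    field_simp
  have hp : ∀ P : ℂ[X], ContinuousAt (fun μ => P.eval μ) μ₀ := fun P => P.continuous.continuousAt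
  let E : ℂ → ℂ := fun z =>
    -((z - μ₀) ^ n * G.eval z ^ 2 * (z ^ 2 * F.eval z - 2 * z * b.eval z) * Y.eval z /
      (6 * b.eval z * w.eval z ^ 2)) -
    (d - 2) * ((z - μ₀) ^ (n + 1) * G.eval z ^ 2 * (b.eval z - z * F.eval z) * v.eval z /
      (2 * b.eval z * w.eval z ^ 2)) -
    (d - 1) * (d - 2) * ((z - μ₀) ^ (2 * n + 4) * G.eval z ^ 3 / (2 * b.eval z * w.eval z)) +
    G.eval z * b.eval z / w.eval z * (c₁ / (z - ρ))
  have hE : ContinuousAt E μ₀ := by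
    have hF' := hp F
    have hb' := hp b
    have hG' := hp G
    have hw' := hp w
    have hv' := hp v
    have hY' := hp Y
    have hρ' := sub_ne_zero.2 hρ
    simp only [E]
    fun_prop (disch := simp [hb, hwne])
  -- The difference quotient of `h` tends to `c₁`; everything else is `s` times the continuous
  -- function `E`.
  have hlim : Tendsto (fun z => G.eval z * b.eval z / w.eval z * (slope h μ₀ z - c₁) +
      (z - μ₀) * E z) (𝓝[≠] μ₀) (𝓝 0) := by
    have h1 := (hasDerivAt_iff_tendsto_slope.1 hh).sub_const c₁
    have h2 : Tendsto (fun z => G.eval z * b.eval z / w.eval z) (𝓝[≠] μ₀)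
        (𝓝 (G.eval μ₀ * b.eval μ₀ / w.eval μ₀)) :=
      (((hp G).mul (hp b)).div (hp w) hwne).tendsto.mono_left nhdsWithin_le_nhds
    have h3 : Tendsto (fun z => (z - μ₀) * E z) (𝓝[≠] μ₀) (𝓝 ((μ₀ - μ₀) * E μ₀)) :=
      ((continuousAt_id.sub continuousAt_const).mul hE).tendsto.mono_left nhdsWithin_le_nhds
    have := (h2.mul h1).add h3
    simpa using this
  refine hlim.congr' ?_
  have e1 : ∀ᶠ z in 𝓝[≠] μ₀, b.eval z ≠ 0 := ((hp b).eventually_ne hb).filter_mono nhdsWithin_le_nhds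
  have e2 : ∀ᶠ z in 𝓝[≠] μ₀, w.eval z ≠ 0 :=
    ((hp w).eventually_ne hwne).filter_mono nhdsWithin_le_nhds
  have e3 : ∀ᶠ z in 𝓝[≠] μ₀, z ≠ ρ :=
    (continuousAt_id.eventually_ne hρ).filter_mono nhdsWithin_le_nhds
  filter_upwards [e1, e2, e3, self_mem_nhdsWithin] with z hbz hwz hzρ hz
  have hs : z - μ₀ ≠ 0 := sub_ne_zero.2 hz
  have hρz := sub_ne_zero.2 hzρ
  have f0 : F.eval z = (z - μ₀) ^ (n + 2) * G.eval z := by rw [hFG]; simp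
  have f1 : (wronskian' 1 F b).eval z = (z - μ₀) ^ (n + 1) * w.eval z := by rw [hW1]; simp
  have f2 : (wronskian' 2 F b).eval z = (z - μ₀) ^ n * v.eval z := by rw [hW2]; simp
  have f3 : (wronskian' 3 F b).eval z = (z - μ₀) ^ (n + 1) * Y.eval z / (z - μ₀) ^ 2 := by
    have := congrArg (eval z) hW3
    simp only [eval_mul, eval_pow, eval_sub, eval_X, eval_C] at this
    rw [eq_div_iff (pow_ne_zero 2 hs), ← this, mul_comm]
  rw [slope_def_field, hh0]
  simp only [regularizedTerm, E, h]
  rw [f1, f2, f3]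
  have hsq : (b.eval z - z * F.eval z) ^ 2 =
      b.eval z ^ 2 + (z - μ₀) ^ (n + 2) * G.eval z * (z ^ 2 * F.eval z - 2 * z * b.eval z) := by
    rw [f0]; ring
  rw [hsq]
  set f := F.eval z
  generalize b.eval z - z * f = Q
  generalize z ^ 2 * f - 2 * z * b.eval z = Q'
  rw [f0]
  generalize z - μ₀ = s at *
  generalize z - ρ = s' at *
  generalize G.eval z = g at *
  generalize b.eval z = B at *
  generalize w.eval z = w' at *
  generalize v.eval z = v' at *
  generalize Y.eval z = Y' at *
  have t1 : -(s ^ (n + 2) * g * (B ^ 2 + s ^ (n + 2) * g * Q') * (s ^ (n + 1) * Y' / s ^ 2) /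
      (6 * B * (s ^ (n + 1) * w') ^ 2)) =
      -(g * B * Y' / (6 * w' ^ 2 * s)) - s * (s ^ n * g ^ 2 * Q' * Y' / (6 * B * w' ^ 2)) := by
    field_simp
    ring
  have t2 : (s ^ (n + 2) * g) ^ 2 * Q * (s ^ n * v') / (2 * B * (s ^ (n + 1) * w') ^ 2) =
      s * (s ^ (n + 1) * g ^ 2 * Q * v' / (2 * B * w' ^ 2)) := by
    field_simp
    ring
  have t3 : (s ^ (n + 2) * g) ^ 3 / (2 * B * (s ^ (n + 1) * w')) =
      s * (s ^ (2 * n + 4) * g ^ 3 / (2 * B * w')) := by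
    field_simp
    ring
  have t4 : s ^ (n + 2) * g * B / (s ^ (n + 1) * w') * (c₂ / s ^ 2 + c₁ * (1 / s - 1 / s')) =
      g * B / w' * (c₂ / s + c₁) - s * (g * B / w' * (c₁ / s')) := by
    field_simp
    ring
  have t5 : g * B / w' * ((-(Y' / (6 * w')) - c₂) / s - c₁) =
      -(g * B * Y' / (6 * w' ^ 2 * s)) - g * B / w' * (c₂ / s + c₁) := by
    field_simp
    ring
  rw [t1, t2, t3, t4, t5]
  ring

/-- After division by `(X - μ₀) ^ n`, its value at `μ₀` is `(n + 1) G(μ₀) b(μ₀)`. Non-vanishing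
makes the critical values of `-F / b` finite in number. -/
theorem wronskian'_one_ne_zero {F b G : ℂ[X]} {μ₀ : ℂ} {n : ℕ} (hFG : F = (X - C μ₀) ^ (n + 1) * G)
    (hG : G.eval μ₀ ≠ 0) (hb : b.eval μ₀ ≠ 0) : wronskian' 1 F b ≠ 0 := by
  intro h
  have h1 : wronskian' 1 F b = (X - C μ₀) ^ n *
      ((C ((n : ℂ) + 1) * G + (X - C μ₀) * derivative G) * b - (X - C μ₀) * G * derivative b) := by
    simp only [wronskian', Function.iterate_succ, Function.iterate_zero, Function.comp_apply, id]
    rw [hFG, derivative_X_sub_C_pow_succ_mul]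
    ring
  rw [h] at h1
  rcases mul_eq_zero.1 h1.symm with h2 | h2
  · exact pow_ne_zero _ (X_sub_C_ne_zero μ₀) h2
  · have h3 := congrArg (eval μ₀) h2
    simp only [eval_sub, eval_mul, eval_add, eval_X, eval_C, sub_self, eval_zero, zero_mul, add_zero,
      sub_zero] at h3
    exact mul_ne_zero (mul_ne_zero (by exact_mod_cast n.succ_ne_zero) hG) hb h3

/-- The parameters close to, and different from, the one of a multiple root are regular. -/
theorem eventually_isRegularParam {d : ℕ} {F b : ℂ[X]} (hW : wronskian' 1 F b ≠ 0)
    (hco : ∀ μ, F.eval μ = 0 → b.eval μ ≠ 0) (hlead : F.coeff d ≠ 0 ∨ b.coeff d ≠ 0) :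
    ∀ᶠ π in 𝓝[≠] (0 : ℂ), IsRegularParam d F b π := by
  have h1 : ∀ᶠ π in 𝓝[≠] (0 : ℂ), (pencil F b π).coeff d ≠ 0 := by
    by_cases hF : F.coeff d = 0
    · have hb : b.coeff d ≠ 0 := hlead.resolve_left (not_not.2 hF)
      filter_upwards [self_mem_nhdsWithin] with π hπ
      simpa [pencil, hF, hb] using hπ
    · have hc : Continuous fun π => (pencil F b π).coeff d := by
        simpa using continuous_coeff_pencil d F b 0
      exact (hc.continuousAt.eventually_ne (by simpa [pencil] using hF)).filter_mono
        nhdsWithin_le_nhds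
  -- The critical values of `-F / b` other than `0`: a nonzero parameter with a multiple root is one
  -- of them.
  let S : Set ℂ := ((fun μ => -(F.eval μ / b.eval μ)) '' {μ | (wronskian' 1 F b).IsRoot μ}) \ {0}
  have hS : S.Finite := ((finite_setOfPred_isRoot hW).image _).sdiff
  have h2 : ∀ᶠ π in 𝓝[≠] (0 : ℂ), π ∉ S :=
    (hS.isClosed.isOpen_compl.eventually_mem (show (0 : ℂ) ∈ Sᶜ by simp [S])).filter_mono
      nhdsWithin_le_nhds
  filter_upwards [h1, h2, self_mem_nhdsWithin] with π hπ1 hπ2 hπ0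
  refine ⟨hπ1, fun μ h0 hs => hπ2 ⟨⟨μ, ?_, ?_⟩, hπ0⟩⟩
  · rw [eval_pencil] at h0
    simp only [pencil, derivative_add, derivative_C_mul, eval_add, eval_mul, eval_C] at hs
    show (wronskian' 1 F b).eval μ = 0
    simp only [wronskian', Function.iterate_succ, Function.iterate_zero, Function.comp_apply, id,
      eval_sub, eval_mul]
    linear_combination (eval μ b) * hs - (eval μ (derivative b)) * h0
  · have hb : b.eval μ ≠ 0 := fun hb => by
      rw [eval_pencil, hb, mul_zero, add_zero] at h0
      exact hco μ h0 hb
    rw [eval_pencil] at h0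
    field_simp
    linear_combination -h0

/-- The polar part at a multiple root of the sum over the roots of a pencil. -/
theorem tendsto_mul_pencilSum {d n : ℕ} {F b G : ℂ[X]} {μ₀ c₁ : ℂ} (hF : F.natDegree ≤ d)
    (hb : b.natDegree ≤ d) (hlead : F.coeff d ≠ 0 ∨ b.coeff d ≠ 0)
    (hco : ∀ μ, F.eval μ = 0 → b.eval μ ≠ 0) (hFG : F = (X - C μ₀) ^ (n + 2) * G)
    (hG : G.eval μ₀ ≠ 0) (hsimple : ∀ μ, μ ≠ μ₀ → F.eval μ = 0 → (derivative F).eval μ ≠ 0)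
    (hc₁ : c₁ = -((n + 1) / (6 * (n + 2)) * (2 * (n + 3) * ((derivative G).eval μ₀ / G.eval μ₀) +
      n * ((derivative b).eval μ₀ / b.eval μ₀)))) :
    Tendsto (fun π => π * pencilSum d F b π) (𝓝[≠] 0) (𝓝 c₁) := by
  have hFμ₀ : F.eval μ₀ = 0 := by simp [hFG]
  have hbμ₀ := hco μ₀ hFμ₀
  have hF0 : F ≠ 0 := by
    rw [hFG]
    exact mul_ne_zero (pow_ne_zero _ (X_sub_C_ne_zero μ₀)) fun h => hG (by simp [h])
  have hF'μ₀ : (derivative F).eval μ₀ = 0 := by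
    rw [hFG, derivative_X_sub_C_pow_succ_mul]
    simp
  -- An auxiliary point off the zeros of `F`. Pairing `μ₀` with `ρ` improves the decay at infinity
  -- and cancels the constant of the partial fraction expansion.
  obtain ⟨ρ, hρ⟩ : ∃ ρ, F.eval ρ ≠ 0 := by
    by_contra! h
    exact hF0 (funext fun z => by simpa using h z)
  have hμρ : μ₀ ≠ ρ := fun h => hρ (h ▸ hFμ₀)
  set c₂ : ℂ := -((n + 1) * n / 6) with hc₂
  set R := regularizedTerm d F b μ₀ ρ c₁ c₂ with hR
  have hRt : ∀ r, F.eval r = 0 → Tendsto R (𝓝[≠] r) (𝓝 0) := by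
    intro r hr
    by_cases h : r = μ₀
    · subst h
      exact regularizedTerm_tendsto_of_multiple hFG hG hbμ₀ hμρ hc₂ hc₁
    · exact regularizedTerm_tendsto_of_simple hr (hco r hr) (hsimple r h hr) h
        fun h' => hρ (h' ▸ hr)
  have hinf : F.coeff d ≠ 0 ∨ Tendsto R (cobounded ℂ) (𝓝 0) := by
    by_cases h : F.coeff d = 0
    · refine Or.inr (regularizedTerm_tendsto_cobounded hF0 ?_)
      have hbd : b.natDegree = d :=
        le_antisymm hb (le_natDegree_of_ne_zero (hlead.resolve_left (not_not.2 h)))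
      rw [hbd]
      refine lt_of_le_of_ne hF fun h' => ?_
      rw [← h', coeff_natDegree, leadingCoeff_eq_zero] at h
      exact hF0 h
    · exact Or.inl h
  have hreg := eventually_isRegularParam (wronskian'_one_ne_zero hFG hG hbμ₀) hco hlead
  have hρc : Tendsto (fun π => (pencil F b π).eval ρ) (𝓝[≠] 0) (𝓝 (F.eval ρ)) := by
    have : Continuous fun π => (pencil F b π).eval ρ := by
      simp only [eval_pencil]; fun_prop
    simpa [pencil] using (this.tendsto 0).mono_left nhdsWithin_le_nhds
  have key : ∀ᶠ π in 𝓝[≠] (0 : ℂ), ∀ ε : ℝ,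
      (∀ μ, (pencil F b π).eval μ = 0 → ‖R μ‖ < ε) →
      ‖π * pencilSum d F b π - c₁ * (1 - π * (b.eval ρ / (pencil F b π).eval ρ))‖ ≤ d * ε := by
    filter_upwards [hreg, hρc.eventually_ne hρ, self_mem_nhdsWithin] with π hπ hρπ hπ0 ε hε
    obtain ⟨r, hr, hφ⟩ := exists_injective_roots (natDegree_pencil_le hF hb π) hπ.1 hπ.2
    have hr0 : ∀ i, (pencil F b π).eval (r i) = 0 := fun i => by
      rw [hφ, eval_mul, eval_prod, Finset.prod_eq_zero (Finset.mem_univ i) (by simp), mul_zero]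
    have hbr : ∀ i, b.eval (r i) ≠ 0 := fun i h => by
      have := hr0 i
      rw [eval_pencil, h, mul_zero, add_zero] at this
      exact hco _ this h
    have hφμ₀ : (pencil F b π).eval μ₀ = π * b.eval μ₀ := by rw [eval_pencil, hFμ₀, zero_add]
    have hφ'μ₀ : (derivative (pencil F b π)).eval μ₀ = π * (derivative b).eval μ₀ := by
      simp [pencil, hF'μ₀]
    have hφμ₀0 : (pencil F b π).eval μ₀ ≠ 0 := by
      rw [hφμ₀]; exact mul_ne_zero hπ0 hbμ₀
    have s1 := sum_div_derivative_root hπ.1 hr hφ hb hφμ₀0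
    have s2 := sum_div_derivative_root hπ.1 hr hφ hb hρπ
    have s3 := sum_div_derivative_root_sq hπ.1 hr hφ hb hφμ₀0
    -- At `μ₀` both `F` and `F'` vanish, so `φ = π b` and `φ' = π b'`: the derivative of `b / φ` is
    -- zero, and the double pole contributes nothing.
    rw [hφ'μ₀, hφμ₀, show b.eval μ₀ * (π * (derivative b).eval μ₀) -
      (derivative b).eval μ₀ * (π * b.eval μ₀) = 0 by ring, zero_div] at s3
    have e1 : π * pencilSum d F b π = ∑ i, R (r i) - π * (c₂ *
        (∑ i, b.eval (r i) / (derivative (pencil F b π)).eval (r i) * ((μ₀ - r i)⁻¹) ^ 2) +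
        c₁ * (∑ i, b.eval (r i) / (derivative (pencil F b π)).eval (r i) * (ρ - r i)⁻¹ -
          ∑ i, b.eval (r i) / (derivative (pencil F b π)).eval (r i) * (μ₀ - r i)⁻¹)) := by
      rw [pencilSum_eq hπ.1 hφ, Finset.mul_sum, ← Finset.sum_sub_distrib, Finset.mul_sum,
        Finset.mul_sum, ← Finset.sum_add_distrib, Finset.mul_sum, ← Finset.sum_sub_distrib]
      refine Finset.sum_congr rfl fun i _ => ?_
      rw [mul_pencilTerm_eq (hbr i) (hr0 i) (hπ.2 _ (hr0 i)) μ₀ ρ c₁ c₂, ← neg_sub (r i) μ₀,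
        ← neg_sub (r i) ρ, div_eq_mul_inv c₂, ← inv_pow, inv_neg, inv_neg, one_div, one_div, ← hR]
      generalize (r i - μ₀)⁻¹ = x
      generalize (r i - ρ)⁻¹ = y
      ring
    rw [e1, s1, s2, s3, hφμ₀]
    have hπ0' : π ≠ 0 := hπ0
    -- Since `b / φ = 1 / π` at `μ₀`, the simple pole contributes exactly `c₁`; only the small terms
    -- `R (r i)` remain.
    have e2 : ∑ i, R (r i) - π * (c₂ * 0 + c₁ * (b.eval ρ / (pencil F b π).eval ρ -
        b.coeff d / (pencil F b π).coeff d - (b.eval μ₀ / (π * b.eval μ₀) -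
        b.coeff d / (pencil F b π).coeff d))) - c₁ * (1 - π * (b.eval ρ / (pencil F b π).eval ρ)) =
        ∑ i, R (r i) := by
      have : π * (b.eval μ₀ / (π * b.eval μ₀)) = 1 := by field_simp
      linear_combination c₁ * this
    rw [e2]
    refine (norm_sum_le _ _).trans ((Finset.sum_le_card_nsmul _ _ ε fun i _ =>
      (hε _ (hr0 i)).le).trans_eq ?_)
    simp
  have hdiff : Tendsto (fun π => π * pencilSum d F b π -
      c₁ * (1 - π * (b.eval ρ / (pencil F b π).eval ρ))) (𝓝[≠] 0) (𝓝 0) := by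
    rw [Metric.tendsto_nhds]
    intro ε hε
    have hd1 : (0 : ℝ) < d + 1 := by positivity
    filter_upwards [key, eventually_forall_root_lt hF hb hco hRt hinf
      (div_pos hε hd1)] with π h1 h2
    rw [dist_zero_right]
    refine (h1 _ h2).trans_lt ?_
    rw [mul_div_assoc', div_lt_iff₀ hd1]
    nlinarith
  have hlim : Tendsto (fun π => c₁ * (1 - π * (b.eval ρ / (pencil F b π).eval ρ))) (𝓝[≠] 0)
      (𝓝 (c₁ * (1 - 0 * (b.eval ρ / F.eval ρ)))) :=
    ((((continuous_id.tendsto (0 : ℂ)).mono_left nhdsWithin_le_nhds).mul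
      (tendsto_const_nhds.div hρc hρ)).const_sub 1).const_mul c₁
  have := hdiff.add hlim
  simpa using this

end Polynomial

/-! ### Binary forms and the webs defined by pencils. -/

namespace Polynomial

/-- The value at `(x, k)` of the binary form of degree `d` with dehomogenization `φ`. -/
noncomputable def homEval (d : ℕ) (φ : ℂ[X]) (x k : ℂ) : ℂ :=
  ∑ j ∈ Finset.range (d + 1), φ.coeff j * x ^ j * k ^ (d - j)

theorem homEval_one {d : ℕ} {φ : ℂ[X]} (hφ : φ.natDegree ≤ d) (x : ℂ) :
    homEval d φ x 1 = φ.eval x := by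
  rw [eval_eq_sum_range' (Nat.lt_succ_of_le hφ)]
  simp [homEval]

theorem homEval_zero (d : ℕ) (φ : ℂ[X]) (x : ℂ) : homEval d φ x 0 = φ.coeff d * x ^ d := by
  unfold homEval
  rw [Finset.sum_range_succ, Finset.sum_eq_zero, zero_add]
  · simp
  · intro j hj
    rw [zero_pow (Nat.sub_ne_zero_of_lt (Finset.mem_range.1 hj)), mul_zero]

theorem homEval_eq {d : ℕ} {φ : ℂ[X]} (hφ : φ.natDegree ≤ d) (x : ℂ) {k : ℂ} (hk : k ≠ 0) :
    homEval d φ x k = k ^ d * φ.eval (x / k) := by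
  rw [eval_eq_sum_range' (Nat.lt_succ_of_le hφ), Finset.mul_sum]
  refine Finset.sum_congr rfl fun j hj => ?_
  rw [pow_sub₀ _ hk (Nat.lt_succ_iff.1 (Finset.mem_range.1 hj)), div_pow]
  ring

theorem homEval_C_mul_prod {d : ℕ} (l : ℂ) (r : Fin d → ℂ) (x k : ℂ) :
    homEval d (C l * ∏ i, (X - C (r i))) x k = l * ∏ i, (x - r i * k) := by
  have hm : (∏ i, (X - C (r i))).Monic := monic_prod_of_monic _ _ fun i _ => monic_X_sub_C _
  have hd : (∏ i, (X - C (r i))).natDegree = d := by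
    rw [natDegree_prod _ _ fun i _ => X_sub_C_ne_zero _]
    simp
  by_cases hk : k = 0
  · subst hk
    rw [homEval_zero, coeff_C_mul]
    have hc : (∏ i, (X - C (r i))).coeff d = 1 := by
      have := hm.coeff_natDegree
      rwa [hd] at this
    simp [hc]
  · rw [homEval_eq ((natDegree_C_mul_le _ _).trans hd.le) x hk, eval_mul, eval_C, eval_prod]
    have : ∏ i, (x - r i * k) = ∏ i, (k * (x / k - r i)) :=
      Finset.prod_congr rfl fun i _ => by field_simp
    rw [this, Finset.prod_mul_distrib]
    simp
    ring

end Polynomial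

namespace PlanarWeb

open Filter Topology Polynomial

/-- The web `W` is, in the coordinates `(p, q)`, the web of the roots of the pencil `F + π b`,
`π = p - p₀`. -/
def IsPencilWeb (d : ℕ) (F b : ℂ[X]) (p₀ : ℂ) (W : ℂ × ℂ → ℂ × ℂ → ℂ) : Prop :=
  ∀ z ξ : ℂ × ℂ, W z ξ =
    homEval d (pencil F b (z.1 - p₀)) ξ.2 (z.2 * ξ.1 - (z.1 - p₀) * ξ.2)

theorem branchForm_apply (p₀ : ℂ) (m : ℂ → ℂ) (z ξ : ℂ × ℂ) :
    (branchForm p₀ m z).1 * ξ.1 + (branchForm p₀ m z).2 * ξ.2 =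
      -(ξ.2 - m z.1 * (z.2 * ξ.1 - (z.1 - p₀) * ξ.2)) := by
  simp only [branchForm]
  ring

theorem IsPencilWeb.eq_prod {d : ℕ} {F b : ℂ[X]} {p₀ : ℂ} {W : ℂ × ℂ → ℂ × ℂ → ℂ}
    (hW : IsPencilWeb d F b p₀ W) {z : ℂ × ℂ} {l : ℂ} {m : Fin d → ℂ → ℂ}
    (hφ : pencil F b (z.1 - p₀) = Polynomial.C l * ∏ i, (Polynomial.X - Polynomial.C (m i z.1)))
    (ξ : ℂ × ℂ) : W z ξ = (-1) ^ d * l *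
      ∏ i, ((branchForm p₀ (m i) z).1 * ξ.1 + (branchForm p₀ (m i) z).2 * ξ.2) := by
  rw [hW, hφ, homEval_C_mul_prod]
  simp only [branchForm_apply]
  rw [Finset.prod_neg]
  simp only [Finset.card_univ, Fintype.card_fin]
  have : ((-1 : ℂ) ^ d) * (-1) ^ d = 1 := by rw [← mul_pow]; simp
  linear_combination -(l * ∏ i, (ξ.2 - m i z.1 * (z.2 * ξ.1 - (z.1 - p₀) * ξ.2))) * this

/-- A product presentation of the web over a regular parameter defines roots of the pencil. -/
theorem IsPencilWeb.exists_root_of_factors {d : ℕ} {F b : ℂ[X]} {p₀ : ℂ} {W : ℂ × ℂ → ℂ × ℂ → ℂ}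
    (hW : IsPencilWeb d F b p₀ W) (hF : F.natDegree ≤ d) (hb : b.natDegree ≤ d) {z : ℂ × ℂ}
    (hz : z.2 ≠ 0) (hc : (pencil F b (z.1 - p₀)).coeff d ≠ 0) {θ : Fin d → ℂ × ℂ}
    (hθ : Factors (W z) θ) (i : Fin d) {ρ μ : ℂ}
    (hρ : ρ = -(θ i).2 - (z.1 - p₀) / z.2 * (θ i).1) (hμ : μ = (θ i).1 / (z.2 * ρ)) :
    ρ ≠ 0 ∧ θ i = ρ • branchForm p₀ (fun _ => μ) z ∧ (pencil F b (z.1 - p₀)).eval μ = 0 := by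
  have hρ0 : ρ ≠ 0 := by
    intro h0
    -- On this vector `q dp - π dq = 0`, so the web takes the value `(leading coefficient) · q ^ d ≠
    -- 0`, while the `i`-th factor is `-q ρ`.
    have h1 := hθ.2 (z.1 - p₀, z.2)
    rw [Finset.prod_eq_zero (Finset.mem_univ i), hW] at h1
    · simp only at h1
      rw [show z.2 * (z.1 - p₀) - (z.1 - p₀) * z.2 = 0 by ring, homEval_zero] at h1
      exact mul_ne_zero hc (pow_ne_zero _ hz) h1
    · rw [hρ] at h0
      simp only
      field_simp at h0
      linear_combination -h0
  have hθi : θ i = ρ • branchForm p₀ (fun _ => μ) z := by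
    ext
    · simp only [branchForm, Prod.smul_fst, smul_eq_mul, hμ]
      field_simp
    · simp only [branchForm, Prod.smul_snd, smul_eq_mul, hμ]
      rw [mul_neg, mul_add, mul_one, show ρ * ((z.1 - p₀) * ((θ i).1 / (z.2 * ρ))) =
        (z.1 - p₀) / z.2 * (θ i).1 by field_simp, hρ]
      ring
  refine ⟨hρ0, hθi, ?_⟩
  -- This vector lies in the kernel of `θ i` and satisfies `q dp - π dq = 1`, so the web evaluates
  -- to the pencil at `μ`.
  have h1 := hθ.2 ((1 + (z.1 - p₀) * μ) / z.2, μ)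
  rw [Finset.prod_eq_zero (Finset.mem_univ i), hW] at h1
  · simp only at h1
    rw [show z.2 * ((1 + (z.1 - p₀) * μ) / z.2) - (z.1 - p₀) * μ = 1 by field_simp; ring,
      homEval_one (natDegree_pencil_le hF hb _)] at h1
    exact h1
  · rw [hθi]
    simp only [branchForm, Prod.smul_fst, Prod.smul_snd, smul_eq_mul]
    field_simp
    ring

/-- The curvature of a pencil web over a regular parameter. -/
theorem HasCurvatureNear.eq_deriv_pencilSum {d : ℕ} (hd : 0 < d) {F b : ℂ[X]} {p₀ : ℂ}
    {W : ℂ × ℂ → ℂ × ℂ → ℂ} (hW : IsPencilWeb d F b p₀ W) (hF : F.natDegree ≤ d)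
    (hb : b.natDegree ≤ d) (hco : ∀ μ, F.eval μ = 0 → b.eval μ ≠ 0) {z : ℂ × ℂ} (hz : z.2 ≠ 0)
    (hreg : IsRegularParam d F b (z.1 - p₀)) {g : ℂ × ℂ → ℂ} (h : HasCurvatureNear d W g z) :
    g z = deriv (fun p => pencilSum d F b (p - p₀)) z.1 / z.2 := by
  obtain ⟨V, ω, η, hV, hzV, hω, hfac, hη, hg⟩ := h
  let ρ : Fin d → ℂ × ℂ → ℂ := fun i w => -(ω i w).2 - (w.1 - p₀) / w.2 * (ω i w).1
  let μ : Fin d → ℂ × ℂ → ℂ := fun i w => (ω i w).1 / (w.2 * ρ i w)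
  have hroot : ∀ i, ∀ w ∈ V, w.2 ≠ 0 → (pencil F b (w.1 - p₀)).coeff d ≠ 0 → ρ i w ≠ 0 ∧
      ω i w = ρ i w • branchForm p₀ (fun _ => μ i w) w ∧
      (pencil F b (w.1 - p₀)).eval (μ i w) = 0 := fun i w hw h2 hc =>
    hW.exists_root_of_factors hF hb h2 hc (hfac w hw) i rfl rfl
  have hρ0 : ∀ i, ρ i z ≠ 0 := fun i => (hroot i z hzV hz hreg.1).1
  have hω1 : ∀ i, AnalyticAt ℂ (fun w => (ω i w).1) z := fun i =>
    AnalyticAt.comp (g := Prod.fst) analyticAt_fst (hω i z hzV)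
  have hω2 : ∀ i, AnalyticAt ℂ (fun w => (ω i w).2) z := fun i =>
    AnalyticAt.comp (g := Prod.snd) analyticAt_snd (hω i z hzV)
  have hρa : ∀ i, AnalyticAt ℂ (ρ i) z := fun i =>
    (hω2 i).neg.sub (((analyticAt_fst.sub analyticAt_const).div analyticAt_snd hz).mul (hω1 i))
  have hμa : ∀ i, AnalyticAt ℂ (μ i) z := fun i =>
    (hω1 i).div (analyticAt_snd.mul (hρa i)) (mul_ne_zero hz (hρ0 i))
  have hinj : Function.Injective fun i => μ i z := by
    intro i j hij
    by_contra hne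
    have h1 := (hfac z hzV).1 i j hne
    simp only at h1 hij
    rw [(hroot i z hzV hz hreg.1).2.1, (hroot j z hzV hz hreg.1).2.1, wedge_smul_left,
      wedge_smul_right, wedge_branchForm, hij, sub_self, mul_zero, mul_zero, mul_zero] at h1
    exact h1 rfl
  -- The roots `μ i` read off from the given forms depend a priori on `(p, q)`. Local uniqueness of
  -- root branches identifies them with functions of `p` alone.
  obtain ⟨m, hmr, hmu, U, hUo, hzU, hma, hminj, -, -, hsum⟩ := exists_root_branches hd hF hb hco hreg
    hinj fun i => (hroot i z hzV hz hreg.1).2.2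
  have hfst : Tendsto (Prod.fst : ℂ × ℂ → ℂ) (𝓝 z) (𝓝 z.1) := continuous_fst.continuousAt
  have hev : ∀ i, ∀ᶠ w in 𝓝 z, ω i w = ρ i w • branchForm p₀ (m i) w := by
    intro i
    have h1 : Tendsto (fun w : ℂ × ℂ => (w.1, μ i w)) (𝓝 z) (𝓝 (z.1, μ i z)) :=
      hfst.prodMk_nhds (hμa i).continuousAt
    have h2 : ∀ᶠ w : ℂ × ℂ in 𝓝 z, w.2 ≠ 0 := continuous_snd.continuousAt.eventually_ne hz
    have h3 : ∀ᶠ w : ℂ × ℂ in 𝓝 z, (pencil F b (w.1 - p₀)).coeff d ≠ 0 :=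
      hfst.eventually ((continuous_coeff_pencil d F b p₀).continuousAt.eventually_ne hreg.1)
    filter_upwards [h1.eventually (hmu i), h2, h3, hV.mem_nhds hzV] with w hw1 hw2 hw3 hw4
    obtain ⟨-, h5, h6⟩ := hroot i w hw4 hw2 hw3
    rw [h5]
    simp only [branchForm, hw1 h6]
  rw [hg z hzV, extD_eq_of_branches hV (fun r s t h1 h2 => (hη r s t h1 h2).2) hzV (hma _ hzU)
    (hminj _ hzU) hz hρa hρ0 hev]
  have h7 : totalBranchTerm p₀ m =ᶠ[𝓝 z.1] fun p => -pencilSum d F b (p - p₀) :=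
    eventually_of_mem (hUo.mem_nhds hzU) hsum
  rw [h7.deriv_eq, deriv.fun_neg, neg_div, neg_neg]

/-- Locally it is minus `totalBranchTerm` of analytic, pairwise distinct branches. -/
theorem analyticAt_pencilSum {d : ℕ} (hd : 0 < d) {F b : ℂ[X]} {p₀ p : ℂ} (hF : F.natDegree ≤ d)
    (hb : b.natDegree ≤ d) (hco : ∀ μ, F.eval μ = 0 → b.eval μ ≠ 0)
    (hreg : IsRegularParam d F b (p - p₀)) :
    AnalyticAt ℂ (fun p => pencilSum d F b (p - p₀)) p := by
  obtain ⟨r, hr, hφ⟩ := exists_injective_roots (natDegree_pencil_le hF hb _) hreg.1 hreg.2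
  obtain ⟨m, -, -, U, hUo, hpU, hma, hminj, -, -, hsum⟩ := exists_root_branches hd hF hb hco hreg hr
    fun i => by rw [hφ, Polynomial.eval_mul, Polynomial.eval_prod,
      Finset.prod_eq_zero (Finset.mem_univ i) (by simp), mul_zero]
  have h1 := (analyticAt_totalBranchTerm (p₀ := p₀) (hma p hpU) (hminj p hpU)).neg
  refine h1.congr (eventually_of_mem (hUo.mem_nhds hpU) fun w hw => ?_)
  simp [hsum w hw]

/-- Over a regular parameter the curvature of the pencil web is given by the sum over the roots. -/
theorem IsPencilWeb.hasCurvatureNear {d : ℕ} (hd : 0 < d) {F b : ℂ[X]} {p₀ : ℂ}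
    {W : ℂ × ℂ → ℂ × ℂ → ℂ} (hW : IsPencilWeb d F b p₀ W) (hF : F.natDegree ≤ d)
    (hb : b.natDegree ≤ d) (hco : ∀ μ, F.eval μ = 0 → b.eval μ ≠ 0) {z : ℂ × ℂ} (hz : z.2 ≠ 0)
    (hreg : IsRegularParam d F b (z.1 - p₀)) {g : ℂ × ℂ → ℂ} {S : Set ℂ} (hS : IsOpen S)
    (hzS : z.1 ∈ S) (hg : ∀ w : ℂ × ℂ, w.1 ∈ S → w.2 ≠ 0 →
      g w = deriv (fun p => pencilSum d F b (p - p₀)) w.1 / w.2) : HasCurvatureNear d W g z := by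
  obtain ⟨r, hr, hφ⟩ := exists_injective_roots (natDegree_pencil_le hF hb _) hreg.1 hreg.2
  obtain ⟨m, -, -, U, hUo, hzU, hma, hminj, hc, hfac, hsum⟩ := exists_root_branches hd hF hb hco hreg
    hr fun i => by rw [hφ, Polynomial.eval_mul, Polynomial.eval_prod,
      Finset.prod_eq_zero (Finset.mem_univ i) (by simp), mul_zero]
  refine hasCurvatureNear_of_branches (p₀ := p₀) hd (hUo.inter hS) (m := m)
    (c := fun p => (-1) ^ d * (pencil F b (p - p₀)).coeff d)
    (fun p hp => hma p hp.1) (fun p hp => hminj p hp.1) (fun p _ => ?_)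
    (fun p hp => mul_ne_zero (pow_ne_zero _ (by norm_num)) (hc p hp.1))
    (fun w hw _ ξ => hW.eq_prod (hfac _ hw.1) ξ) (fun w hw hw2 => ?_) ⟨hzU, hzS⟩ hz
  · simp only [pencil, Polynomial.coeff_add, Polynomial.coeff_C_mul]
    fun_prop
  · have h7 : totalBranchTerm p₀ m =ᶠ[𝓝 w.1] fun p => -pencilSum d F b (p - p₀) :=
      eventually_of_mem (hUo.mem_nhds hw.1) hsum
    rw [hg w hw.2 hw2, h7.deriv_eq, deriv.fun_neg, neg_div, neg_neg]

theorem IsPencilWeb.notMem_discriminant {d : ℕ} {F b : ℂ[X]} {p₀ : ℂ}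
    {W : ℂ × ℂ → ℂ × ℂ → ℂ} (hW : IsPencilWeb d F b p₀ W) (hF : F.natDegree ≤ d)
    (hb : b.natDegree ≤ d) {z : ℂ × ℂ} (hz : z.2 ≠ 0) (hd : 0 < d)
    (hreg : IsRegularParam d F b (z.1 - p₀)) (hco : ∀ μ, F.eval μ = 0 → b.eval μ ≠ 0) :
    z ∉ discriminant d W := by
  obtain ⟨V, ω, -, -, hzV, -, h, -⟩ := hW.hasCurvatureNear hd hF hb hco hz hreg isOpen_univ
    (Set.mem_univ _) (g := fun w => deriv (fun p => pencilSum d F b (p - p₀)) w.1 / w.2)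
    fun w _ _ => rfl
  exact fun h' => h' ⟨_, h z hzV⟩

/-- A multiple root of the pencil belongs to the discriminant. -/
theorem IsPencilWeb.mem_discriminant {d : ℕ} (hd : 2 ≤ d) {F b G : ℂ[X]} {p₀ μ₀ : ℂ}
    {W : ℂ × ℂ → ℂ × ℂ → ℂ} (hW : IsPencilWeb d F b p₀ W) (hF : F.natDegree ≤ d)
    (hFG : F = (Polynomial.X - Polynomial.C μ₀) ^ 2 * G) {q : ℂ} (hq : q ≠ 0) :
    (p₀, q) ∈ discriminant d W := by
  rintro ⟨θ, hθ, hprod⟩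
  let L : Fin d → ℂ[X] := fun i => Polynomial.C ((θ i).1 / q) + Polynomial.C (θ i).2 * Polynomial.X
  have hL : F = ∏ i, L i := by
    -- Evaluate at `(1 / q, x)`, where `q dp - π dq = 1` for `π = 0`.
    refine Polynomial.funext fun x => ?_
    have h1 := hprod (1 / q, x)
    rw [hW] at h1
    simp only [sub_self, zero_mul, sub_zero] at h1
    rw [mul_one_div_cancel hq, homEval_one (by simpa [pencil] using hF)] at h1
    simp only [pencil, map_zero, zero_mul, add_zero] at h1
    rw [h1, Polynomial.eval_prod]
    refine Finset.prod_congr rfl fun i _ => ?_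
    simp [L]
    ring
  have hroot : ∃ i, (L i).eval μ₀ = 0 := by
    have : F.eval μ₀ = 0 := by simp [hFG]
    rw [hL, Polynomial.eval_prod] at this
    obtain ⟨i, -, hi⟩ := Finset.prod_eq_zero_iff.1 this
    exact ⟨i, hi⟩
  obtain ⟨i, hi⟩ := hroot
  have hi' : (θ i).1 = -(q * (θ i).2 * μ₀) := by
    simp only [L, Polynomial.eval_add, Polynomial.eval_mul, Polynomial.eval_C, Polynomial.eval_X] at hi
    field_simp at hi
    linear_combination hi
  have hLi : L i = Polynomial.C (θ i).2 * (Polynomial.X - Polynomial.C μ₀) := by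
    simp only [L, hi']
    rw [show -(q * (θ i).2 * μ₀) / q = -((θ i).2 * μ₀) by field_simp, map_neg, map_mul]
    ring
  rw [← Finset.mul_prod_erase _ _ (Finset.mem_univ i), hLi] at hL
  -- One factor `X - μ₀` belongs to `L i`. The second forces either `θ i = 0` or another `L j` to
  -- vanish at `μ₀`; both contradict pairwise independence.
  have hcancel : (Polynomial.X - Polynomial.C μ₀) * G =
      Polynomial.C (θ i).2 * ∏ j ∈ Finset.univ.erase i, L j := by
    apply mul_left_cancel₀ (Polynomial.X_sub_C_ne_zero μ₀)
    linear_combination hL - hFG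
  have h0 := congrArg (Polynomial.eval μ₀) hcancel
  simp only [Polynomial.eval_mul, Polynomial.eval_sub, Polynomial.eval_X, Polynomial.eval_C, sub_self,
    zero_mul, Polynomial.eval_prod] at h0
  have hne : ∀ j, j ≠ i → wedge (θ i) (θ j) ≠ 0 := fun j hj => hθ i j hj.symm
  rcases mul_eq_zero.1 h0.symm with h | h
  · have : Nontrivial (Fin d) := Fin.nontrivial_iff_two_le.2 hd
    obtain ⟨j, hj⟩ := exists_ne i
    apply hne j hj
    simp [wedge, hi', h]
  · obtain ⟨j, hj, hj0⟩ := Finset.prod_eq_zero_iff.1 h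
    apply hne j (Finset.ne_of_mem_erase hj)
    simp only [L, Polynomial.eval_add, Polynomial.eval_mul, Polynomial.eval_C, Polynomial.eval_X] at hj0
    field_simp at hj0
    simp only [wedge, hi']
    linear_combination -(θ i).2 * hj0

/-- The residue of a function with bounded derivative vanishes. -/
theorem eq_zero_of_tendsto_deriv {f : ℂ → ℂ} {p₀ c L : ℂ}
    (hf : ∀ᶠ p in 𝓝[≠] p₀, DifferentiableAt ℂ f p)
    (hc : Tendsto (fun p => (p - p₀) * f p) (𝓝[≠] p₀) (𝓝 c))
    (hL : Tendsto (deriv f) (𝓝[≠] p₀) (𝓝 L)) : c = 0 := by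
  -- The removable extension of `(p - p₀) f`. Then `(p - p₀) h' = (p - p₀) f + (p - p₀)² f'` tends
  -- both to `0` and to `c`.
  let h : ℂ → ℂ := Function.update (fun p => (p - p₀) * f p) p₀ c
  have hev : ∀ p, p ≠ p₀ → h =ᶠ[𝓝 p] fun p => (p - p₀) * f p := fun p hp => by
    filter_upwards [isOpen_ne.mem_nhds hp] with w hw
    exact Function.update_of_ne hw _ _
  have hdiff : ∀ᶠ p in 𝓝[≠] p₀, DifferentiableAt ℂ h p := by
    filter_upwards [hf, self_mem_nhdsWithin] with p hp hne
    exact ((differentiableAt_id.sub_const p₀).mul hp).congr_of_eventuallyEq (hev p hne)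
  have hcont : ContinuousAt h p₀ := by
    rw [continuousAt_update_same]
    exact hc
  have han : AnalyticAt ℂ h p₀ :=
    Complex.analyticAt_of_differentiable_on_punctured_nhds_of_continuousAt hdiff hcont
  have h1 : Tendsto (fun p => (p - p₀) * deriv h p) (𝓝[≠] p₀) (𝓝 ((p₀ - p₀) * deriv h p₀)) :=
    ((continuousAt_id.sub continuousAt_const).mul han.deriv.continuousAt).tendsto.mono_left
      nhdsWithin_le_nhds
  have h2 : Tendsto (fun p => (p - p₀) * f p + (p - p₀) ^ 2 * deriv f p) (𝓝[≠] p₀)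
      (𝓝 (c + (p₀ - p₀) ^ 2 * L)) :=
    hc.add (Tendsto.mul (((continuousAt_id.sub continuousAt_const).pow 2).tendsto.mono_left
      nhdsWithin_le_nhds) hL)
  have h3 : Tendsto (fun p => (p - p₀) * deriv h p) (𝓝[≠] p₀) (𝓝 (c + (p₀ - p₀) ^ 2 * L)) := by
    refine h2.congr' ?_
    filter_upwards [hf, self_mem_nhdsWithin] with p hp hne
    have := (((hasDerivAt_id p).sub_const p₀).mul hp.hasDerivAt).deriv
    rw [(hev p hne).deriv_eq, show deriv (fun p => (p - p₀) * f p) p = _ from this]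
    simp
    ring
  have := tendsto_nhds_unique h1 h3
  simpa using this.symm

/-- A removable singularity. -/
theorem exists_analytic_extension {f : ℂ → ℂ} {p₀ : ℂ}
    (hf : ∀ᶠ p in 𝓝[≠] p₀, DifferentiableAt ℂ f p)
    (hc : Tendsto (fun p => (p - p₀) * f p) (𝓝[≠] p₀) (𝓝 0)) :
    ∃ ε > 0, ∃ h : ℂ → ℂ, (∀ p ∈ Metric.ball p₀ ε, AnalyticAt ℂ h p) ∧ ∀ p ≠ p₀, h p = f p := by
  obtain ⟨ε, hε, hball⟩ := Metric.eventually_nhds_iff_ball.1 (eventually_nhdsWithin_iff.1 hf)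
  have hdf : DifferentiableOn ℂ f (Metric.ball p₀ ε \ {p₀}) := fun p hp =>
    (hball p hp.1 hp.2).differentiableWithinAt
  have ho : (fun p => f p - f p₀) =o[𝓝[≠] p₀] fun p => (p - p₀)⁻¹ := by
    rw [Asymptotics.isLittleO_iff_tendsto']
    · have h1 : Tendsto (fun p => (p - p₀) * f p - (p - p₀) * f p₀) (𝓝[≠] p₀)
          (𝓝 (0 - (p₀ - p₀) * f p₀)) :=
        hc.sub ((((continuous_id.sub continuous_const).mul continuous_const).tendsto p₀).mono_left
          nhdsWithin_le_nhds)
      rw [sub_self, zero_mul, sub_zero] at h1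
      refine h1.congr fun p => ?_
      rw [div_inv_eq_mul]
      ring
    · filter_upwards [self_mem_nhdsWithin] with p hp h0
      exact absurd h0 (inv_ne_zero (sub_ne_zero.2 hp))
  exact ⟨ε, hε, _, fun p hp => (Complex.differentiableOn_update_limUnder_of_isLittleO
    (Metric.ball_mem_nhds p₀ hε) hdf ho).analyticAt (Metric.isOpen_ball.mem_nhds hp),
    fun p hp => Function.update_of_ne hp _ _⟩

theorem tendsto_sub_punctured (p₀ : ℂ) : Tendsto (fun p : ℂ => p - p₀) (𝓝[≠] p₀) (𝓝[≠] 0) := by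
  refine tendsto_nhdsWithin_iff.2 ⟨?_, ?_⟩
  · have : Tendsto (fun p : ℂ => p - p₀) (𝓝 p₀) (𝓝 (p₀ - p₀)) :=
      (continuous_id.sub continuous_const).tendsto p₀
    rw [sub_self] at this
    exact this.mono_left nhdsWithin_le_nhds
  · filter_upwards [self_mem_nhdsWithin] with p hp
    exact sub_ne_zero.2 hp

/-- Fix `q` and let `p → p₀`: the derivative of the sum over the roots equals `q g(p, q)`, which
stays bounded, so the sum has no residue. -/
theorem IsPencilWeb.eq_zero_of_curvatureHolomorphicAt {d : ℕ} (hd : 0 < d) {F b : ℂ[X]} {p₀ c₁ : ℂ}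
    {W : ℂ × ℂ → ℂ × ℂ → ℂ} (hW : IsPencilWeb d F b p₀ W) (hF : F.natDegree ≤ d)
    (hb : b.natDegree ≤ d) (hco : ∀ μ, F.eval μ = 0 → b.eval μ ≠ 0)
    (hreg : ∀ᶠ p in 𝓝[≠] p₀, IsRegularParam d F b (p - p₀))
    (hlim : Tendsto (fun p => (p - p₀) * pencilSum d F b (p - p₀)) (𝓝[≠] p₀) (𝓝 c₁)) {q : ℂ}
    (hq : q ≠ 0) (h : CurvatureHolomorphicAt d W (p₀, q)) : c₁ = 0 := by
  obtain ⟨N, g, hN, hqN, hg, hcurv⟩ := h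
  have hcont : ContinuousAt (fun p : ℂ => ((p, q) : ℂ × ℂ)) p₀ := by fun_prop
  have h1 : ∀ᶠ p in 𝓝[≠] p₀, g (p, q) * q = deriv (fun p => pencilSum d F b (p - p₀)) p := by
    have h2 : ∀ᶠ p in 𝓝[≠] p₀, (p, q) ∈ N :=
      (hcont.eventually (hN.eventually_mem hqN)).filter_mono nhdsWithin_le_nhds
    filter_upwards [hreg, h2] with p hp hpN
    have h3 : HasCurvatureNear d W g (p, q) :=
      hcurv (p, q) hpN (hW.notMem_discriminant (z := (p, q)) hF hb hq hd hp hco)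
    have h4 := HasCurvatureNear.eq_deriv_pencilSum (z := (p, q)) hd hW hF hb hco hq hp h3
    rw [h4, div_mul_cancel₀ _ hq]
  have h4 : Tendsto (fun p => g (p, q) * q) (𝓝[≠] p₀) (𝓝 (g (p₀, q) * q)) := by
    have : ContinuousAt (fun p => g (p, q)) p₀ :=
      ContinuousAt.comp (f := fun p : ℂ => ((p, q) : ℂ × ℂ)) (hg _ hqN).continuousAt hcont
    exact (this.mul continuousAt_const).tendsto.mono_left nhdsWithin_le_nhds
  exact eq_zero_of_tendsto_deriv
    (hreg.mono fun p hp => (analyticAt_pencilSum hd hF hb hco hp).differentiableAt) hlim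
    (h4.congr' h1)

/-- With zero residue the sum extends to an analytic `h`, and `h'(p) / q` is the extended curvature.
Nothing is required on `p = p₀` itself, since those points lie in the discriminant. -/
theorem IsPencilWeb.curvatureHolomorphicAt {d : ℕ} (hd : 2 ≤ d) {F b G : ℂ[X]} {p₀ μ₀ : ℂ}
    {W : ℂ × ℂ → ℂ × ℂ → ℂ} (hW : IsPencilWeb d F b p₀ W) (hF : F.natDegree ≤ d)
    (hb : b.natDegree ≤ d) (hco : ∀ μ, F.eval μ = 0 → b.eval μ ≠ 0)
    (hFG : F = (Polynomial.X - Polynomial.C μ₀) ^ 2 * G)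
    (hreg : ∀ᶠ p in 𝓝[≠] p₀, IsRegularParam d F b (p - p₀))
    (hlim : Tendsto (fun p => (p - p₀) * pencilSum d F b (p - p₀)) (𝓝[≠] p₀) (𝓝 0)) {q : ℂ}
    (hq : q ≠ 0) : CurvatureHolomorphicAt d W (p₀, q) := by
  have hd0 : 0 < d := by omega
  obtain ⟨ε, hε, h, hh, hhf⟩ := exists_analytic_extension
    (hreg.mono fun p hp => (analyticAt_pencilSum hd0 hF hb hco hp).differentiableAt) hlim
  obtain ⟨δ, hδ, hball⟩ := Metric.eventually_nhds_iff_ball.1 (eventually_nhdsWithin_iff.1 hreg)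
  refine ⟨{z | z.1 ∈ Metric.ball p₀ ε ∩ Metric.ball p₀ δ ∧ z.2 ≠ 0}, fun z => deriv h z.1 / z.2,
    ((Metric.isOpen_ball.inter Metric.isOpen_ball).preimage continuous_fst).inter
      (isOpen_ne.preimage continuous_snd),
    ⟨⟨Metric.mem_ball_self hε, Metric.mem_ball_self hδ⟩, hq⟩, fun z hz => ?_, fun z hz hzd => ?_⟩
  · have h1 : AnalyticAt ℂ (deriv h ∘ Prod.fst) z :=
      AnalyticAt.comp (hh z.1 hz.1.1).deriv analyticAt_fst
    exact h1.div analyticAt_snd hz.2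
  have hne : z.1 ≠ p₀ := by
    intro h
    apply hzd
    have := hW.mem_discriminant hd hF hFG hz.2
    rwa [← h] at this
  refine hW.hasCurvatureNear hd0 hF hb hco hz.2 (hball z.1 hz.1.2 hne) isOpen_ne hne
    fun w hw _ => ?_
  have h2 : h =ᶠ[𝓝 w.1] fun p => pencilSum d F b (p - p₀) := by
    filter_upwards [isOpen_ne.mem_nhds hw] with p hp
    exact hhf p hp
  show deriv h w.1 / w.2 = _
  rw [h2.deriv_eq]

/-- The curvature of a pencil web extends holomorphically across a line of parameters if and only
if the polar part of the sum over the roots vanishes. -/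
theorem IsPencilWeb.curvatureHolomorphicAt_iff {d : ℕ} (hd : 2 ≤ d) {F b G : ℂ[X]} {p₀ μ₀ c₁ : ℂ}
    {W : ℂ × ℂ → ℂ × ℂ → ℂ} (hW : IsPencilWeb d F b p₀ W) (hF : F.natDegree ≤ d)
    (hb : b.natDegree ≤ d) (hco : ∀ μ, F.eval μ = 0 → b.eval μ ≠ 0)
    (hFG : F = (Polynomial.X - Polynomial.C μ₀) ^ 2 * G)
    (hreg : ∀ᶠ π in 𝓝[≠] (0 : ℂ), IsRegularParam d F b π)
    (hlim : Tendsto (fun π => π * pencilSum d F b π) (𝓝[≠] 0) (𝓝 c₁)) {q : ℂ} (hq : q ≠ 0) :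
    CurvatureHolomorphicAt d W (p₀, q) ↔ c₁ = 0 := by
  have hreg' := (tendsto_sub_punctured p₀).eventually hreg
  have hlim' := hlim.comp (tendsto_sub_punctured p₀)
  refine ⟨fun h => hW.eq_zero_of_curvatureHolomorphicAt (by omega) hF hb hco hreg' hlim' hq h, ?_⟩
  rintro rfl
  exact hW.curvatureHolomorphicAt hd hF hb hco hFG hreg' hlim' hq

end PlanarWeb

/-! ### Homogeneous polynomials and their restriction to the line `y = p x - 1`. -/

namespace MvPolynomial

theorem IsHomogeneous.eval_mul_left {σ : Type*} [Fintype σ] {f : MvPolynomial σ ℂ} {n : ℕ}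
    (hf : f.IsHomogeneous n) (k : ℂ) (w : σ → ℂ) :
    eval (fun i => k * w i) f = k ^ n * eval w f := by
  rw [eval_eq', eval_eq', Finset.mul_sum]
  refine Finset.sum_congr rfl fun m hm => ?_
  have hn : ∑ j, m j = n := by
    have := hf (mem_support_iff.1 hm)
    rw [← this, Finsupp.weight_apply, Finsupp.sum_fintype _ _ (by simp)]
    simp
  simp_rw [mul_pow]
  rw [Finset.prod_mul_distrib, Finset.prod_pow_eq_pow_sum, hn]
  ring

theorem IsHomogeneous.eval_scale {f : MvPolynomial (Fin 2) ℂ} {n : ℕ} (hf : f.IsHomogeneous n)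
    (k x y : ℂ) : eval ![k * x, k * y] f = k ^ n * eval ![x, y] f := by
  rw [← hf.eval_mul_left]
  congr 1
  congr 1
  funext i
  fin_cases i <;> rfl

/-- Euler's identity at a point. -/
theorem IsHomogeneous.euler {f : MvPolynomial (Fin 2) ℂ} {n : ℕ} (hf : f.IsHomogeneous n) :
    X 0 * pderiv 0 f + X 1 * pderiv 1 f = (n : MvPolynomial (Fin 2) ℂ) * f := by
  have := hf.sum_X_mul_pderiv
  rwa [Fin.sum_univ_two, nsmul_eq_mul] at this

theorem IsHomogeneous.eval_euler {f : MvPolynomial (Fin 2) ℂ} {n : ℕ} (hf : f.IsHomogeneous n)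
    (x y : ℂ) : x * eval ![x, y] (pderiv 0 f) + y * eval ![x, y] (pderiv 1 f) =
      n * eval ![x, y] f := by
  have := congrArg (eval ![x, y]) hf.euler
  simpa using this

/-- The factor `k` on the left replaces the exponent `n - 1`, so that constants are included. -/
theorem IsHomogeneous.eval_pderiv_scale {f : MvPolynomial (Fin 2) ℂ} {n : ℕ}
    (hf : f.IsHomogeneous n) (i : Fin 2) (k x y : ℂ) :
    k * eval ![k * x, k * y] (pderiv i f) = k ^ n * eval ![x, y] (pderiv i f) := by
  rw [(hf.pderiv (i := i)).eval_scale]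
  rcases n with _ | n
  · have hC : ∃ c, f = C c := by
      rw [← totalDegree_zero_iff_isHomogeneous, totalDegree_eq_zero_iff_eq_C] at hf
      exact ⟨_, hf⟩
    obtain ⟨c, rfl⟩ := hC
    simp
  · simp only [Nat.add_sub_cancel]
    ring

/-- The homogeneous component of degree `n` of `g` serves as cofactor, by comparison of the
components of degree `m + n`. -/
theorem IsHomogeneous.exists_of_mul {σ : Type*} {l g : MvPolynomial σ ℂ} {m n : ℕ}
    (hl : l.IsHomogeneous m) (hlg : (l * g).IsHomogeneous (m + n)) :
    ∃ h : MvPolynomial σ ℂ, h.IsHomogeneous n ∧ l * g = l * h := by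
  refine ⟨homogeneousComponent n g, homogeneousComponent_isHomogeneous n g, ?_⟩
  let := gradedAlgebra (σ := σ) (R := ℂ)
  have h1 := DirectSum.coe_decompose_mul_add_of_left_mem (homogeneousSubmodule σ ℂ) (i := m) (j := n)
    (b := g) ((mem_homogeneousSubmodule m l).2 hl)
  have h2 : ∀ (k : ℕ) (p : MvPolynomial σ ℂ),
      ((DirectSum.decompose (homogeneousSubmodule σ ℂ) p) k : MvPolynomial σ ℂ) =
        homogeneousComponent k p := fun k p => decomposition.decompose'_apply p k
  rw [h2, h2, homogeneousComponent_eq_self hlg] at h1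
  exact h1

/-- The restriction of a polynomial to the line `y = p x - 1`. -/
noncomputable def restrictLine (p : ℂ) : MvPolynomial (Fin 2) ℂ →ₐ[ℂ] Polynomial ℂ :=
  aeval ![Polynomial.X, Polynomial.C p * Polynomial.X - 1]

theorem restrictLine_X_zero (p : ℂ) : restrictLine p (X 0) = Polynomial.X := by simp [restrictLine]

theorem restrictLine_X_one (p : ℂ) :
    restrictLine p (X 1) = Polynomial.C p * Polynomial.X - 1 := by simp [restrictLine]

theorem restrictLine_C (p c : ℂ) : restrictLine p (C c) = Polynomial.C c := by
  simp [restrictLine]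

theorem eval_restrictLine (p : ℂ) (f : MvPolynomial (Fin 2) ℂ) (μ : ℂ) :
    (restrictLine p f).eval μ = eval ![μ, p * μ - 1] f := by
  induction f using MvPolynomial.induction_on with
  | C c => simp
  | add f g hf hg => simp [hf, hg]
  | mul_X f i hf =>
    fin_cases i
    · simp [hf, restrictLine_X_zero]
    · simp [hf, restrictLine_X_one]

theorem derivative_restrictLine (p : ℂ) (f : MvPolynomial (Fin 2) ℂ) :
    Polynomial.derivative (restrictLine p f) =
      restrictLine p (pderiv 0 f) + Polynomial.C p * restrictLine p (pderiv 1 f) := by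
  induction f using MvPolynomial.induction_on with
  | C c => simp
  | add f g hf hg =>
    simp only [map_add, hf, hg]
    ring
  | mul_X f i hf =>
    fin_cases i
    · simp [hf, restrictLine_X_zero, pderiv_X]
      ring
    · simp [hf, restrictLine_X_one, pderiv_X]
      ring

theorem eval_derivative_restrictLine (p : ℂ) (f : MvPolynomial (Fin 2) ℂ) (μ : ℂ) :
    (Polynomial.derivative (restrictLine p f)).eval μ =
      eval ![μ, p * μ - 1] (pderiv 0 f) + p * eval ![μ, p * μ - 1] (pderiv 1 f) := by
  rw [derivative_restrictLine, Polynomial.eval_add, Polynomial.eval_mul, Polynomial.eval_C,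
    eval_restrictLine, eval_restrictLine]

theorem IsHomogeneous.natDegree_restrictLine_le {f : MvPolynomial (Fin 2) ℂ} {n : ℕ}
    (hf : f.IsHomogeneous n) (p : ℂ) : (restrictLine p f).natDegree ≤ n := by
  rw [restrictLine, aeval_def, eval₂_eq']
  refine Polynomial.natDegree_sum_le_of_forall_le _ _ fun m hm => ?_
  have hn : m 0 + m 1 = n := by
    have := hf (mem_support_iff.1 hm)
    rw [← this, Finsupp.weight_apply, Finsupp.sum_fintype _ _ (by simp)]
    simp
  rw [Fin.prod_univ_two]
  refine (Polynomial.natDegree_C_mul_le _ _).trans (Polynomial.natDegree_mul_le.trans ?_)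
  rw [← hn]
  refine add_le_add ?_ ?_
  · refine (Polynomial.natDegree_pow_le_of_le (m := 1) _ ?_).trans_eq (mul_one _)
    simp
  · refine (Polynomial.natDegree_pow_le_of_le (m := 1) _ ?_).trans_eq (mul_one _)
    simp only [Matrix.cons_val_one, Matrix.cons_val_fin_one]
    compute_degree

/-- Homogeneity gives the identity for `k ≠ 0`, and continuity in `k` extends it to `k = 0`, the
direction at infinity of the line. -/
theorem IsHomogeneous.homEval_restrictLine {f : MvPolynomial (Fin 2) ℂ} {n : ℕ}
    (hf : f.IsHomogeneous n) (p x k : ℂ) :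
    Polynomial.homEval n (restrictLine p f) x k = eval ![x, p * x - k] f := by
  have h1 : Continuous fun k => Polynomial.homEval n (restrictLine p f) x k := by
    unfold Polynomial.homEval
    fun_prop
  have h2 : Continuous fun k => eval ![x, p * x - k] f := by
    refine (MvPolynomial.continuous_eval f).comp (continuous_pi fun i => ?_)
    fin_cases i
    · exact continuous_const
    · exact continuous_const.sub continuous_id
  refine congrFun (h1.ext_on (dense_compl_singleton (0 : ℂ)) h2 fun k hk => ?_) k
  have hk0 : k ≠ 0 := hk
  simp only
  rw [Polynomial.homEval_eq (hf.natDegree_restrictLine_le p) x hk0, eval_restrictLine,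
    ← hf.eval_scale, mul_div_cancel₀ _ hk0, mul_sub, mul_one, mul_left_comm, mul_div_cancel₀ _ hk0]

theorem IsHomogeneous.coeff_restrictLine {f : MvPolynomial (Fin 2) ℂ} {n : ℕ}
    (hf : f.IsHomogeneous n) (p : ℂ) : (restrictLine p f).coeff n = eval ![1, p] f := by
  have := hf.homEval_restrictLine p 1 0
  rw [Polynomial.homEval_zero] at this
  simpa using this

end MvPolynomial

namespace MvPolynomial

theorem linForm_isHomogeneous (a b : ℂ) : (linForm a b).IsHomogeneous 1 :=
  (isHomogeneous_C_mul_X a 0).add (isHomogeneous_C_mul_X b 1)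

theorem eval_linForm (a b x y : ℂ) : eval ![x, y] (linForm a b) = a * x + b * y := by
  simp [linForm]

end MvPolynomial

/-! ### The criterion for a pencil of binary forms. -/

namespace PlanarWeb

open Filter Topology Polynomial

/-- The web of the pencil `A + p B` of binary forms, near a parameter over which the form has
exactly one multiple root of multiplicity `n + 2`. -/
theorem curvatureHolomorphicAt_iff_of_forms {d n e : ℕ} (hd : 2 ≤ d)
    {A B P : MvPolynomial (Fin 2) ℂ} (hA : A.IsHomogeneous d) (hB : B.IsHomogeneous d)
    (hP : P.IsHomogeneous e)
    (hAB : ∀ x y, ![x, y] ≠ 0 → MvPolynomial.eval ![x, y] A = 0 → MvPolynomial.eval ![x, y] B ≠ 0)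
    {W : ℂ × ℂ → ℂ × ℂ → ℂ} {a b v₀ v₁ p₀ u : ℂ}
    (hW : ∀ z ξ : ℂ × ℂ, W z ξ = MvPolynomial.eval ![ξ.2, z.1 * ξ.2 - z.2 * ξ.1] A +
      z.1 * MvPolynomial.eval ![ξ.2, z.1 * ξ.2 - z.2 * ξ.1] B)
    (hl : a * v₀ + b * v₁ = 0) (hk : p₀ * v₀ - v₁ ≠ 0) (hκ : a + b * p₀ ≠ 0)
    (hBv : MvPolynomial.eval ![v₀, v₁] B ≠ 0) (hu : u ≠ 0)
    (hF : MvPolynomial.C u * (A + MvPolynomial.C p₀ * B) = linForm a b ^ (n + 2) * P)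
    (hPv : MvPolynomial.eval ![v₀, v₁] P ≠ 0)
    (hcrit : ∀ x y, p₀ * x - y ≠ 0 →
      MvPolynomial.eval ![x, y] (A + MvPolynomial.C p₀ * B) = 0 →
      (∀ i, MvPolynomial.eval ![x, y] (pderiv i (A + MvPolynomial.C p₀ * B)) = 0) →
      a * x + b * y = 0) {q : ℂ} (hq : q ≠ 0) :
    CurvatureHolomorphicAt d W (p₀, q) ↔ MvPolynomial.eval ![v₀, v₁]
      (MvPolynomial.C (n : ℂ) * (pderiv 0 B - pderiv 1 A) * P +
        MvPolynomial.C (2 * ((n : ℂ) + 3)) * (pderiv 0 P * B - A * pderiv 1 P)) = 0 := by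
  set Φ := A + MvPolynomial.C p₀ * B with hΦ
  have hΦh : Φ.IsHomogeneous d := hA.add (hB.C_mul p₀)
  set k : ℂ := p₀ * v₀ - v₁ with hkdef
  set κ : ℂ := a + b * p₀ with hκdef
  set μ₀ : ℂ := v₀ / k with hμ₀
  have hv₁ : p₀ * μ₀ - 1 = v₁ / k := by
    rw [hμ₀]
    field_simp
    rw [hkdef]
    ring
  have hκμ : κ * μ₀ = b := by
    rw [hμ₀]
    field_simp
    rw [hκdef, hkdef]
    linear_combination hl
  let F : ℂ[X] := restrictLine p₀ Φ
  let β : ℂ[X] := restrictLine p₀ B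
  let G : ℂ[X] := Polynomial.C (κ ^ (n + 2) / u) * restrictLine p₀ P
  have hlin : restrictLine p₀ (linForm a b) =
      Polynomial.C κ * (Polynomial.X - Polynomial.C μ₀) := by
    rw [linForm, map_add, map_mul, map_mul, restrictLine_C, restrictLine_C, restrictLine_X_zero,
      restrictLine_X_one, mul_sub (Polynomial.C κ), ← Polynomial.C_mul, hκμ, hκdef, Polynomial.C_add,
      Polynomial.C_mul]
    ring
  have hFG : F = (Polynomial.X - Polynomial.C μ₀) ^ (n + 2) * G := by
    have h1 := congrArg (restrictLine p₀) hF
    rw [map_mul, map_mul, map_pow, hlin, restrictLine_C] at h1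
    have h2 : F = Polynomial.C u⁻¹ * (Polynomial.C u * F) := by
      rw [← mul_assoc, ← Polynomial.C_mul, inv_mul_cancel₀ hu, Polynomial.C_1, one_mul]
    rw [h2, h1]
    simp only [G]
    rw [mul_pow, ← Polynomial.C_pow, div_eq_inv_mul, Polynomial.C_mul]
    ring
  have hFd : F.natDegree ≤ d := hΦh.natDegree_restrictLine_le p₀
  have hβd : β.natDegree ≤ d := hB.natDegree_restrictLine_le p₀
  have hpencil : IsPencilWeb d F β p₀ W := by
    intro z ξ
    have h1 : pencil F β (z.1 - p₀) =
        restrictLine p₀ (Φ + MvPolynomial.C (z.1 - p₀) * B) := by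
      rw [map_add, map_mul, restrictLine_C]
      rfl
    -- Here `p dq - q dp = p₀ dq - (q dp - π dq)`, which explains the second argument in
    -- `IsPencilWeb`.
    rw [h1, (hΦh.add (hB.C_mul _)).homEval_restrictLine, hW, hΦ,
      show p₀ * ξ.2 - (z.2 * ξ.1 - (z.1 - p₀) * ξ.2) = z.1 * ξ.2 - z.2 * ξ.1 by ring]
    simp only [map_add, map_mul, MvPolynomial.eval_C]
    ring
  have hΦA : ∀ x y, MvPolynomial.eval ![x, y] Φ = MvPolynomial.eval ![x, y] A +
      p₀ * MvPolynomial.eval ![x, y] B := fun x y => by simp [hΦ]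
  have hco : ∀ μ, F.eval μ = 0 → β.eval μ ≠ 0 := by
    intro μ h1 h2
    simp only [F, β, eval_restrictLine] at h1 h2
    refine hAB μ (p₀ * μ - 1) ?_ ?_ h2
    · intro h3
      have h4 : μ = 0 := congrFun h3 0
      have h5 : p₀ * μ - 1 = 0 := congrFun h3 1
      simp [h4] at h5
    · rw [hΦA, h2] at h1
      simpa using h1
  have hlead : F.coeff d ≠ 0 ∨ β.coeff d ≠ 0 := by
    by_contra! h
    obtain ⟨h1, h2⟩ := h
    simp only [F, β] at h1 h2
    rw [hΦh.coeff_restrictLine, hΦA] at h1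
    rw [hB.coeff_restrictLine] at h2
    refine hAB 1 p₀ (fun h3 => one_ne_zero (congrFun h3 0)) ?_ h2
    rw [h2] at h1
    simpa using h1
  -- A double root of the restriction is, by Euler's identity, a zero of the whole gradient of `Φ`,
  -- so `hcrit` applies; the condition `p₀ x - y ≠ 0` holds since it equals `1` there.
  have hsimple : ∀ μ, μ ≠ μ₀ → F.eval μ = 0 → (derivative F).eval μ ≠ 0 := by
    intro μ hμ h1 h2
    simp only [F, eval_restrictLine, eval_derivative_restrictLine] at h1 h2
    have h3 := hΦh.eval_euler μ (p₀ * μ - 1)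
    rw [h1, mul_zero] at h3
    have h4 : MvPolynomial.eval ![μ, p₀ * μ - 1] (pderiv 1 Φ) = 0 := by
      linear_combination μ * h2 - h3
    have h5 : MvPolynomial.eval ![μ, p₀ * μ - 1] (pderiv 0 Φ) = 0 := by
      linear_combination h2 - p₀ * h4
    have h6 := hcrit μ (p₀ * μ - 1) (by simp) h1 fun i => by
      fin_cases i
      · exact h5
      · exact h4
    apply hμ
    apply mul_left_cancel₀ hκ
    rw [hκμ, hκdef]
    linear_combination h6
  have hv₀k : k * μ₀ = v₀ := by rw [hμ₀]; field_simp
  have hv₁k : k * (p₀ * μ₀ - 1) = v₁ := by rw [hv₁]; field_simp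
  have hscale : ∀ {f : MvPolynomial (Fin 2) ℂ} {m : ℕ}, f.IsHomogeneous m →
      MvPolynomial.eval ![v₀, v₁] f = k ^ m * (restrictLine p₀ f).eval μ₀ := by
    intro f m hf
    rw [eval_restrictLine, ← hf.eval_scale, hv₀k, hv₁k]
  have hscale' : ∀ {f : MvPolynomial (Fin 2) ℂ} {m : ℕ}, f.IsHomogeneous m →
      k * (MvPolynomial.eval ![v₀, v₁] (pderiv 0 f) +
        p₀ * MvPolynomial.eval ![v₀, v₁] (pderiv 1 f)) =
      k ^ m * (derivative (restrictLine p₀ f)).eval μ₀ := by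
    intro f m hf
    have h0 := hf.eval_pderiv_scale 0 k μ₀ (p₀ * μ₀ - 1)
    have h1 := hf.eval_pderiv_scale 1 k μ₀ (p₀ * μ₀ - 1)
    rw [hv₀k, hv₁k] at h0 h1
    rw [eval_derivative_restrictLine]
    linear_combination h0 + p₀ * h1
  have hβ0 : β.eval μ₀ ≠ 0 := fun h => hBv (by rw [hscale hB]; exact mul_eq_zero_of_right _ h)
  have hP0 : (restrictLine p₀ P).eval μ₀ ≠ 0 := fun h =>
    hPv (by rw [hscale hP]; exact mul_eq_zero_of_right _ h)
  have hc : κ ^ (n + 2) / u ≠ 0 := div_ne_zero (pow_ne_zero _ hκ) hu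
  have hG0 : G.eval μ₀ ≠ 0 := by
    simp only [G, Polynomial.eval_mul, Polynomial.eval_C]
    exact mul_ne_zero hc hP0
  have hreg : ∀ᶠ π in 𝓝[≠] (0 : ℂ), IsRegularParam d F β π :=
    eventually_isRegularParam (wronskian'_one_ne_zero (n := n + 1) hFG hG0 hβ0) hco hlead
  have hlim := tendsto_mul_pencilSum hFd hβd hlead hco hFG hG0 hsimple rfl
  rw [hpencil.curvatureHolomorphicAt_iff (G := (Polynomial.X - Polynomial.C μ₀) ^ n * G) hd hFd hβd
    hco (by rw [hFG]; ring) hreg hlim hq]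
  -- `Φ = A + p₀ B` vanishes to order at least two along the line. With `A = -p₀ B` and `∂A/∂y = -p₀
  -- ∂B/∂y` at the point, both parts of `Q` become derivatives along the direction `(1, p₀)`, that
  -- is, derivatives of the restrictions.
  have hgrad : MvPolynomial.eval ![v₀, v₁] (pderiv 1 A) =
      -p₀ * MvPolynomial.eval ![v₀, v₁] (pderiv 1 B) := by
    have h1 := congrArg (fun f => MvPolynomial.eval ![v₀, v₁] (pderiv 1 f)) hF
    simp only [hΦ, pderiv_mul, pderiv_C, pderiv_pow, map_add, map_mul, map_pow, MvPolynomial.eval_C,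
      eval_linForm, hl, map_zero] at h1
    have h2 : u * (MvPolynomial.eval ![v₀, v₁] (pderiv 1 A) +
        p₀ * MvPolynomial.eval ![v₀, v₁] (pderiv 1 B)) = 0 := by
      have hz : (0 : ℂ) ^ (n + 2 - 1) = 0 := by simp
      simp only [hz] at h1
      simpa using h1
    have h3 := (mul_eq_zero.1 h2).resolve_left hu
    linear_combination h3
  have hval : MvPolynomial.eval ![v₀, v₁] A = -p₀ * MvPolynomial.eval ![v₀, v₁] B := by
    have h1 := congrArg (MvPolynomial.eval ![v₀, v₁]) hF
    simp only [map_mul, map_pow, MvPolynomial.eval_C, eval_linForm, hl, hΦA] at h1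
    have h2 : u * (MvPolynomial.eval ![v₀, v₁] A + p₀ * MvPolynomial.eval ![v₀, v₁] B) = 0 := by
      simpa using h1
    have h3 := (mul_eq_zero.1 h2).resolve_left hu
    linear_combination h3
  have hQ : k * MvPolynomial.eval ![v₀, v₁]
      (MvPolynomial.C (n : ℂ) * (pderiv 0 B - pderiv 1 A) * P +
        MvPolynomial.C (2 * ((n : ℂ) + 3)) * (pderiv 0 P * B - A * pderiv 1 P)) =
      k ^ (d + e) * (n * (derivative β).eval μ₀ * (restrictLine p₀ P).eval μ₀ +
        2 * (n + 3) * (derivative (restrictLine p₀ P)).eval μ₀ * β.eval μ₀) := by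
    simp only [map_add, map_sub, map_mul, MvPolynomial.eval_C, hgrad, hval]
    have e1 := hscale hB
    have e2 := hscale hP
    have e3 := hscale' hB
    have e4 := hscale' hP
    simp only [β]
    rw [pow_add]
    linear_combination (n : ℂ) * MvPolynomial.eval ![v₀, v₁] P * e3 +
      n * k ^ d * (derivative (restrictLine p₀ B)).eval μ₀ * e2 +
      2 * (n + 3) * MvPolynomial.eval ![v₀, v₁] B * e4 +
      2 * (n + 3) * k ^ e * (derivative (restrictLine p₀ P)).eval μ₀ * e1
  have hn1 : ((n : ℂ) + 1) ≠ 0 := by exact_mod_cast n.succ_ne_zero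
  have hn2 : ((n : ℂ) + 2) ≠ 0 := by exact_mod_cast (n + 1).succ_ne_zero
  have hQ0 := congrArg (· = 0) hQ
  simp only [mul_eq_zero_iff_left hk, mul_eq_zero_iff_left (pow_ne_zero _ hk)] at hQ0
  rw [hQ0, neg_eq_zero, mul_eq_zero_iff_left (div_ne_zero hn1 (mul_ne_zero (by norm_num) hn2))]
  simp only [G, derivative_C_mul, Polynomial.eval_mul, Polynomial.eval_C]
  rw [mul_div_mul_left _ _ hc]
  field_simp
  constructor <;> intro h <;> linear_combination h

end PlanarWeb

/-! ### Inflection order and multiplicity in the fibre polynomial. -/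

namespace MvPolynomial

theorem linForm_dvd_of_eval {f : MvPolynomial (Fin 2) ℂ} {n : ℕ} (hf : f.IsHomogeneous n) {a b : ℂ}
    (hv : ![b, -a] ≠ 0) (h0 : eval ![b, -a] f = 0) : linForm a b ∣ f := by
  have h := HomogeneousFoliation.linForm_dvd hf hv h0
  have h1 : linForm (-a) (-b) = -linForm a b := by
    simp only [linForm, map_neg]
    ring
  rwa [h1, neg_dvd] at h

theorem linForm_ne_zero {a b : ℂ} (hv : ![b, -a] ≠ 0) : linForm a b ≠ 0 := by
  intro h
  apply hv
  have h0 := congrArg (eval ![1, 0]) h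
  have h1 := congrArg (eval ![0, 1]) h
  simp only [eval_linForm, map_zero] at h0 h1
  have ha : a = 0 := by linear_combination h0
  have hb : b = 0 := by linear_combination h1
  simp [ha, hb]

/-- A binary form factors as a power of a linear form times a form prime to it. -/
theorem IsHomogeneous.exists_linForm_pow_mul {a b : ℂ} (hv : ![b, -a] ≠ 0) {n : ℕ} :
    ∀ {f : MvPolynomial (Fin 2) ℂ}, f.IsHomogeneous n → f ≠ 0 →
      ∃ (k e : ℕ) (P : MvPolynomial (Fin 2) ℂ), P.IsHomogeneous e ∧ f = linForm a b ^ k * P ∧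
        eval ![b, -a] P ≠ 0 := by
  induction n with
  | zero =>
    intro f hf hf0
    refine ⟨0, 0, f, hf, by simp, fun h => hf0 ?_⟩
    rw [← totalDegree_zero_iff_isHomogeneous, totalDegree_eq_zero_iff_eq_C] at hf
    rw [hf, eval_C] at h
    rw [hf, h, map_zero]
  | succ n ih =>
    intro f hf hf0
    by_cases h0 : eval ![b, -a] f = 0
    · obtain ⟨g, rfl⟩ := linForm_dvd_of_eval hf hv h0
      rw [add_comm] at hf
      obtain ⟨h, hh, hgh⟩ := (linForm_isHomogeneous a b).exists_of_mul hf
      rw [hgh] at hf0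
      obtain ⟨k, e, P, hP, hPe, hPv⟩ := ih hh (right_ne_zero_of_mul hf0)
      exact ⟨k + 1, e, P, hP, by rw [hgh, hPe, pow_succ']; ring, hPv⟩
    · exact ⟨0, n + 1, f, hf, by simp, h0⟩

/-- The Jacobian determinant. -/
noncomputable def jacobianDet (f g : MvPolynomial (Fin 2) ℂ) : MvPolynomial (Fin 2) ℂ :=
  pderiv 0 f * pderiv 1 g - pderiv 1 f * pderiv 0 g

theorem pderiv_linForm (a b : ℂ) :
    pderiv 0 (linForm a b) = C a ∧ pderiv 1 (linForm a b) = C b := by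
  constructor <;> simp [linForm, pderiv_X]

/-- Exactly one power of the linear form is lost: on the line, the cofactor is `(k + 1) P` times `a
∂D/∂y - b ∂D/∂x`, which Euler's identity evaluates as `-n D ≠ 0`. -/
theorem jacobianDet_linForm_pow_mul {a b : ℂ} {k n : ℕ} {P D : MvPolynomial (Fin 2) ℂ}
    (hD : D.IsHomogeneous n) (hn : n ≠ 0) (hDv : eval ![b, -a] D ≠ 0) (hPv : eval ![b, -a] P ≠ 0) :
    ∃ S, jacobianDet (linForm a b ^ (k + 1) * P) D = linForm a b ^ k * S ∧
      eval ![b, -a] S ≠ 0 := by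
  obtain ⟨ha, hb⟩ := pderiv_linForm a b
  refine ⟨((k + 1 : ℕ) : MvPolynomial (Fin 2) ℂ) * P * (C a * pderiv 1 D - C b * pderiv 0 D) +
    linForm a b * jacobianDet P D, ?_, ?_⟩
  · simp only [jacobianDet, pderiv_mul, pderiv_pow, ha, hb, Nat.add_sub_cancel]
    ring
  · have h1 := hD.eval_euler b (-a)
    have h2 : eval ![b, -a] (((k + 1 : ℕ) : MvPolynomial (Fin 2) ℂ) * P *
        (C a * pderiv 1 D - C b * pderiv 0 D) + linForm a b * jacobianDet P D) =
        -((k + 1 : ℕ) * eval ![b, -a] P * (n * eval ![b, -a] D)) := by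
      rw [← h1]
      simp only [map_add, map_mul, map_sub, map_natCast, eval_C, eval_linForm]
      ring
    rw [h2]
    refine neg_ne_zero.2 (mul_ne_zero (mul_ne_zero ?_ hPv) (mul_ne_zero ?_ hDv))
    · exact_mod_cast k.succ_ne_zero
    · exact_mod_cast hn

theorem emultiplicity_linForm {a b : ℂ} (hv : ![b, -a] ≠ 0) {k : ℕ} {c : ℂ} (hc : c ≠ 0)
    {f S : MvPolynomial (Fin 2) ℂ} (hf : C c * f = linForm a b ^ k * S)
    (hS : eval ![b, -a] S ≠ 0) : emultiplicity (linForm a b) f = k := by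
  have hu : IsUnit (C c : MvPolynomial (Fin 2) ℂ) :=
    (isUnit_iff_ne_zero.2 hc).map (C : ℂ →+* MvPolynomial (Fin 2) ℂ)
  rw [emultiplicity_eq_coe, ← hu.dvd_mul_left, ← hu.dvd_mul_left (b := f), hf]
  refine ⟨dvd_mul_right _ _, fun h => hS ?_⟩
  rw [pow_succ, mul_dvd_mul_iff_left (pow_ne_zero _ (linForm_ne_zero hv))] at h
  obtain ⟨g, rfl⟩ := h
  rw [map_mul, eval_linForm]
  ring

end MvPolynomial

namespace HomogeneousFoliation

variable {d : ℕ} (H : HomogeneousFoliation d)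

theorem eval_ne_zero_of_eval_eq_zero {x y : ℂ} (hv : ![x, y] ≠ 0) (hA : eval ![x, y] H.A = 0) :
    eval ![x, y] H.B ≠ 0 := fun hB =>
  not_isUnit_linForm _ _
    (H.gcd_eq_one (linForm_dvd H.homogeneous_A hv hA) (linForm_dvd H.homogeneous_B hv hB))

/-- Euler's identity for `A` and `B` splits the inflection divisor into the invariant lines `x A + y
B` and the Jacobian, which governs the critical points of the Gauss map. -/
theorem natCast_mul_inflectionPoly :
    (d : MvPolynomial (Fin 2) ℂ) * H.inflectionPoly =
      -((X 0 * H.A + X 1 * H.B) * jacobianDet H.A H.B) := by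
  have hA := H.homogeneous_A.euler
  have hB := H.homogeneous_B.euler
  simp only [inflectionPoly, tangentField, jacobianDet, pderiv_X, map_sub, Pi.single_apply]
  simp
  linear_combination (-H.B * pderiv 0 H.B + H.A * pderiv 1 H.B) * hA +
    (H.B * pderiv 0 H.A - H.A * pderiv 1 H.A) * hB

theorem jacobianDet_fiberPoly (a b : ℂ) :
    jacobianDet (H.fiberPoly a b) H.B = C (eval ![b, -a] H.B) * jacobianDet H.A H.B ∧
    jacobianDet (H.fiberPoly a b) H.A = C (eval ![b, -a] H.A) * jacobianDet H.A H.B := by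
  constructor <;>
    simp only [jacobianDet, fiberPoly, map_sub, pderiv_mul, pderiv_C] <;> ring

theorem fiberPoly_isHomogeneous (a b : ℂ) : (H.fiberPoly a b).IsHomogeneous d := by
  rw [fiberPoly, mul_comm]
  exact (H.homogeneous_A.C_mul _).sub (H.homogeneous_B.C_mul _)

theorem eval_fiberPoly_self (a b : ℂ) : eval ![b, -a] (H.fiberPoly a b) = 0 := by
  simp only [fiberPoly, map_sub, map_mul, eval_C]
  ring

/-- Turns non-invariance into the non-vanishing of `x A + y B` at `(b, -a)`. -/
theorem ne_zero_of_not_isInvariantLine {a b : ℂ} (hv : ![b, -a] ≠ 0)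
    (h : ¬ H.IsInvariantLine a b) : b * eval ![b, -a] H.A - a * eval ![b, -a] H.B ≠ 0 := by
  intro h0
  refine h (linForm_dvd_of_eval ((H.homogeneous_B.C_mul a).sub (H.homogeneous_A.C_mul b)) hv ?_)
  simp only [map_sub, map_mul, eval_C]
  linear_combination -h0

/-- The order of a transverse inflection line is read off from the fibre of the Gauss map. -/
theorem exists_fiberPoly_eq (hd : d ≠ 0) {a b : ℂ} (hv : ![b, -a] ≠ 0) {ν : ℕ}
    (hT : H.IsTransverseInflectionLine a b (ν - 1)) :
    ∃ (e : ℕ) (P : MvPolynomial (Fin 2) ℂ), P.IsHomogeneous e ∧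
      linForm a b ^ ν * P = H.fiberPoly a b ∧ eval ![b, -a] P ≠ 0 := by
  obtain ⟨hinv, hν, hmult⟩ := hT
  have hΘ := H.ne_zero_of_not_isInvariantLine hv hinv
  -- `D` is whichever of `A`, `B` does not vanish at `(b, -a)`. Its Jacobian with the fibre
  -- polynomial is then a nonzero multiple of that of `A` and `B`.
  obtain ⟨D, c, hD, hDv, hc, hJ⟩ : ∃ (D : MvPolynomial (Fin 2) ℂ) (c : ℂ), D.IsHomogeneous d ∧
      eval ![b, -a] D ≠ 0 ∧ c ≠ 0 ∧ jacobianDet (H.fiberPoly a b) D = C c * jacobianDet H.A H.B := by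
    by_cases hA : eval ![b, -a] H.A = 0
    · have hB := H.eval_ne_zero_of_eval_eq_zero hv hA
      exact ⟨H.B, _, H.homogeneous_B, hB, hB, (H.jacobianDet_fiberPoly a b).1⟩
    · exact ⟨H.A, _, H.homogeneous_A, hA, hA, (H.jacobianDet_fiberPoly a b).2⟩
  have hcd : c * d ≠ 0 := mul_ne_zero hc (by exact_mod_cast hd)
  have hI : C (c * d) * H.inflectionPoly =
      -((X 0 * H.A + X 1 * H.B) * jacobianDet (H.fiberPoly a b) D) := by
    have := H.natCast_mul_inflectionPoly
    rw [hJ, map_mul, map_natCast]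
    linear_combination C c * this
  have hF0 : H.fiberPoly a b ≠ 0 := by
    intro h0
    rw [h0] at hI
    have h1 : H.inflectionPoly = 0 := by
      have : C (c * d) * H.inflectionPoly = 0 := by rw [hI]; simp [jacobianDet]
      exact (mul_eq_zero.1 this).resolve_left (C_eq_zero.not.2 hcd)
    rw [h1, emultiplicity_zero] at hmult
    exact absurd hmult (ENat.top_ne_natCast _)
  obtain ⟨k, e, P, hP, hPe, hPv⟩ := (H.fiberPoly_isHomogeneous a b).exists_linForm_pow_mul hv hF0
  have hk : k ≠ 0 := by
    rintro rfl
    apply hPv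
    rw [pow_zero, one_mul] at hPe
    rw [← hPe, eval_fiberPoly_self]
  obtain ⟨k, rfl⟩ := Nat.exists_eq_succ_of_ne_zero hk
  obtain ⟨S, hS, hSv⟩ := jacobianDet_linForm_pow_mul (k := k) hD hd hDv hPv
  rw [hPe, Nat.succ_eq_add_one, hS] at hI
  have hmult' : emultiplicity (linForm a b) H.inflectionPoly = k := by
    refine emultiplicity_linForm hv hcd (S := -((X 0 * H.A + X 1 * H.B) * S)) (by rw [hI]; ring) ?_
    simp only [map_neg, map_mul, map_add, eval_X]
    refine neg_ne_zero.2 (mul_ne_zero ?_ hSv)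
    simp only [Matrix.cons_val_zero, Matrix.cons_val_one, Matrix.cons_val_fin_one]
    intro h
    apply hΘ
    linear_combination h
  rw [hmult'] at hmult
  have hkν : k = ν - 1 := by exact_mod_cast hmult
  have : k + 1 = ν := by omega
  exact ⟨e, P, hP, by rw [hPe, ← this], hPv⟩

end HomogeneousFoliation

/-! ### Critical points of the Gauss map in the fibre. -/

namespace HomogeneousFoliation

variable {d : ℕ} (H : HomogeneousFoliation d)

theorem gaussLift_pair (x y : ℂ) :
    H.gaussLift ![y, x] = ![-(eval ![x, y] H.A), eval ![x, y] H.B] := rfl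

theorem gaussLift_pair_ne_zero {x y : ℂ} (h : ![y, x] ≠ 0) :
    ![-(eval ![x, y] H.A), eval ![x, y] H.B] ≠ 0 := by
  rw [← gaussLift_pair]
  exact H.gaussLift_ne_zero h

theorem rep_mk_pair {x y : ℂ} (h : ![y, x] ≠ 0) :
    ∃ c : ℂ, c ≠ 0 ∧ (Projectivization.mk ℂ ![y, x] h).rep = ![c * y, c * x] := by
  obtain ⟨c, hc⟩ := Projectivization.exists_smul_eq_mk_rep ℂ ![y, x] h
  refine ⟨c, c.ne_zero, ?_⟩
  rw [← hc]
  funext i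
  fin_cases i <;> rfl

theorem gaussMap_mk {x y : ℂ} (h : ![y, x] ≠ 0) : H.gaussMap (Projectivization.mk ℂ ![y, x] h) =
    Projectivization.mk ℂ ![-(eval ![x, y] H.A), eval ![x, y] H.B]
      (H.gaussLift_pair_ne_zero h) := by
  obtain ⟨c, hc, hrep⟩ := rep_mk_pair h
  rw [gaussMap, Projectivization.mk_eq_mk_iff']
  refine ⟨c ^ d, ?_⟩
  rw [hrep, gaussLift_pair, H.homogeneous_A.eval_scale, H.homogeneous_B.eval_scale]
  funext i
  fin_cases i
  · simp
  · simp

theorem exists_smul_of_det_eq_zero {u₀ u₁ w₀ w₁ : ℂ} (hu : ![u₀, u₁] ≠ 0)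
    (h : w₀ * u₁ = w₁ * u₀) : ∃ c : ℂ, w₀ = c * u₀ ∧ w₁ = c * u₁ := by
  by_cases h0 : u₀ = 0
  · have h1 : u₁ ≠ 0 := by
      rintro rfl
      exact hu (by simp [h0])
    refine ⟨w₁ / u₁, ?_, by field_simp⟩
    rw [h0, mul_zero] at h ⊢
    exact (mul_eq_zero.1 h).resolve_right h1
  · refine ⟨w₀ / u₀, by field_simp, ?_⟩
    field_simp
    linear_combination -h

/-- A nonfixed critical point in the fibre of the line lies on the line. -/
theorem eval_linForm_eq_zero_of_gradient {a b : ℂ} (hab : ![-a, b] ≠ 0)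
    (hfib : H.nonFixedCriticalPointsInFiber (Projectivization.mk ℂ ![-a, b] hab)
      = {Projectivization.mk ℂ ![-a, b] hab}) {x y : ℂ}
    (hxy : x * eval ![b, -a] H.A + y * eval ![b, -a] H.B ≠ 0)
    (h0 : eval ![x, y] (H.fiberPoly a b) = 0)
    (h1 : ∀ i, eval ![x, y] (pderiv i (H.fiberPoly a b)) = 0) : a * x + b * y = 0 := by
  have hne : ![y, x] ≠ 0 := by
    intro h
    have hy : y = 0 := congrFun h 0
    have hx : x = 0 := congrFun h 1
    exact hxy (by simp [hx, hy])
  set A₀ := eval ![b, -a] H.A with hA₀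
  set B₀ := eval ![b, -a] H.B with hB₀
  have hU : ![-A₀, B₀] ≠ 0 := H.gaussLift_pair_ne_zero hab
  have hdet : ∀ s t : ℂ, eval ![s, t] (H.fiberPoly a b) =
      eval ![s, t] H.A * B₀ - A₀ * eval ![s, t] H.B := fun s t => by
    simp [fiberPoly, hA₀, hB₀]
  have hpd : ∀ (i : Fin 2) (s t : ℂ), eval ![s, t] (pderiv i (H.fiberPoly a b)) =
      eval ![s, t] (pderiv i H.A) * B₀ - A₀ * eval ![s, t] (pderiv i H.B) := fun i s t => by
    simp [fiberPoly, hA₀, hB₀]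
    ring
  have hz₀ : H.gaussMap (Projectivization.mk ℂ ![-a, b] hab) = Projectivization.mk ℂ ![-A₀, B₀] hU :=
    H.gaussMap_mk hab
  have hz : H.gaussMap (Projectivization.mk ℂ ![y, x] hne) = Projectivization.mk ℂ ![-A₀, B₀] hU := by
    rw [H.gaussMap_mk hne, Projectivization.mk_eq_mk_iff']
    rw [hdet] at h0
    obtain ⟨c, hc0, hc1⟩ := exists_smul_of_det_eq_zero (w₀ := -(eval ![x, y] H.A))
      (w₁ := eval ![x, y] H.B) hU (by linear_combination -h0)
    refine ⟨c, ?_⟩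
    rw [hc0, hc1]
    simp
  have hmem : Projectivization.mk ℂ ![y, x] hne ∈
      H.nonFixedCriticalPointsInFiber (Projectivization.mk ℂ ![-a, b] hab) := by
    refine ⟨hz.trans hz₀.symm, fun s t => ?_, ?_⟩
    · obtain ⟨c, hc, hrep⟩ := rep_mk_pair hne
      rw [hrep]
      simp only [Matrix.cons_val_zero, Matrix.cons_val_one, Matrix.cons_val_fin_one]
      rw [gaussLift_pair]
      have hdc : eval ![c * x, c * y] H.A * B₀ - A₀ * eval ![c * x, c * y] H.B = 0 := by
        rw [← hdet, (H.fiberPoly_isHomogeneous a b).eval_scale, h0, mul_zero]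
      have hpc : ∀ i : Fin 2, eval ![c * x, c * y] (pderiv i H.A) * B₀ -
          A₀ * eval ![c * x, c * y] (pderiv i H.B) = 0 := fun i => by
        have := (H.fiberPoly_isHomogeneous a b).eval_pderiv_scale i c x y
        rw [h1, mul_zero, hpd] at this
        exact (mul_eq_zero.1 this).resolve_left hc
      obtain ⟨r, hr0, hr1⟩ := exists_smul_of_det_eq_zero (w₀ := -(eval ![c * x, c * y] H.A))
        (w₁ := eval ![c * x, c * y] H.B) hU (by linear_combination -hdc)
      obtain ⟨r', hr0', hr1'⟩ := exists_smul_of_det_eq_zero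
        (w₀ := -(s * eval ![c * x, c * y] (pderiv 0 H.A) + t * eval ![c * x, c * y] (pderiv 1 H.A)))
        (w₁ := s * eval ![c * x, c * y] (pderiv 0 H.B) + t * eval ![c * x, c * y] (pderiv 1 H.B)) hU
        (by linear_combination -s * hpc 0 - t * hpc 1)
      have hr : r ≠ 0 := by
        rintro rfl
        have hne' : ![c * y, c * x] ≠ 0 := by
          rw [← hrep]
          exact Projectivization.rep_nonzero _
        apply H.gaussLift_ne_zero hne'
        rw [gaussLift_pair, hr0, hr1]
        simp
      rw [Submodule.mem_span_singleton, hr0, hr1, hr0', hr1']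
      refine ⟨r' / r, ?_⟩
      funext i
      fin_cases i
      · simp
        field_simp
      · simp
        field_simp
    -- A fixed point would make `(y, x)` proportional to `(-A₀, B₀)`, hence `x A₀ + y B₀ = 0`.
    · rw [hz, Ne, Projectivization.mk_eq_mk_iff']
      rintro ⟨c, hc⟩
      have e0 : c * y = -A₀ := congrFun hc 0
      have e1 : c * x = B₀ := congrFun hc 1
      apply hxy
      linear_combination x * e0 - y * e1
  rw [hfib, Set.mem_singleton_iff, Projectivization.mk_eq_mk_iff'] at hmem
  obtain ⟨c, hc⟩ := hmem
  have e0 : c * -a = y := congrFun hc 0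
  have e1 : c * b = x := congrFun hc 1
  rw [← e0, ← e1]
  ring

end HomogeneousFoliation

/-! ### Exchange of the variables and the two charts of the dual plane. -/

namespace MvPolynomial

/-- Exchange of the two variables. -/
noncomputable def swapVars : MvPolynomial (Fin 2) ℂ →ₐ[ℂ] MvPolynomial (Fin 2) ℂ :=
  rename (Equiv.swap 0 1)

theorem eval_swapVars (f : MvPolynomial (Fin 2) ℂ) (x y : ℂ) :
    eval ![x, y] (swapVars f) = eval ![y, x] f := by
  rw [swapVars, eval_rename]
  congr 1
  congr 1
  funext i
  fin_cases i <;> rfl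

theorem pderiv_zero_swapVars (f : MvPolynomial (Fin 2) ℂ) :
    pderiv 0 (swapVars f) = swapVars (pderiv 1 f) := by
  have := pderiv_rename (Equiv.swap (0 : Fin 2) 1).injective 1 f
  rwa [Equiv.swap_apply_right] at this

theorem pderiv_one_swapVars (f : MvPolynomial (Fin 2) ℂ) :
    pderiv 1 (swapVars f) = swapVars (pderiv 0 f) := by
  have := pderiv_rename (Equiv.swap (0 : Fin 2) 1).injective 0 f
  rwa [Equiv.swap_apply_left] at this

theorem swapVars_linForm (a b : ℂ) : swapVars (linForm a b) = linForm b a := by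
  simp [swapVars, linForm]
  ring

theorem swapVars_C (c : ℂ) : swapVars (C c) = C c := by simp [swapVars]

theorem IsHomogeneous.swapVars {f : MvPolynomial (Fin 2) ℂ} {n : ℕ} (hf : f.IsHomogeneous n) :
    (swapVars f).IsHomogeneous n := hf.rename_isHomogeneous

end MvPolynomial

namespace HomogeneousFoliation

variable {d : ℕ} (H : HomogeneousFoliation d)

theorem curvatureHolomorphicAt_leg₁_iff (hd : 2 ≤ d) {n e : ℕ} {a b : ℂ} (hab : ![-a, b] ≠ 0)
    (hΘ : b * eval ![b, -a] H.A - a * eval ![b, -a] H.B ≠ 0)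
    (hfib : H.nonFixedCriticalPointsInFiber (Projectivization.mk ℂ ![-a, b] hab)
      = {Projectivization.mk ℂ ![-a, b] hab})
    {P : MvPolynomial (Fin 2) ℂ} (hP : P.IsHomogeneous e)
    (hF : linForm a b ^ (n + 2) * P = H.fiberPoly a b) (hPv : eval ![b, -a] P ≠ 0)
    (hB : eval ![b, -a] H.B ≠ 0) {q : ℂ} (hq : q ≠ 0) :
    PlanarWeb.CurvatureHolomorphicAt d H.leg₁ (-eval ![b, -a] H.A / eval ![b, -a] H.B, q) ↔
      eval ![b, -a] (H.criterionPoly (n + 2) P) = 0 := by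
  set A₀ := eval ![b, -a] H.A with hA₀
  set B₀ := eval ![b, -a] H.B with hB₀
  have hΦ : C B₀ * (H.A + C (-A₀ / B₀) * H.B) = H.fiberPoly a b := by
    rw [mul_add, ← mul_assoc, ← C_mul, mul_div_cancel₀ _ hB, fiberPoly, map_neg]
    ring
  have hp : -A₀ / B₀ * B₀ = -A₀ := by field_simp
  rw [PlanarWeb.curvatureHolomorphicAt_iff_of_forms (n := n) hd H.homogeneous_A H.homogeneous_B hP
    (fun x y => H.eval_ne_zero_of_eval_eq_zero) (W := H.leg₁) (fun z ξ => rfl) (a := a) (b := b)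
    (by ring) (fun h => hΘ ?_) (fun h => hΘ ?_) hB hB (hΦ.trans hF.symm) hPv
    (fun x y hxy h0 h1 => H.eval_linForm_eq_zero_of_gradient hab hfib ?_ ?_ fun i => ?_) hq]
  · have : (((n + 2 : ℕ) : ℂ) + 1) = n + 3 := by
      push_cast
      ring
    rw [criterionPoly, this, show ((n + 2 : ℕ) : ℂ) - 2 = n by push_cast; ring]
  · linear_combination -B₀ * h + b * hp
  · linear_combination -B₀ * h + b * hp
  · intro h
    apply hxy
    apply mul_left_cancel₀ hB
    linear_combination x * hp - h
  · rw [← hΦ, map_mul, h0, mul_zero]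
  · rw [← hΦ, pderiv_C_mul, map_mul, h1, mul_zero]

/-- Exchanging `x` and `y`, and with them `A` and `B`, turns this chart into the first. The
criterion polynomial only changes sign. -/
theorem curvatureHolomorphicAt_leg₂_iff (hd : 2 ≤ d) {n e : ℕ} {a b : ℂ} (hab : ![-a, b] ≠ 0)
    (hΘ : b * eval ![b, -a] H.A - a * eval ![b, -a] H.B ≠ 0)
    (hfib : H.nonFixedCriticalPointsInFiber (Projectivization.mk ℂ ![-a, b] hab)
      = {Projectivization.mk ℂ ![-a, b] hab})
    {P : MvPolynomial (Fin 2) ℂ} (hP : P.IsHomogeneous e)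
    (hF : linForm a b ^ (n + 2) * P = H.fiberPoly a b) (hPv : eval ![b, -a] P ≠ 0)
    (hA : eval ![b, -a] H.A ≠ 0) {q : ℂ} (hq : q ≠ 0) :
    PlanarWeb.CurvatureHolomorphicAt d H.leg₂ (-eval ![b, -a] H.B / eval ![b, -a] H.A, q) ↔
      eval ![b, -a] (H.criterionPoly (n + 2) P) = 0 := by
  set A₀ := eval ![b, -a] H.A with hA₀
  set B₀ := eval ![b, -a] H.B with hB₀
  -- The scalar is `-A₀` because the roles of `A` and `B` in the fibre determinant are exchanged.
  have hΦ : C (-A₀) * (swapVars H.B + C (-B₀ / A₀) * swapVars H.A) =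
      swapVars (H.fiberPoly a b) := by
    rw [mul_add, ← mul_assoc, ← C_mul, neg_mul, mul_div_cancel₀ _ hA, fiberPoly, map_sub, map_mul,
      map_mul, swapVars_C, swapVars_C, map_neg, neg_neg]
    ring
  have hp : -B₀ / A₀ * A₀ = -B₀ := by field_simp
  have hco : ∀ x y, ![x, y] ≠ 0 → eval ![x, y] (swapVars H.B) = 0 →
      eval ![x, y] (swapVars H.A) ≠ 0 := by
    intro x y hxy h1 h2
    rw [eval_swapVars] at h1 h2
    refine H.eval_ne_zero_of_eval_eq_zero (fun h => hxy ?_) h2 h1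
    have hy : y = 0 := congrFun h 0
    have hx : x = 0 := congrFun h 1
    rw [hx, hy]
    simp
  have hleg : ∀ z ξ : ℂ × ℂ, H.leg₂ z ξ =
      eval ![ξ.2, z.1 * ξ.2 - z.2 * ξ.1] (swapVars H.B) +
        z.1 * eval ![ξ.2, z.1 * ξ.2 - z.2 * ξ.1] (swapVars H.A) := by
    intro z ξ
    rw [eval_swapVars, eval_swapVars, add_comm]
    rfl
  have hk : -B₀ / A₀ * -a - b ≠ 0 := fun h => hΘ (by linear_combination -A₀ * h - a * hp)
  have hκ : b + a * (-B₀ / A₀) ≠ 0 := fun h => hΘ (by linear_combination A₀ * h - a * hp)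
  have hcrit : ∀ x y, -B₀ / A₀ * x - y ≠ 0 →
      eval ![x, y] (swapVars H.B + C (-B₀ / A₀) * swapVars H.A) = 0 →
      (∀ i, eval ![x, y] (pderiv i (swapVars H.B + C (-B₀ / A₀) * swapVars H.A)) = 0) →
      b * x + a * y = 0 := by
    intro x y hxy h0 h1
    have h3 : ∀ j, eval ![x, y] (pderiv j (swapVars (H.fiberPoly a b))) = 0 := fun j => by
      rw [← hΦ, pderiv_C_mul, map_mul, h1, mul_zero]
    have h2 := H.eval_linForm_eq_zero_of_gradient hab hfib (x := y) (y := x) (fun h => hxy ?_) ?_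
      fun i => ?_
    · linear_combination h2
    · apply mul_left_cancel₀ hA
      linear_combination x * hp - h
    · rw [← eval_swapVars, ← hΦ, map_mul, h0, mul_zero]
    · rw [← eval_swapVars]
      fin_cases i
      · exact (congrArg _ (pderiv_one_swapVars _)).symm.trans (h3 1)
      · exact (congrArg _ (pderiv_zero_swapVars _)).symm.trans (h3 0)
  rw [PlanarWeb.curvatureHolomorphicAt_iff_of_forms (n := n) (P := swapVars P) (v₀ := -a) (v₁ := b) hd
    H.homogeneous_B.swapVars H.homogeneous_A.swapVars hP.swapVars hco hleg (a := b) (b := a) (by ring)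
    hk hκ (by rwa [eval_swapVars]) (neg_ne_zero.2 hA)
    (hΦ.trans (by rw [← hF, map_mul, map_pow, swapVars_linForm])) (by rwa [eval_swapVars]) hcrit hq]
  have h3 : (((n + 2 : ℕ) : ℂ) + 1) = n + 3 := by
    push_cast
    ring
  rw [criterionPoly, h3, show ((n + 2 : ℕ) : ℂ) - 2 = n by push_cast; ring, ← neg_eq_zero]
  simp only [pderiv_zero_swapVars, pderiv_one_swapVars, map_add, map_sub, map_mul, eval_swapVars,
    eval_C]
  constructor <;> intro h <;> linear_combination h

/-- The tangent line at the point `t (b, -a)`. -/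
theorem tangentLine_ne_zero {a b : ℂ} (hv : ![b, -a] ≠ 0) (s : ℂ) :
    ![eval ![b, -a] H.A, eval ![b, -a] H.B, s] ≠ 0 := by
  intro h
  have hA : eval ![b, -a] H.A = 0 := congrFun h 0
  have hB : eval ![b, -a] H.B = 0 := congrFun h 1
  exact H.eval_ne_zero_of_eval_eq_zero hv hA hB

/-- By homogeneity the tangents at the points `t (b, -a)` differ only in their constant term, which
is linear in `t`. The value `t = 0` is excluded because the origin is singular. -/
theorem mem_gaussImageOfLine_iff (hd : d ≠ 0) {a b : ℂ} (hv : ![b, -a] ≠ 0) (ℓ : DualPlane) :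
    ℓ ∈ H.gaussImageOfLine a b ↔ ∃ t : ℂ, t ≠ 0 ∧ ℓ = Projectivization.mk ℂ _
      (H.tangentLine_ne_zero hv
        (-(t * (b * eval ![b, -a] H.A - a * eval ![b, -a] H.B)))) := by
  constructor
  · rintro ⟨x, y, h, hxy, rfl⟩
    obtain ⟨t, hx, hy⟩ : ∃ t, x = t * b ∧ y = t * -a :=
      exists_smul_of_det_eq_zero hv (by linear_combination -hxy)
    subst hx hy
    have ht : t ≠ 0 := by
      rintro rfl
      apply h
      rw [H.homogeneous_A.eval_scale, H.homogeneous_B.eval_scale, zero_pow hd]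
      simp
    refine ⟨t, ht, ?_⟩
    rw [Projectivization.mk_eq_mk_iff']
    refine ⟨t ^ d, ?_⟩
    rw [H.homogeneous_A.eval_scale, H.homogeneous_B.eval_scale]
    funext i
    fin_cases i
    · simp
    · simp
    · simp
      ring
  · rintro ⟨t, ht, rfl⟩
    have h1 : ![eval ![t * b, t * -a] H.A, eval ![t * b, t * -a] H.B,
        -(t * b * eval ![t * b, t * -a] H.A + t * -a * eval ![t * b, t * -a] H.B)] =
        t ^ d • ![eval ![b, -a] H.A, eval ![b, -a] H.B,
          -(t * (b * eval ![b, -a] H.A - a * eval ![b, -a] H.B))] := by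
      rw [H.homogeneous_A.eval_scale, H.homogeneous_B.eval_scale]
      funext i
      fin_cases i
      · simp
      · simp
      · simp
        ring
    refine ⟨t * b, t * -a, ?_, by ring, ?_⟩
    · rw [h1]
      exact smul_ne_zero (pow_ne_zero _ ht) (H.tangentLine_ne_zero hv _)
    · rw [eq_comm, Projectivization.mk_eq_mk_iff']
      exact ⟨t ^ d, h1.symm⟩

theorem infinite_gaussImageOfLine (hd : d ≠ 0) {a b : ℂ} (hv : ![b, -a] ≠ 0)
    (hΘ : b * eval ![b, -a] H.A - a * eval ![b, -a] H.B ≠ 0) :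
    (H.gaussImageOfLine a b).Infinite := by
  refine Set.infinite_of_injective_forall_mem (α := ℕ) (f := fun m => Projectivization.mk ℂ _
    (H.tangentLine_ne_zero hv
      (-(((m + 1 : ℕ) : ℂ) * (b * eval ![b, -a] H.A - a * eval ![b, -a] H.B))))) ?_ fun m =>
    (H.mem_gaussImageOfLine_iff hd hv _).2 ⟨_, Nat.cast_ne_zero.2 m.succ_ne_zero, rfl⟩
  intro m m' h
  simp only [Projectivization.mk_eq_mk_iff'] at h
  obtain ⟨c, hc⟩ := h
  have e0 : c * eval ![b, -a] H.A = eval ![b, -a] H.A := congrFun hc 0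
  have e1 : c * eval ![b, -a] H.B = eval ![b, -a] H.B := congrFun hc 1
  have e2 : c * -(((m' + 1 : ℕ) : ℂ) * (b * eval ![b, -a] H.A - a * eval ![b, -a] H.B)) =
      -(((m + 1 : ℕ) : ℂ) * (b * eval ![b, -a] H.A - a * eval ![b, -a] H.B)) := congrFun hc 2
  have hc1 : c = 1 := by
    apply mul_right_cancel₀ hΘ
    linear_combination b * e0 - a * e1
  rw [hc1, one_mul, neg_inj] at e2
  have := mul_right_cancel₀ hΘ e2
  have h3 : m' + 1 = m + 1 := by exact_mod_cast this
  omega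

end HomogeneousFoliation

theorem corollary3p6 (d : ℕ) (hd : 3 ≤ d) (H : HomogeneousFoliation d) (a b : ℂ)
    (hab : ![-a, b] ≠ 0) (ν : ℕ)
    (hT : H.IsTransverseInflectionLine a b (ν - 1))
    (hfib : H.nonFixedCriticalPointsInFiber (Projectivization.mk ℂ ![-a, b] hab)
      = {Projectivization.mk ℂ ![-a, b] hab}) :
    ∃ P : MvPolynomial (Fin 2) ℂ, linForm a b ^ ν * P = H.fiberPoly a b ∧
      (H.LegCurvatureHolomorphicOn (H.gaussImageOfLine a b) ↔
        MvPolynomial.eval ![b, -a] (H.criterionPoly ν P) = 0) := by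
  have hv : ![b, -a] ≠ 0 := by
    intro h
    apply hab
    have hb : b = 0 := congrFun h 0
    have ha : -a = 0 := congrFun h 1
    rw [ha, hb]
    simp
  have hd0 : d ≠ 0 := by omega
  have hd2 : 2 ≤ d := by omega
  have hΘ := H.ne_zero_of_not_isInvariantLine hv hT.1
  obtain ⟨e, P, hP, hF, hPv⟩ := H.exists_fiberPoly_eq hd0 hv hT
  -- The inflection order is at least one, so `ν ≥ 2` and the truncated `ν - 1` is harmless.
  obtain ⟨n, rfl⟩ : ∃ n, ν = n + 2 := ⟨ν - 2, by have := hT.2.1; omega⟩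
  refine ⟨P, hF, fun h => ?_, fun hQ => ?_⟩
  -- The image curve is infinite, so the curvature is holomorphic at some point of it; one point
  -- already forces `Q = 0`.
  · obtain ⟨ℓ, hℓ, hℓ'⟩ := (H.infinite_gaussImageOfLine hd0 hv hΘ).exists_notMem_finite h
    have hhol : H.LegCurvatureHolomorphicAt ℓ := by
      by_contra hcon
      exact hℓ' ⟨hℓ, hcon⟩
    obtain ⟨t, ht, rfl⟩ := (H.mem_gaussImageOfLine_iff hd0 hv ℓ).1 hℓ
    by_cases hB : eval ![b, -a] H.B = 0
    · have hA : eval ![b, -a] H.A ≠ 0 := fun hA => H.eval_ne_zero_of_eval_eq_zero hv hA hB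
      have hq : -(t * (b * eval ![b, -a] H.A - a * eval ![b, -a] H.B)) / eval ![b, -a] H.A ≠ 0 :=
        div_ne_zero (neg_ne_zero.2 (mul_ne_zero ht hΘ)) hA
      refine (H.curvatureHolomorphicAt_leg₂_iff hd2 hab hΘ hfib hP hF hPv hA hq).1 (hhol.2 _ ?_)
      rw [dualChart₂, Projectivization.mk_eq_mk_iff']
      refine ⟨-(eval ![b, -a] H.A)⁻¹, ?_⟩
      funext i
      fin_cases i
      · simp [hA]
      · simp
        ring
      · simp
        ring
    · have hq : -(t * (b * eval ![b, -a] H.A - a * eval ![b, -a] H.B)) / eval ![b, -a] H.B ≠ 0 :=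
        div_ne_zero (neg_ne_zero.2 (mul_ne_zero ht hΘ)) hB
      refine (H.curvatureHolomorphicAt_leg₁_iff hd2 hab hΘ hfib hP hF hPv hB hq).1 (hhol.1 _ ?_)
      rw [dualChart₁, Projectivization.mk_eq_mk_iff']
      refine ⟨-(eval ![b, -a] H.B)⁻¹, ?_⟩
      funext i
      fin_cases i
      · simp
        ring
      · simp [hB]
      · simp
        ring
  -- Conversely the criterion does not involve `q`, so the exceptional set is empty. Every chart
  -- containing the point has to be checked.
  · refine Set.Finite.subset Set.finite_empty ?_
    rintro ℓ ⟨hℓ, hnot⟩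
    refine (hnot ?_).elim
    obtain ⟨t, ht, rfl⟩ := (H.mem_gaussImageOfLine_iff hd0 hv ℓ).1 hℓ
    constructor
    · rintro ⟨p, q⟩ hpq
      rw [dualChart₁, Projectivization.mk_eq_mk_iff'] at hpq
      obtain ⟨c, hc⟩ := hpq
      have e0 : c * eval ![b, -a] H.A = p := congrFun hc 0
      have e1 : c * eval ![b, -a] H.B = -1 := congrFun hc 1
      have e2 : c * -(t * (b * eval ![b, -a] H.A - a * eval ![b, -a] H.B)) = -q := congrFun hc 2
      have hB : eval ![b, -a] H.B ≠ 0 := by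
        intro h
        simp [h] at e1
      have hc0 : c ≠ 0 := by
        rintro rfl
        simp at e1
      have hp : p = -eval ![b, -a] H.A / eval ![b, -a] H.B := by
        rw [eq_div_iff hB]
        linear_combination -eval ![b, -a] H.B * e0 + eval ![b, -a] H.A * e1
      have hq : q ≠ 0 := by
        rintro rfl
        rw [neg_zero] at e2
        exact mul_ne_zero hc0 (neg_ne_zero.2 (mul_ne_zero ht hΘ)) e2
      rw [hp]
      exact (H.curvatureHolomorphicAt_leg₁_iff hd2 hab hΘ hfib hP hF hPv hB hq).2 hQ
    · rintro ⟨p, q⟩ hpq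
      rw [dualChart₂, Projectivization.mk_eq_mk_iff'] at hpq
      obtain ⟨c, hc⟩ := hpq
      have e0 : c * eval ![b, -a] H.A = -1 := congrFun hc 0
      have e1 : c * eval ![b, -a] H.B = p := congrFun hc 1
      have e2 : c * -(t * (b * eval ![b, -a] H.A - a * eval ![b, -a] H.B)) = -q := congrFun hc 2
      have hA : eval ![b, -a] H.A ≠ 0 := by
        intro h
        simp [h] at e0
      have hc0 : c ≠ 0 := by
        rintro rfl
        simp at e0
      have hp : p = -eval ![b, -a] H.B / eval ![b, -a] H.A := by
        rw [eq_div_iff hA]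
        linear_combination -eval ![b, -a] H.A * e1 + eval ![b, -a] H.B * e0
      have hq : q ≠ 0 := by
        rintro rfl
        rw [neg_zero] at e2
        exact mul_ne_zero hc0 (neg_ne_zero.2 (mul_ne_zero ht hΘ)) e2
      rw [hp]
      exact (H.curvatureHolomorphicAt_leg₂_iff hd2 hab hΘ hfib hP hF hPv hA hq).2 hQ
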